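/- Let $r\ge 1$ be an integer, $\kappa\in(0,1]$ and $M>0$, all independent of $N$, and put $q=N^{\kappa}$. For each $N$ let $\gamma^{(k)}_i$ ($1\le k\le r$, $1\le i\le N$) be real numbers and $H=(h_{ij})$ a random real symmetric $N\times N$ matrix whose entries $h_{ij}$, $i\le j$, are independent. Write $s_{ij}=\mathbb E|h_{ij}|^2$ and assume that, for all sufficiently large $N$, $$\mathbb E h_{ij}=0,\qquad s_{ij}=\frac1N\sum_{k=1}^r\gamma^{(k)}_i\gamma^{(k)}_j,\qquad \mathbb E|h_{ij}|^k\le \frac{s_{ij}}{q^{k/2-1}}\ \text{ for every integer } k\ge 3,$$ $$\gamma^{(k)}_i\ge 1,\qquad \frac1N\sum_{k,i}(\gamma^{(k)}_i)^2\le M,\qquad q\,s_{ij}\le 1$$ (a generalized Chung–Lu ensemble). Put $\theta_i=\sum_{k=1}^r\gamma^{(k)}_i$ and $G(z)=(H-z)^{-1}$. For $z$ in the upper half-plane $\mathbb C^+$ let $(u^{(k)}(z))_{1\le k\le r}\in(\mathbb C^+)^r$ be the solution of $$u^{(k)}(z)=-\frac1N\sum_{i=1}^N\frac{\gamma^{(k)}_i}{z+\sum_{j=1}^r\gamma^{(j)}_iu^{(j)}(z)}\qquad(1\le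 k\le r),$$ and set $$g_i(z)=-\frac{1}{z+\sum_{j}\gamma^{(j)}_iu^{(j)}(z)},\qquad m(z)=\frac1N\sum_{i=1}^N g_i(z).$$ (All these objects depend on $N$.) Let $$\Lambda(z)=\max\Big\{\max_i\theta_i|G_{ii}(z)-g_i(z)|,\ \max_{i\ne j}\sqrt{\theta_i\theta_j}\,|G_{ij}(z)|\Big\},\qquad \Phi(z)=\frac1{\sqrt q}+\frac1{\sqrt{N\eta}},\quad \eta=\operatorname{Im}z .$$ Let $I\subset\mathbb R$ be a bulk interval, i.e. a bounded interval for which there is a constant $c_I>0$ independent of $N$ such that, for all sufficiently large $N$, $\operatorname{Im}m(E+i\eta)>c_I$ for all $E\in I$ and $0<\eta\le 1$. Fix $\delta>0$ and let $$\mathcal D^I_\delta=\{E+i\eta:\ E\in I,\ N^{\delta-1}\le\eta\le 10\}.$$ Then $\Lambda\prec\Phi$ uniformly on $\mathcal D^I_\delta$: for all $\varepsilon>0$ and $D>0$ one has $$\sup_{z\in\mathcal D^I_\delta}\mathbb P\big[\Lambda(z)>N^{\varepsilon}\,\Phi(z)\big]\le N^{-D}$$ for all sufficiently large $N$. -/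

import Mathlib

open MeasureTheory ProbabilityTheory Filter Topology

namespace ChungLu

noncomputable section

/-- The sparsity parameter `q = N ^ κ`. -/
def sparsity (κ : ℝ) (N : ℕ) : ℝ := (N : ℝ) ^ κ

/-- The rank-`r` variance profile `s i j = (1 / N) * ∑ k, γ k i * γ k j`. -/
def varianceProfile {N r : ℕ} (γ : Fin r → Fin N → ℝ) (i j : Fin N) : ℝ :=
  (1 / (N : ℝ)) * ∑ k, γ k i * γ k j

/-- The weights `θ i = ∑ k, γ k i`. -/
def theta {N r : ℕ} (γ : Fin r → Fin N → ℝ) (i : Fin N) : ℝ := ∑ k, γ k i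

/-- The conditions on a single `N × N` matrix `H` of a generalized Chung–Lu ensemble with
sparsity parameter `q`, bound `M` and vectors `γ`. -/
structure IsChungLuMatrix {Ω : Type*} [MeasurableSpace Ω] (P : Measure Ω) {N r : ℕ}
    (q M : ℝ) (γ : Fin r → Fin N → ℝ) (H : Ω → Matrix (Fin N) (Fin N) ℝ) : Prop where
  measurable : ∀ i j, Measurable fun ω => H ω i j
  symm : ∀ ω i j, H ω i j = H ω j i
  /-- The entries on and above the diagonal are independent. -/
  indep : iIndepFun (fun (p : {p : Fin N × Fin N // p.1 ≤ p.2}) (ω : Ω) => H ω p.1.1 p.1.2) P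
  /-- All moments are finite (so that the integrals below are genuine expectations). -/
  integrable : ∀ i j, ∀ k : ℕ, Integrable (fun ω => |H ω i j| ^ k) P
  mean : ∀ i j, ∫ ω, H ω i j ∂P = 0
  variance : ∀ i j, ∫ ω, |H ω i j| ^ 2 ∂P = varianceProfile γ i j
  moment : ∀ i j, ∀ k : ℕ, 3 ≤ k →
    ∫ ω, |H ω i j| ^ k ∂P ≤ varianceProfile γ i j / q ^ ((k : ℝ) / 2 - 1)
  one_le : ∀ k i, 1 ≤ γ k i
  sum_sq_le : (1 / (N : ℝ)) * ∑ k, ∑ i, γ k i ^ 2 ≤ M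
  sparse : ∀ i j, q * varianceProfile γ i j ≤ 1

/-- A generalized Chung–Lu ensemble: a sequence of random matrices, of size `N × N` for each `N`,
satisfying the above conditions for all large `N`, with `r`, `κ`, `M` independent of `N`.
(For small `N` the conditions may contradict each other: `γ ≥ 1` and `q * s ≤ 1` force
`r ≤ N ^ (1 - κ)`.) -/
structure IsGeneralizedChungLu {Ω : ℕ → Type*} [∀ N, MeasurableSpace (Ω N)]
    (P : ∀ N, Measure (Ω N)) {r : ℕ} (κ M : ℝ) (γ : ∀ N, Fin r → Fin N → ℝ)
    (H : ∀ N, Ω N → Matrix (Fin N) (Fin N) ℝ) : Prop where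
  rank_pos : 0 < r
  kappa_pos : 0 < κ
  kappa_le_one : κ ≤ 1
  M_pos : 0 < M
  eventually : ∀ᶠ N in atTop, IsChungLuMatrix (P N) (sparsity κ N) M (γ N) (H N)

/-- The denominator `z + ∑ j, γ j i * u j` of the self-consistent system. -/
def scDenom {N r : ℕ} (γ : Fin r → Fin N → ℝ) (z : ℂ) (u : Fin r → ℂ) (i : Fin N) : ℂ :=
  z + ∑ j, (γ j i : ℂ) * u j

/-- `u` is the solution at `z` (in the upper half-plane) of the self-consistent system
`u k = - (1 / N) * ∑ i, γ k i / (z + ∑ j, γ j i * u j)`. -/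
def IsSCSolution {N r : ℕ} (γ : Fin r → Fin N → ℝ) (z : ℂ) (u : Fin r → ℂ) : Prop :=
  ∀ k, 0 < (u k).im ∧ u k = -(1 / (N : ℂ)) * ∑ i, (γ k i : ℂ) / scDenom γ z u i

/-- `m = - (1 / N) * ∑ i, 1 / (z + ∑ j, γ j i * u j)`. -/
def scM {N r : ℕ} (γ : Fin r → Fin N → ℝ) (z : ℂ) (u : Fin r → ℂ) : ℂ :=
  -(1 / (N : ℂ)) * ∑ i, 1 / scDenom γ z u i

/-- `g i = - 1 / (z + ∑ j, γ j i * u j)`. -/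
def scG {N r : ℕ} (γ : Fin r → Fin N → ℝ) (z : ℂ) (u : Fin r → ℂ) (i : Fin N) : ℂ :=
  -(1 / scDenom γ z u i)

/-- A bulk interval: a bounded interval `I` such that, for some `c > 0` independent of `N`,
`Im m(E + iη) > c` for `E ∈ I`, `0 < η ≤ 1` (and all large `N`). -/
structure IsBulkInterval {r : ℕ} (γ : ∀ N, Fin r → Fin N → ℝ) (u : ℕ → ℂ → Fin r → ℂ)
    (I : Set ℝ) : Prop where
  ordConnected : I.OrdConnected
  bounded : Bornology.IsBounded I
  im_lower : ∃ c : ℝ, 0 < c ∧ ∀ᶠ N in atTop, ∀ E ∈ I, ∀ η : ℝ, 0 < η → η ≤ 1 →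
    c < (scM (γ N) ⟨E, η⟩ (u N ⟨E, η⟩)).im

/-- The resolvent `G(z) = (A - z)⁻¹` of a real matrix. -/
def resolvent {N : ℕ} (A : Matrix (Fin N) (Fin N) ℝ) (z : ℂ) : Matrix (Fin N) (Fin N) ℂ :=
  (A.map (fun x : ℝ => (x : ℂ)) - z • (1 : Matrix (Fin N) (Fin N) ℂ))⁻¹

/-- `Λ_d = max_i θ i * |G i i - g i|`. -/
def LambdaD {N r : ℕ} (γ : Fin r → Fin N → ℝ) (z : ℂ) (u : Fin r → ℂ)
    (A : Matrix (Fin N) (Fin N) ℝ) : ℝ :=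
  ⨆ i : Fin N, theta γ i * ‖resolvent A z i i - scG γ z u i‖

/-- `Λ_o = max_{i ≠ j} |√(θ i * θ j) * G i j|`. -/
def LambdaO {N r : ℕ} (γ : Fin r → Fin N → ℝ) (z : ℂ)
    (A : Matrix (Fin N) (Fin N) ℝ) : ℝ :=
  ⨆ p : {p : Fin N × Fin N // p.1 ≠ p.2},
    √(theta γ p.1.1 * theta γ p.1.2) * ‖resolvent A z p.1.1 p.1.2‖

/-- `Λ = max (Λ_d, Λ_o)`. -/
def Lambda {N r : ℕ} (γ : Fin r → Fin N → ℝ) (z : ℂ) (u : Fin r → ℂ)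
    (A : Matrix (Fin N) (Fin N) ℝ) : ℝ :=
  max (LambdaD γ z u A) (LambdaO γ z A)

/-- The control parameter `Φ = 1 / √q + 1 / √(N η)`, with `η = Im z`. -/
def Phi (κ : ℝ) (N : ℕ) (z : ℂ) : ℝ :=
  1 / √(sparsity κ N) + 1 / √((N : ℝ) * z.im)

/-- The spectral domain `{E + iη : E ∈ I, N ^ (δ - 1) ≤ η ≤ 10}`. -/
def spectralDomain (I : Set ℝ) (δ : ℝ) (N : ℕ) : Set ℂ :=
  {z | z.re ∈ I ∧ (N : ℝ) ^ (δ - 1) ≤ z.im ∧ z.im ≤ 10}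

/-- Stochastic domination `X ≺ Y`, uniformly in the parameter `v ∈ U N`: for all `ε, D > 0`,
`sup_{v ∈ U N} P (|X v| > N ^ ε * Y v) ≤ N ^ (-D)` for all large `N`. -/
def StochDominated {Ω : ℕ → Type*} [∀ N, MeasurableSpace (Ω N)] (P : ∀ N, Measure (Ω N))
    {α : Type*} (U : ℕ → Set α) (X Y : ∀ N, α → Ω N → ℝ) : Prop :=
  ∀ ε : ℝ, 0 < ε → ∀ D : ℝ, 0 < D → ∀ᶠ N : ℕ in atTop,
    (⨆ v ∈ U N, P N {ω | |X N v ω| > (N : ℝ) ^ ε * Y N v ω}) ≤ ENNReal.ofReal ((N : ℝ) ^ (-D))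

end

end ChungLu

/-! Write b = 1/√q. Letting k → ∞ in the moment assumption shows that the entries of `H` are almost
surely bounded by b. Row i of `H` is independent of the resolvent of the minor without index i, so
Chernoff bounds for linear and quadratic forms in bounded independent variables control all
fluctuations in Schur's formula up to a factor T = 8t², outside an event of probability O(N² e^{-t})
for each z. The complement of that event is `GoodAt`; given `GoodAt`, the argument is deterministic.

The variance profile has rank r, so ∑_k s_ik G_kk is a combination of the r averages U_k = N⁻¹ ∑_i
γ^{(k)}_i G_ii (`empU`), and Schur's formula reads 1/G_ii = -(z + ∑_j γ^{(j)}_i U_j) + error. Hence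
U nearly solves the system for u. In the bulk γ ≥ 1 gives Im u_k ≥ Im m ≥ 1/C, so g_i has size of
order 1/θ_i; this explains the weights in Λ, and why the Schur error only has to be small relative
to θ_i.

Two lemmas carry the proof. The first is `stability`: an approximate solution w with |w| bounded and
Im w bounded below is close to u, with no prior closeness required. Subtracting the equations, u - w
is controlled by the kernel N⁻¹ ∑_i γ^{(k)}_i g_i g'_i γ^{(j)}_i, where g' belongs to w. Its
absolute value nearly contracts the weight √(Im u_j · Im w_j), by taking imaginary parts of both
systems and using the arithmetic-geometric mean inequality. A strict gap comes from phases: g_i and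
g'_i lie in the upper half-plane, so Re(g_i g'_i) is smaller than |g_i g'_i| by an amount governed
by Im g_i, whose average is at least 1/C.

The second is `weighted_ward`: the error involves N⁻¹ ∑_k θ_k |G_kj|², where the θ_k are unbounded.
Indices with θ_k ≤ K are covered by the Ward identity. For the others the a priori size of Λ_o and
the bounded second moment of θ give a term of order Λ_o²/K². With K a large multiple of T this term
is absorbed on the left of the resulting inequality for Λ_o.

`bootstrap_step` combines the two: rough a priori bounds at z and `GoodAt` imply Λ ≤ T² C³⁰ Φ. The a
priori bounds hold for Im z ≥ 1 by the trivial resolvent estimates (`aPriori_of_one_le_im`), and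
pass down a vertical grid of N⁴ steps by Lipschitz continuity of the resolvent
(`aPriori_gridPoint`). Taking t = N^a with a small and a union bound over the grid finishes the
proof. -/

namespace ChungLu

noncomputable section

/-! ### Resolvent identities: Ward, minors, Schur complement -/

section ResolventAlgebra

variable {N : ℕ}

lemma im_sum_quadratic (A : Matrix (Fin N) (Fin N) ℝ) (hA : ∀ i j, A i j = A j i)
    (x : Fin N → ℂ) :
    (∑ k, ∑ l, (starRingEnd ℂ) (x k) * ((A k l : ℂ) * x l)).im = 0 := by
  have h : (starRingEnd ℂ) (∑ k, ∑ l, (starRingEnd ℂ) (x k) * ((A k l : ℂ) * x l)) =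
      ∑ k, ∑ l, (starRingEnd ℂ) (x k) * ((A k l : ℂ) * x l) := by
    simp only [map_sum, map_mul, Complex.conj_conj, Complex.conj_ofReal]
    rw [Finset.sum_comm]
    refine Finset.sum_congr rfl fun k _ => Finset.sum_congr rfl fun l _ => ?_
    rw [hA l k]; ring
  exact Complex.conj_eq_iff_im.mp h

/-- The imaginary part of the quadratic form of `(A - z) x = f`. -/
lemma im_mul_sum_normSq (A : Matrix (Fin N) (Fin N) ℝ) (hA : ∀ i j, A i j = A j i) (z : ℂ)
    (x f : Fin N → ℂ) (h : ∀ k, ∑ l, (A k l : ℂ) * x l - z * x k = f k) :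
    z.im * ∑ k, ‖x k‖ ^ 2 = -(∑ k, (starRingEnd ℂ) (x k) * f k).im := by
  have h1 : ∑ k, (starRingEnd ℂ) (x k) * f k =
      ∑ k, ∑ l, (starRingEnd ℂ) (x k) * ((A k l : ℂ) * x l)
        - z * ((∑ k, ‖x k‖ ^ 2 : ℝ) : ℂ) := by
    push_cast
    rw [Finset.mul_sum, ← Finset.sum_sub_distrib]
    refine Finset.sum_congr rfl fun k _ => ?_
    rw [← h k, mul_sub, Finset.mul_sum, ← Complex.conj_mul']
    ring
  rw [h1, Complex.sub_im, im_sum_quadratic A hA, Complex.im_mul_ofReal]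
  ring

/-- The matrix `A - z`. -/
def shifted (A : Matrix (Fin N) (Fin N) ℝ) (z : ℂ) : Matrix (Fin N) (Fin N) ℂ :=
  A.map (fun x : ℝ => (x : ℂ)) - z • (1 : Matrix (Fin N) (Fin N) ℂ)

lemma shifted_apply (A : Matrix (Fin N) (Fin N) ℝ) (z : ℂ) (k l : Fin N) :
    shifted A z k l = (A k l : ℂ) - if k = l then z else 0 := by
  simp [shifted, Matrix.one_apply]

lemma resolvent_eq (A : Matrix (Fin N) (Fin N) ℝ) (z : ℂ) :
    resolvent A z = (shifted A z)⁻¹ := rfl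

lemma sum_shifted_mul (A : Matrix (Fin N) (Fin N) ℝ) (z : ℂ) (x : Fin N → ℂ) (k : Fin N) :
    ∑ l, shifted A z k l * x l = ∑ l, (A k l : ℂ) * x l - z * x k := by
  simp [shifted_apply, sub_mul, Finset.sum_sub_distrib]

/-- A kernel vector would make the imaginary part of the quadratic form equal to both 0 and a
nonzero multiple of its squared norm. -/
lemma isUnit_det_shifted (A : Matrix (Fin N) (Fin N) ℝ) (hA : ∀ i j, A i j = A j i) {z : ℂ}
    (hz : 0 < z.im) : IsUnit (shifted A z).det := by
  rw [isUnit_iff_ne_zero]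
  intro h
  obtain ⟨x, hx, hx0⟩ := Matrix.exists_mulVec_eq_zero_iff.mpr h
  have h1 := im_mul_sum_normSq A hA z x 0 fun k => by
    rw [← sum_shifted_mul]; exact congrFun hx0 k
  simp only [Pi.zero_apply, mul_zero, Finset.sum_const_zero, Complex.zero_im, neg_zero,
    mul_eq_zero, hz.ne', false_or] at h1
  apply hx
  funext k
  have := (Finset.sum_eq_zero_iff_of_nonneg (fun i _ => by positivity)).mp h1 k (Finset.mem_univ k)
  simpa using this

variable {A : Matrix (Fin N) (Fin N) ℝ} (hA : ∀ i j, A i j = A j i) {z : ℂ} (hz : 0 < z.im)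

include hA hz in
lemma shifted_mul_resolvent : shifted A z * resolvent A z = 1 :=
  Matrix.mul_nonsing_inv _ (isUnit_det_shifted A hA hz)

include hA hz in
lemma resolvent_mul_shifted : resolvent A z * shifted A z = 1 :=
  Matrix.nonsing_inv_mul _ (isUnit_det_shifted A hA hz)

include hA in
lemma resolvent_symm (k l : Fin N) : resolvent A z k l = resolvent A z l k := by
  have h : (shifted A z).transpose = shifted A z := by
    ext i j
    simp only [Matrix.transpose_apply, shifted_apply, hA j i, eq_comm]
  have := congrFun (congrFun (Matrix.transpose_nonsing_inv (shifted A z)) l) k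
  rw [h] at this
  exact this

include hA hz in
lemma sum_mul_resolvent (k j : Fin N) :
    ∑ l, (A k l : ℂ) * resolvent A z l j - z * resolvent A z k j = if k = j then 1 else 0 := by
  rw [← sum_shifted_mul A z (fun l => resolvent A z l j), ← Matrix.one_apply,
    ← shifted_mul_resolvent hA hz, Matrix.mul_apply]

include hA hz in
/-- The Ward identity. -/
lemma ward (j : Fin N) :
    z.im * ∑ k, ‖resolvent A z k j‖ ^ 2 = (resolvent A z j j).im := by
  rw [im_mul_sum_normSq A hA z (fun l => resolvent A z l j) (fun k => if k = j then 1 else 0)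
    fun k => sum_mul_resolvent hA hz k j]
  simp

include hA hz in
lemma sum_normSq_resolvent_le (j : Fin N) :
    ∑ k, ‖resolvent A z k j‖ ^ 2 ≤ ‖resolvent A z j j‖ / z.im := by
  rw [le_div_iff₀ hz, mul_comm, ward hA hz]
  exact (le_abs_self _).trans (Complex.abs_im_le_norm _)

include hA hz in
-- The diagonal entry occurs in its own Ward sum, so |G_jj|² ≤ |G_jj| / η.
lemma norm_resolvent_diag_le (j : Fin N) : ‖resolvent A z j j‖ ≤ 1 / z.im := by
  have h := sum_normSq_resolvent_le hA hz j
  have h1 := Finset.single_le_sum (f := fun k => ‖resolvent A z k j‖ ^ 2)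
    (fun _ _ => by positivity) (Finset.mem_univ j)
  have h2 := h1.trans h
  rw [le_div_iff₀ hz] at h2 ⊢
  by_contra hc
  push Not at hc
  nlinarith [norm_nonneg (resolvent A z j j)]

include hA hz in
lemma sum_normSq_resolvent_le' (j : Fin N) :
    ∑ k, ‖resolvent A z k j‖ ^ 2 ≤ (1 / z.im) ^ 2 := by
  refine (sum_normSq_resolvent_le hA hz j).trans ?_
  rw [div_eq_mul_one_div, sq]
  exact mul_le_mul_of_nonneg_right (norm_resolvent_diag_le hA hz j) (by positivity)

include hA hz in
lemma norm_resolvent_le (k j : Fin N) : ‖resolvent A z k j‖ ≤ 1 / z.im := by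
  have h1 := Finset.single_le_sum (f := fun k => ‖resolvent A z k j‖ ^ 2)
    (fun _ _ => by positivity) (Finset.mem_univ k)
  exact le_of_sq_le_sq (h1.trans (sum_normSq_resolvent_le' hA hz j)) (by positivity)

include hA hz in
lemma resolvent_diag_im_pos (j : Fin N) : 0 < (resolvent A z j j).im := by
  rw [← ward hA hz]
  refine mul_pos hz (lt_of_le_of_ne (Finset.sum_nonneg fun _ _ => by positivity) fun h => ?_)
  have h0 := (Finset.sum_eq_zero_iff_of_nonneg (fun i _ => by positivity)).mp h.symm
  have h1 := sum_mul_resolvent hA hz j j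
  have h2 : ∀ k, resolvent A z k j = 0 := fun k => by simpa using h0 k (Finset.mem_univ k)
  simp [h2] at h1

include hA hz in
lemma resolvent_diag_ne_zero (j : Fin N) : resolvent A z j j ≠ 0 := fun h => by
  have := resolvent_diag_im_pos hA hz j
  simp [h] at this

include hA hz in
-- Resolvent identity G(z) - G(w) = (z - w) G(z) G(w), then Cauchy–Schwarz on the entries of the
-- product.
lemma norm_resolvent_sub_le {w : ℂ} (hw : 0 < w.im) (i j : Fin N) :
    ‖resolvent A z i j - resolvent A w i j‖ ≤ ‖z - w‖ / (z.im * w.im) := by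
  have h : resolvent A z - resolvent A w = (z - w) • (resolvent A z * resolvent A w) := by
    have e : shifted A w - shifted A z = (z - w) • (1 : Matrix (Fin N) (Fin N) ℂ) := by
      simp [shifted, sub_smul]
    calc resolvent A z - resolvent A w
        = resolvent A z * (shifted A w - shifted A z) * resolvent A w := by
          rw [mul_sub, sub_mul, resolvent_mul_shifted hA hz, mul_assoc,
            shifted_mul_resolvent hA hw, mul_one, one_mul]
      _ = _ := by rw [e]; simp
  have h1 := congrFun (congrFun h i) j
  rw [Matrix.sub_apply, Matrix.smul_apply, Matrix.mul_apply] at h1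
  rw [h1, smul_eq_mul, norm_mul, div_eq_mul_one_div]
  refine mul_le_mul_of_nonneg_left ?_ (norm_nonneg _)
  have h2 : ‖∑ k, resolvent A z i k * resolvent A w k j‖ ≤
      ∑ k, ‖resolvent A z k i‖ * ‖resolvent A w k j‖ := by
    refine (norm_sum_le _ _).trans (Finset.sum_le_sum fun k _ => ?_)
    rw [norm_mul, resolvent_symm hA]
  refine h2.trans ((Real.sum_mul_le_sqrt_mul_sqrt _ _ _).trans ?_)
  rw [← one_div_mul_one_div]
  gcongr
  · exact Real.sqrt_le_iff.mpr ⟨by positivity, sum_normSq_resolvent_le' hA hz i⟩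
  · exact Real.sqrt_le_iff.mpr ⟨by positivity, sum_normSq_resolvent_le' hA hw j⟩

/-- `A` with row and column `i` set to zero. -/
def minor (A : Matrix (Fin N) (Fin N) ℝ) (i : Fin N) : Matrix (Fin N) (Fin N) ℝ :=
  fun k l => if k = i ∨ l = i then 0 else A k l

/-- The row `i` of `A`, with the diagonal entry set to zero. -/
def rowVec (A : Matrix (Fin N) (Fin N) ℝ) (i k : Fin N) : ℝ := if k = i then 0 else A i k

/-- The resolvent of the minor of `A` obtained by removing the index `i`, extended by zero. -/
def minorRes (A : Matrix (Fin N) (Fin N) ℝ) (z : ℂ) (i k l : Fin N) : ℂ :=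
  if k = i ∨ l = i then 0 else resolvent (minor A i) z k l

include hA in
lemma minor_symm (i k l : Fin N) : minor A i k l = minor A i l k := by
  simp only [minor, hA k l, or_comm]

include hA in
lemma minorRes_symm (i k l : Fin N) : minorRes A z i k l = minorRes A z i l k := by
  simp only [minorRes, resolvent_symm (minor_symm hA i) k l, or_comm]

@[simp] lemma minorRes_left (i l : Fin N) : minorRes A z i i l = 0 := by simp [minorRes]
@[simp] lemma minorRes_right (i k : Fin N) : minorRes A z i k i = 0 := by simp [minorRes]
@[simp] lemma rowVec_self (i : Fin N) : rowVec A i i = 0 := by simp [rowVec]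

/-- The resolvent of the minor solves the reduced linear system. -/
lemma sum_mul_minorRes (hA : ∀ i j, A i j = A j i) (hz : 0 < z.im) {i k j : Fin N}
    (hk : k ≠ i) (hj : j ≠ i) :
    ∑ l, (A k l : ℂ) * minorRes A z i l j - z * minorRes A z i k j = if k = j then 1 else 0 := by
  rw [← sum_mul_resolvent (minor_symm hA i) hz k j]
  congr 1
  · refine Finset.sum_congr rfl fun l _ => ?_
    by_cases hl : l = i
    · simp [hl, minor]
    · simp [hl, hj, hk, minor, minorRes]
  · simp [minorRes, hk, hj]

/-- Solutions of the reduced linear system are given by the resolvent of the minor. -/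
lemma eq_sum_minorRes (hA : ∀ i j, A i j = A j i) (hz : 0 < z.im) {i : Fin N}
    (x f : Fin N → ℂ) (hxi : x i = 0)
    (h : ∀ k, k ≠ i → ∑ l, (A k l : ℂ) * x l - z * x k = f k) {k : Fin N} (hk : k ≠ i) :
    x k = ∑ l, minorRes A z i k l * f l := by
  have h1 : ∑ m, ∑ l, minorRes A z i k m * ((A m l : ℂ) * x l) -
      ∑ m, minorRes A z i k m * (z * x m) = ∑ m, minorRes A z i k m * f m := by
    rw [← Finset.sum_sub_distrib]
    refine Finset.sum_congr rfl fun m _ => ?_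
    by_cases hm : m = i
    · simp [hm]
    · rw [← h m hm, mul_sub, Finset.mul_sum]
  rw [← h1, Finset.sum_comm, ← Finset.sum_sub_distrib]
  -- By symmetry the sum over m is the equation solved by column k of the minor resolvent, so only l
  -- = k survives.
  have h2 : ∀ l, ∑ m, minorRes A z i k m * ((A m l : ℂ) * x l) - minorRes A z i k l * (z * x l) =
      if l = k then x k else 0 := by
    intro l
    by_cases hl : l = i
    · subst hl; simp [hxi, hk.symm]
    · have := sum_mul_minorRes hA hz (k := l) (j := k) hl hk
      have e : ∑ m, minorRes A z i k m * ((A m l : ℂ) * x l) =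
          (∑ m, (A l m : ℂ) * minorRes A z i m k) * x l := by
        rw [Finset.sum_mul]
        refine Finset.sum_congr rfl fun m _ => ?_
        rw [minorRes_symm hA i k m, hA m l]; ring
      rw [e, minorRes_symm hA i k l]
      have e2 : (∑ m, (A l m : ℂ) * minorRes A z i m k) * x l
          - minorRes A z i l k * (z * x l) = (if l = k then 1 else 0) * x l := by
        rw [← this]; ring
      rw [e2]
      split_ifs with hlk
      · simp [hlk]
      · simp
  simp [h2]

section Schur

variable (i : Fin N)

include hA hz in
-- Column i of G with its entry i deleted solves the reduced system with right-hand side -h_il G_ii.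
lemma resolvent_offdiag {k : Fin N} (hk : k ≠ i) :
    resolvent A z k i = -(∑ l, minorRes A z i k l * rowVec A i l) * resolvent A z i i := by
  have := eq_sum_minorRes hA hz (i := i)
    (fun l => if l = i then 0 else resolvent A z l i)
    (fun l => -(rowVec A i l * resolvent A z i i)) (by simp) ?_ hk
  · simp only [hk, if_false] at this
    rw [this, neg_mul, Finset.sum_mul, ← Finset.sum_neg_distrib]
    refine Finset.sum_congr rfl fun l _ => by ring
  · intro m hm
    have h := sum_mul_resolvent hA hz m i
    rw [if_neg hm] at h
    have e : ∑ l, (A m l : ℂ) * (if l = i then 0 else resolvent A z l i) =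
        ∑ l, (A m l : ℂ) * resolvent A z l i - (A m i : ℂ) * resolvent A z i i := by
      rw [eq_sub_iff_add_eq]
      have : (A m i : ℂ) * resolvent A z i i =
          ∑ l, if l = i then (A m l : ℂ) * resolvent A z l i else 0 := by simp
      rw [this, ← Finset.sum_add_distrib]
      refine Finset.sum_congr rfl fun l _ => ?_
      split_ifs <;> simp
    rw [e, if_neg hm, rowVec, if_neg hm, hA i m]
    linear_combination h

include hA hz in
-- The vector G_lj - G_li G_ij / G_ii vanishes at l = i and solves the reduced system whose
-- right-hand side is the unit vector at j.
lemma resolvent_eq_minorRes_add {k j : Fin N} (hk : k ≠ i) (hj : j ≠ i) :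
    resolvent A z k j = minorRes A z i k j +
      resolvent A z k i * resolvent A z i j / resolvent A z i i := by
  have hG := resolvent_diag_ne_zero hA hz i
  have hm := eq_sum_minorRes hA hz (i := i)
    (fun l => if l = i then 0 else
      resolvent A z l j - resolvent A z l i * resolvent A z i j / resolvent A z i i)
    (fun l => if l = j then 1 else 0) (by simp) ?_ hk
  · simp only [hk, if_false] at hm
    rw [sub_eq_iff_eq_add] at hm
    rw [hm]; simp
  · intro m hm
    have h := sum_mul_resolvent hA hz m j
    have h' := sum_mul_resolvent hA hz m i
    rw [if_neg hm] at h'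
    have e : ∑ l, (A m l : ℂ) * (if l = i then 0 else
        resolvent A z l j - resolvent A z l i * resolvent A z i j / resolvent A z i i) =
        ∑ l, (A m l : ℂ) * resolvent A z l j -
          (∑ l, (A m l : ℂ) * resolvent A z l i) * (resolvent A z i j / resolvent A z i i) := by
      rw [Finset.sum_mul, ← Finset.sum_sub_distrib]
      refine Finset.sum_congr rfl fun l _ => ?_
      split_ifs with hl
      · subst hl; field_simp; ring
      · ring
    simp only [e, if_neg hm]
    rw [← h]
    linear_combination (-resolvent A z i j / resolvent A z i i) * h'

include hA hz in
/-- Schur's complement formula. -/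
lemma schur : (resolvent A z i i)⁻¹ =
    A i i - z - ∑ k, ∑ l, (rowVec A i k : ℂ) * rowVec A i l * minorRes A z i k l := by
  have hG := resolvent_diag_ne_zero hA hz i
  have h := sum_mul_resolvent hA hz i i
  rw [if_pos rfl] at h
  have e : ∑ l, (A i l : ℂ) * resolvent A z l i = A i i * resolvent A z i i -
      (∑ k, ∑ l, (rowVec A i k : ℂ) * rowVec A i l * minorRes A z i k l) *
        resolvent A z i i := by
    have e1 : (A i i : ℂ) * resolvent A z i i =
          ∑ l, if l = i then (A i l : ℂ) * resolvent A z l i else 0 := by simp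
    rw [e1, Finset.sum_mul, ← Finset.sum_sub_distrib]
    refine Finset.sum_congr rfl fun k _ => ?_
    by_cases hk : k = i
    · subst hk; simp
    · rw [if_neg hk, resolvent_offdiag hA hz i hk, rowVec, if_neg hk, zero_sub, neg_mul, mul_neg,
        neg_inj, Finset.sum_mul, Finset.mul_sum, Finset.sum_mul]
      refine Finset.sum_congr rfl fun l _ => by ring
  rw [e] at h
  refine inv_eq_of_mul_eq_one_left ?_
  linear_combination h

end Schur

end ResolventAlgebra

/-! ### Large deviations of linear and quadratic forms -/

section LargeDeviation

variable {Ω : Type*} [MeasurableSpace Ω] {P : Measure Ω} [IsProbabilityMeasure P] {n : ℕ}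

/-- A family of independent centred random variables bounded by `b`, with variances at most
`s k`. -/
structure IsBoundedFamily (P : Measure Ω) (X : Fin n → Ω → ℝ) (b : ℝ) (s : Fin n → ℝ) :
    Prop where
  measurable : ∀ k, Measurable (X k)
  indep : iIndepFun X P
  bound : ∀ k, ∀ᵐ ω ∂P, |X k ω| ≤ b
  mean : ∀ k, ∫ ω, X k ω ∂P = 0
  var : ∀ k, ∫ ω, X k ω ^ 2 ∂P ≤ s k

/-- The coordinates of `x` before `m`, the others being replaced by zero. -/
def past (x : Fin n → ℝ) (m : ℕ) : Fin n → ℝ := fun j => if j.val < m then x j else 0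

lemma measurable_past (m : ℕ) : Measurable fun x : Fin n → ℝ => past x m := by
  refine measurable_pi_lambda _ fun j => ?_
  simp only [past]
  split_ifs <;> fun_prop

lemma past_past (x : Fin n → ℝ) {k m : ℕ} (h : k ≤ m) : past (past x m) k = past x k := by
  funext j
  simp only [past]
  split_ifs with h1 h2
  · rfl
  · omega
  · rfl

/-- The sum up to time `m` of the increments `x k * F k (past x k)`. -/
def predictableSum (F : Fin n → (Fin n → ℝ) → ℝ) (m : ℕ) (x : Fin n → ℝ) : ℝ :=
  ∑ k : Fin n, if k.val < m then x k * F k (past x k) else 0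

lemma predictableSum_past (F : Fin n → (Fin n → ℝ) → ℝ) (m : ℕ) (x : Fin n → ℝ) :
    predictableSum F m (past x m) = predictableSum F m x := by
  refine Finset.sum_congr rfl fun k _ => ?_
  split_ifs with h
  · rw [past_past x h.le]; simp [past, h]
  · rfl

lemma predictableSum_succ (F : Fin n → (Fin n → ℝ) → ℝ) {m : ℕ} (hm : m < n) (x : Fin n → ℝ) :
    predictableSum F (m + 1) x =
      predictableSum F m x + x ⟨m, hm⟩ * F ⟨m, hm⟩ (past x m) := by
  have h : x ⟨m, hm⟩ * F ⟨m, hm⟩ (past x m) =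
      ∑ k : Fin n, if k = ⟨m, hm⟩ then x k * F k (past x k) else 0 := by simp
  rw [h, predictableSum, predictableSum, ← Finset.sum_add_distrib]
  refine Finset.sum_congr rfl fun k _ => ?_
  by_cases h1 : k.val < m
  · have h2 : k ≠ ⟨m, hm⟩ := fun h => by simp [h] at h1
    simp [h1, h2, Nat.lt_succ_of_lt h1]
  · by_cases h2 : k = ⟨m, hm⟩
    · subst h2; simp
    · have h3 : ¬ k.val < m + 1 := fun h => h2 (Fin.ext (by simp; omega))
      simp [h1, h2, h3]

lemma measurable_predictableSum {F : Fin n → (Fin n → ℝ) → ℝ} (hF : ∀ k, Measurable (F k))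
    (m : ℕ) : Measurable (predictableSum F m) := by
  refine Finset.measurable_sum _ fun k _ => ?_
  split_ifs
  · exact (measurable_pi_apply k).mul ((hF k).comp (measurable_past _))
  · exact measurable_const

variable {X : Fin n → Ω → ℝ} {b : ℝ} {s : Fin n → ℝ}

omit [IsProbabilityMeasure P] in
lemma IsBoundedFamily.indepFun_past (hX : IsBoundedFamily P X b s) {m : ℕ} (hm : m < n) :
    IndepFun (fun ω => past (fun k => X k ω) m) (X ⟨m, hm⟩) P := by
  have h := hX.indep.indepFun_finset (Finset.univ.filter fun k : Fin n => k.val < m)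
    {⟨m, hm⟩} (by simp) hX.measurable
  let φ : (({k // k ∈ (Finset.univ.filter fun k : Fin n => k.val < m)}) → ℝ) → Fin n → ℝ :=
    fun y j => if h : j.val < m then y ⟨j, by simpa using h⟩ else 0
  have hφ : Measurable φ := by
    refine measurable_pi_lambda _ fun j => ?_
    simp only [φ]
    split_ifs <;> fun_prop
  have h2 := h.comp hφ (measurable_pi_apply ⟨⟨m, hm⟩, by simp⟩)
  convert h2 using 1
  · funext ω j
    simp only [past, φ, Function.comp]
    split_ifs <;> rfl
  · rfl

/-- A crude bound, needed only for the integrability of the exponentials. -/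
lemma predictableSum_le {F : Fin n → (Fin n → ℝ) → ℝ} {μ : Fin n → ℝ}
    (hFμ : ∀ k x, |F k x| ≤ μ k) (hb : ∀ k, b * μ k ≤ 1) (m : ℕ) {x : Fin n → ℝ}
    (hx : ∀ k, |x k| ≤ b) : predictableSum F m x ≤ n := by
  have : ∑ k : Fin n, (1 : ℝ) = n := by simp
  rw [← this]
  refine Finset.sum_le_sum fun k _ => ?_
  split_ifs
  · refine (le_abs_self _).trans ?_
    rw [abs_mul]
    exact (mul_le_mul (hx k) (hFμ k _) (abs_nonneg _) ((abs_nonneg _).trans (hx k))).trans (hb k)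
  · exact zero_le_one

/-- The exponential moment of a sum of martingale increments. -/
lemma IsBoundedFamily.integral_exp_predictableSum_le (hX : IsBoundedFamily P X b s)
    {F : Fin n → (Fin n → ℝ) → ℝ} (hF : ∀ k, Measurable (F k)) {μ : Fin n → ℝ}
    (hFμ : ∀ k x, |F k x| ≤ μ k) (hb : ∀ k, b * μ k ≤ 1) {m : ℕ} (hm : m ≤ n) :
    ∫ ω, Real.exp (predictableSum F m fun k => X k ω) ∂P ≤
      Real.exp (∑ k : Fin n, if k.val < m then s k * μ k ^ 2 else 0) := by
  have hXv : Measurable fun ω => (fun k => X k ω) := measurable_pi_lambda _ hX.measurable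
  induction m with
  | zero => simp [predictableSum]
  | succ m ih =>
    have hmn : m < n := hm
    have ih := ih hmn.le
    set k₀ : Fin n := ⟨m, hmn⟩ with hk₀
    have hall : ∀ᵐ ω ∂P, ∀ k, |X k ω| ≤ b := ae_all_iff.mpr hX.bound
    set W : Ω → ℝ := fun ω => Real.exp (predictableSum F m fun k => X k ω) with hW
    set f : Ω → ℝ := fun ω => F k₀ (past (fun k => X k ω) m) with hf
    have hWm : Measurable W :=
      Real.measurable_exp.comp ((measurable_predictableSum hF m).comp hXv)
    have hfm : Measurable f := (hF k₀).comp ((measurable_past m).comp hXv)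
    have hX0 : Measurable (X k₀) := hX.measurable k₀
    have hWb : ∀ᵐ ω ∂P, ‖W ω‖ ≤ Real.exp n := by
      filter_upwards [hall] with ω hω
      rw [Real.norm_eq_abs, abs_of_pos (Real.exp_pos _)]
      exact Real.exp_le_exp.mpr (predictableSum_le hFμ hb m hω)
    have hμ0 : 0 ≤ μ k₀ := (abs_nonneg _).trans (hFμ k₀ 0)
    have hWi : Integrable W P := Integrable.of_bound hWm.aestronglyMeasurable _ hWb
    have hWfX : Integrable (fun ω => W ω * f ω * X k₀ ω) P := by
      refine Integrable.of_bound (by fun_prop) (Real.exp n * μ k₀ * b) ?_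
      filter_upwards [hWb, hall] with ω h1 h2
      rw [norm_mul, norm_mul]
      have := h2 k₀
      have h3 := hFμ k₀ (past (fun k => X k ω) m)
      simp only [Real.norm_eq_abs] at *
      gcongr
    have hWX : Integrable (fun ω => W ω * X k₀ ω ^ 2) P := by
      refine Integrable.of_bound (by fun_prop) (Real.exp n * b ^ 2) ?_
      filter_upwards [hWb, hall] with ω h1 h2
      rw [norm_mul, norm_pow]
      have := h2 k₀
      simp only [Real.norm_eq_abs] at *
      gcongr
    have hind := hX.indepFun_past hmn
    have hWpast : ∀ ω, W ω = Real.exp (predictableSum F m (past (fun k => X k ω) m)) := fun ω => by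
      rw [predictableSum_past]
    have i1 : IndepFun (fun ω => W ω * f ω) (X k₀) P := by
      have hφ : Measurable fun y : Fin n → ℝ => Real.exp (predictableSum F m y) * F k₀ y :=
        (Real.measurable_exp.comp (measurable_predictableSum hF m)).mul (hF k₀)
      convert hind.comp hφ measurable_id using 1
      · funext ω
        simp only [Function.comp, hWpast, hf]
      · rfl
    have i2 : IndepFun W (fun ω => X k₀ ω ^ 2) P := by
      have hφ : Measurable fun y : Fin n → ℝ => Real.exp (predictableSum F m y) :=
        (Real.measurable_exp.comp (measurable_predictableSum hF m))
      convert hind.comp hφ (measurable_id.pow_const 2) using 1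
      · funext ω
        simp only [Function.comp, hWpast]
      · rfl
    have e1 : ∫ ω, W ω * f ω * X k₀ ω ∂P = 0 := by
      rw [i1.integral_fun_mul_eq_mul_integral (hWm.mul hfm).aestronglyMeasurable
        hX0.aestronglyMeasurable, hX.mean, mul_zero]
    have e2 : ∫ ω, W ω * X k₀ ω ^ 2 ∂P = (∫ ω, W ω ∂P) * ∫ ω, X k₀ ω ^ 2 ∂P :=
      i2.integral_fun_mul_eq_mul_integral hWm.aestronglyMeasurable
        (hX0.pow_const 2).aestronglyMeasurable
    -- exp y ≤ 1 + y + y² for |y| ≤ 1, which is what b μ_k ≤ 1 is for. The linear term integrates to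
    -- zero because the coefficient and the earlier sum depend only on the past.
    have hstep : ∀ᵐ ω ∂P, Real.exp (predictableSum F (m + 1) fun k => X k ω) ≤
        W ω + W ω * f ω * X k₀ ω + μ k₀ ^ 2 * (W ω * X k₀ ω ^ 2) := by
      filter_upwards [hall] with ω hω
      rw [predictableSum_succ F hmn, Real.exp_add]
      have hW0 : 0 < W ω := Real.exp_pos _
      have h3 : |f ω| ≤ μ k₀ := hFμ k₀ _
      have h4 : |X k₀ ω * f ω| ≤ 1 := by
        rw [abs_mul]
        exact (mul_le_mul (hω k₀) h3 (abs_nonneg _) ((abs_nonneg _).trans (hω k₀))).trans (hb k₀)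
      have h5 := (abs_le.mp (Real.abs_exp_sub_one_sub_id_le h4)).2
      have h6 : (X k₀ ω * f ω) ^ 2 ≤ X k₀ ω ^ 2 * μ k₀ ^ 2 := by
        rw [mul_pow]
        exact mul_le_mul_of_nonneg_left (sq_le_sq' (abs_le.mp h3).1 (abs_le.mp h3).2)
          (sq_nonneg _)
      have h7 : Real.exp (X k₀ ω * f ω) ≤ 1 + X k₀ ω * f ω + X k₀ ω ^ 2 * μ k₀ ^ 2 := by linarith
      calc W ω * Real.exp (X k₀ ω * f ω)
          ≤ W ω * (1 + X k₀ ω * f ω + X k₀ ω ^ 2 * μ k₀ ^ 2) :=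
            mul_le_mul_of_nonneg_left h7 hW0.le
        _ = _ := by ring
    have hint : Integrable (fun ω => W ω + W ω * f ω * X k₀ ω + μ k₀ ^ 2 * (W ω * X k₀ ω ^ 2)) P :=
      (hWi.add hWfX).add (hWX.const_mul _)
    have hW0 : 0 ≤ ∫ ω, W ω ∂P := integral_nonneg fun ω => (Real.exp_pos _).le
    calc ∫ ω, Real.exp (predictableSum F (m + 1) fun k => X k ω) ∂P
        ≤ ∫ ω, W ω + W ω * f ω * X k₀ ω + μ k₀ ^ 2 * (W ω * X k₀ ω ^ 2) ∂P :=
          integral_mono_of_nonneg (ae_of_all _ fun ω => (Real.exp_pos _).le) hint hstep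
      _ = (∫ ω, W ω ∂P) * (1 + μ k₀ ^ 2 * ∫ ω, X k₀ ω ^ 2 ∂P) := by
          rw [integral_add (f := fun ω => W ω + W ω * f ω * X k₀ ω) (hWi.add hWfX) (hWX.const_mul _),
            integral_add hWi hWfX, e1,
            integral_const_mul, e2]
          ring
      _ ≤ (∫ ω, W ω ∂P) * Real.exp (s k₀ * μ k₀ ^ 2) := by
          refine mul_le_mul_of_nonneg_left ?_ hW0
          have := Real.add_one_le_exp (s k₀ * μ k₀ ^ 2)
          nlinarith [hX.var k₀, sq_nonneg (μ k₀)]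
      _ ≤ Real.exp (∑ k : Fin n, if k.val < m then s k * μ k ^ 2 else 0) *
            Real.exp (s k₀ * μ k₀ ^ 2) :=
          mul_le_mul_of_nonneg_right ih (Real.exp_pos _).le
      _ = _ := by
          rw [← Real.exp_add]
          congr 1
          have h : s k₀ * μ k₀ ^ 2 =
            ∑ k : Fin n, if k = k₀ then s k * μ k ^ 2 else 0 := by simp
          rw [h, ← Finset.sum_add_distrib]
          refine Finset.sum_congr rfl fun k _ => ?_
          by_cases h1 : k.val < m
          · have h2 : k ≠ k₀ := fun h => by simp [h, hk₀] at h1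
            simp [h1, h2, Nat.lt_succ_of_lt h1]
          · by_cases h2 : k = k₀
            · subst h2; simp [hk₀]
            · have h3 : ¬ k.val < m + 1 := fun h => h2 (Fin.ext (by simp [hk₀]; omega))
              simp [h1, h2, h3]

/-- Tail bound for sums of martingale increments. -/
lemma IsBoundedFamily.tail_real (hX : IsBoundedFamily P X b s)
    {F : Fin n → (Fin n → ℝ) → ℝ} (hF : ∀ k, Measurable (F k)) {μ : Fin n → ℝ}
    (hFμ : ∀ k x, |F k x| ≤ μ k) {σ : ℝ} (hσ : 0 < σ) (hbσ : ∀ k, b * μ k ≤ σ)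
    (hsσ : ∑ k, s k * μ k ^ 2 ≤ σ ^ 2) (t : ℝ) :
    P {ω | t * σ < |∑ k, X k ω * F k (past (fun j => X j ω) k)|} ≤
      ENNReal.ofReal (2 * Real.exp (1 - t)) := by
  have key : ∀ ε : ℝ, |ε| = 1 → P {ω | t * σ < ε * ∑ k, X k ω * F k (past (fun j => X j ω) k)} ≤
      ENNReal.ofReal (Real.exp (1 - t)) := by
    intro ε hε
    -- After scaling by σ the increments and the sum of variances are at most 1, so the exponential
    -- moment is at most e; this is the 1 in `exp (1 - t)`. The sign ε = ±1 yields the two tails.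
    set F' : Fin n → (Fin n → ℝ) → ℝ := fun k x => (ε / σ) * F k x
    have hF' : ∀ k, Measurable (F' k) := fun k => (hF k).const_mul _
    have hle : ∫ ω, Real.exp (predictableSum F' n fun k => X k ω) ∂P ≤ Real.exp 1 := by
      refine (hX.integral_exp_predictableSum_le hF' (μ := fun k => μ k / σ) (fun k x => ?_)
        (fun k => ?_) le_rfl).trans (Real.exp_le_exp.mpr ?_)
      · simp only [F']
        rw [abs_mul, abs_div, hε, abs_of_pos hσ, one_div, inv_mul_eq_div]
        exact div_le_div_of_nonneg_right (hFμ k x) hσ.le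
      · rw [← mul_div_assoc]; exact (div_le_one hσ).mpr (hbσ k)
      · simp only [Fin.is_lt, if_true, div_pow, ← mul_div_assoc]
        rw [← Finset.sum_div]
        exact (div_le_one (by positivity)).mpr hsσ
    have hsum : ∀ ω, predictableSum F' n (fun k => X k ω) =
        (ε * ∑ k, X k ω * F k (past (fun j => X j ω) k)) / σ := by
      intro ω
      simp only [predictableSum, Fin.is_lt, if_true, F', Finset.mul_sum, Finset.sum_div]
      refine Finset.sum_congr rfl fun k _ => by ring
    have hXv : Measurable fun ω => (fun k => X k ω) := measurable_pi_lambda _ hX.measurable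
    have hm : Measurable fun ω => predictableSum F' n fun k => X k ω :=
      (measurable_predictableSum hF' n).comp hXv
    have hint : Integrable (fun ω => Real.exp (predictableSum F' n fun k => X k ω)) P := by
      refine Integrable.of_bound (Real.measurable_exp.comp hm).aestronglyMeasurable
        (Real.exp n) ?_
      filter_upwards [ae_all_iff.mpr hX.bound] with ω hω
      rw [Real.norm_eq_abs, abs_of_pos (Real.exp_pos _)]
      refine Real.exp_le_exp.mpr (predictableSum_le (μ := fun k => μ k / σ) (fun k x => ?_)
        (fun k => ?_) n hω)
      · simp only [F']
        rw [abs_mul, abs_div, hε, abs_of_pos hσ, one_div, inv_mul_eq_div]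
        exact div_le_div_of_nonneg_right (hFμ k x) hσ.le
      · rw [← mul_div_assoc]; exact (div_le_one hσ).mpr (hbσ k)
    have hmk := mul_meas_ge_le_integral_of_nonneg (ae_of_all _ fun ω => (Real.exp_pos _).le) hint
      (Real.exp t)
    have hsub : {ω | t * σ < ε * ∑ k, X k ω * F k (past (fun j => X j ω) k)} ⊆
        {ω | Real.exp t ≤ Real.exp (predictableSum F' n fun k => X k ω)} := by
      intro ω hω
      simp only [Set.mem_ofPred_eq] at hω ⊢
      rw [hsum]
      exact Real.exp_le_exp.mpr ((le_div_iff₀ hσ).mpr hω.le)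
    refine (measure_mono hsub).trans ?_
    rw [← ENNReal.ofReal_toReal (measure_ne_top P _)]
    refine ENNReal.ofReal_le_ofReal ?_
    rw [Real.exp_sub, le_div_iff₀ (Real.exp_pos t), mul_comm]
    exact hmk.trans hle
  have hsub : {ω | t * σ < |∑ k, X k ω * F k (past (fun j => X j ω) k)|} ⊆
      {ω | t * σ < 1 * ∑ k, X k ω * F k (past (fun j => X j ω) k)} ∪
      {ω | t * σ < (-1) * ∑ k, X k ω * F k (past (fun j => X j ω) k)} := by
    intro ω hω
    simp only [Set.mem_ofPred_eq, Set.mem_union, one_mul, neg_one_mul] at hω ⊢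
    exact lt_abs.mp hω
  refine (measure_mono hsub).trans ((measure_union_le _ _).trans ?_)
  refine (add_le_add (key 1 (by simp)) (key (-1) (by simp))).trans ?_
  rw [← ENNReal.ofReal_add (Real.exp_pos _).le (Real.exp_pos _).le, two_mul]

/-- Tail bound for sums of martingale increments with complex coefficients. -/
lemma IsBoundedFamily.tail_complex (hX : IsBoundedFamily P X b s)
    {F : Fin n → (Fin n → ℝ) → ℂ} (hF : ∀ k, Measurable (F k)) {μ : Fin n → ℝ}
    (hFμ : ∀ k x, ‖F k x‖ ≤ μ k) {σ : ℝ} (hσ : 0 < σ) (hbσ : ∀ k, b * μ k ≤ σ)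
    (hsσ : ∑ k, s k * μ k ^ 2 ≤ σ ^ 2) (t : ℝ) :
    P {ω | 2 * t * σ < ‖∑ k, (X k ω : ℂ) * F k (past (fun j => X j ω) k)‖} ≤
      ENNReal.ofReal (4 * Real.exp (1 - t)) := by
  have h1 := hX.tail_real (F := fun k x => (F k x).re)
    (fun k => Complex.measurable_re.comp (hF k))
    (fun k x => (Complex.abs_re_le_norm _).trans (hFμ k x)) hσ hbσ hsσ t
  have h2 := hX.tail_real (F := fun k x => (F k x).im)
    (fun k => Complex.measurable_im.comp (hF k))
    (fun k x => (Complex.abs_im_le_norm _).trans (hFμ k x)) hσ hbσ hsσ t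
  have e : (4 * Real.exp (1 - t)) = 2 * Real.exp (1 - t) + 2 * Real.exp (1 - t) := by ring
  rw [e, ENNReal.ofReal_add (by positivity) (by positivity)]
  refine (measure_mono ?_).trans ((measure_union_le _ _).trans (add_le_add h1 h2))
  intro ω hω
  simp only [Set.mem_ofPred_eq, Set.mem_union] at hω ⊢
  by_contra hc
  push Not at hc
  have h3 := Complex.norm_le_abs_re_add_abs_im
    (∑ k, (X k ω : ℂ) * F k (past (fun j => X j ω) k))
  simp only [Complex.re_sum, Complex.im_sum, Complex.re_ofReal_mul, Complex.im_ofReal_mul] at h3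
  linarith [hc.1, hc.2]

/-- The scale of the fluctuations of `∑ k, X k * c k`. -/
def linScale (s : Fin n → ℝ) (b : ℝ) (c : Fin n → ℂ) : ℝ :=
  √(∑ k, s k * ‖c k‖ ^ 2) + b * ‖c‖

lemma linScale_nonneg (hb : 0 ≤ b) (c : Fin n → ℂ) : 0 ≤ linScale s b c := by
  unfold linScale; positivity

lemma mul_norm_le_linScale (hb : 0 ≤ b) (c : Fin n → ℂ) (k : Fin n) :
    b * ‖c k‖ ≤ linScale s b c := by
  have h1 := mul_le_mul_of_nonneg_left (norm_le_pi_norm c k) hb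
  have h2 := Real.sqrt_nonneg (∑ k, s k * ‖c k‖ ^ 2)
  unfold linScale; linarith

lemma sum_le_linScale_sq (hb : 0 ≤ b) (hs : ∀ k, 0 ≤ s k) (c : Fin n → ℂ) :
    ∑ k, s k * ‖c k‖ ^ 2 ≤ linScale s b c ^ 2 := by
  have h0 : 0 ≤ ∑ k, s k * ‖c k‖ ^ 2 :=
    Finset.sum_nonneg fun k _ => mul_nonneg (hs k) (by positivity)
  have h1 : √(∑ k, s k * ‖c k‖ ^ 2) ≤ linScale s b c := by
    unfold linScale; have := mul_nonneg hb (norm_nonneg c); linarith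
  calc _ = √(∑ k, s k * ‖c k‖ ^ 2) ^ 2 := (Real.sq_sqrt h0).symm
    _ ≤ _ := pow_le_pow_left₀ (Real.sqrt_nonneg _) h1 2

/-- Disposes of the degenerate scale 0, for which the tail bounds with σ > 0 say nothing: the
supremum term of `linScale` then forces the coefficients to vanish. -/
lemma eq_zero_of_linScale_le (hb : 0 < b) {c : Fin n → ℂ} (h : linScale s b c ≤ 0) : c = 0 := by
  have h2 := Real.sqrt_nonneg (∑ k, s k * ‖c k‖ ^ 2)
  unfold linScale at h
  have h3 : b * ‖c‖ ≤ 0 := by linarith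
  have h4 : ‖c‖ ≤ 0 := by
    by_contra hc
    push Not at hc
    have := mul_pos hb hc
    linarith
  exact norm_eq_zero.mp (le_antisymm h4 (norm_nonneg _))

/-- Large deviations of linear forms. -/
lemma IsBoundedFamily.tail_linear (hX : IsBoundedFamily P X b s) (hb : 0 < b)
    (hs : ∀ k, 0 ≤ s k) (c : Fin n → ℂ) (t : ℝ) :
    P {ω | 2 * t * linScale s b c < ‖∑ k, (X k ω : ℂ) * c k‖} ≤
      ENNReal.ofReal (4 * Real.exp (1 - t)) := by
  by_cases h : linScale s b c ≤ 0
  · have := eq_zero_of_linScale_le hb h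
    subst this
    simp [linScale]
  · exact hX.tail_complex (F := fun k _ => c k) (μ := fun k => ‖c k‖)
      (fun k => measurable_const) (fun k _ => le_rfl) (not_le.mp h)
      (fun k => mul_norm_le_linScale hb.le c k) (sum_le_linScale_sq hb.le hs c) t

/-- The scale of the fluctuations of the row sums of the quadratic form of `B`. -/
def rowScale (s : Fin n → ℝ) (b : ℝ) (B : Fin n → Fin n → ℂ) (k : Fin n) : ℂ :=
  (linScale s b fun l => if k = l then 0 else B k l : ℝ)

/-- The scale of the fluctuations of the off-diagonal quadratic form of `B`. -/
def quadScale (s : Fin n → ℝ) (b : ℝ) (B : Fin n → Fin n → ℂ) : ℝ :=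
  linScale s b (rowScale s b B)

/-- Symmetry folds the terms with l > k onto those with l < k. The coefficient of x_k then depends
only on earlier coordinates, so the quadratic form becomes a martingale sum. -/
lemma sum_offdiag_eq (B : Fin n → Fin n → ℂ) (hB : ∀ k l, B k l = B l k) (x : Fin n → ℝ) :
    ∑ k, ∑ l, (if k = l then 0 else (x k : ℂ) * x l * B k l) =
      ∑ k, (x k : ℂ) * ∑ l, (past x k l : ℂ) * (2 * B k l) := by
  have h1 : ∀ k l, (if k = l then 0 else (x k : ℂ) * x l * B k l) =
      (if l < k then (x k : ℂ) * x l * B k l else 0) +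
      (if k < l then (x k : ℂ) * x l * B k l else 0) := by
    intro k l
    rcases lt_trichotomy k l with h | h | h
    · simp [h, h.ne, h.not_gt]
    · simp [h]
    · simp [h, h.ne', h.not_gt]
  simp only [h1, Finset.sum_add_distrib]
  have h2 : ∑ k, ∑ l, (if k < l then (x k : ℂ) * x l * B k l else 0) =
      ∑ k, ∑ l, (if l < k then (x k : ℂ) * x l * B k l else 0) := by
    rw [Finset.sum_comm]
    refine Finset.sum_congr rfl fun k _ => Finset.sum_congr rfl fun l _ => ?_
    rw [hB l k, mul_comm (x l : ℂ)]
  rw [h2, ← Finset.sum_add_distrib]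
  refine Finset.sum_congr rfl fun k _ => ?_
  rw [← two_mul, Finset.mul_sum, Finset.mul_sum]
  refine Finset.sum_congr rfl fun l _ => ?_
  simp only [past, Fin.lt_def]
  split_ifs <;> push_cast <;> ring

/-- Large deviations of off-diagonal quadratic forms. -/
lemma IsBoundedFamily.tail_quadratic (hX : IsBoundedFamily P X b s) (hb : 0 < b)
    (hs : ∀ k, 0 ≤ s k) (B : Fin n → Fin n → ℂ) (hB : ∀ k l, B k l = B l k) {t : ℝ}
    (ht : 0 < t) :
    P {ω | 8 * t ^ 2 * quadScale s b B <
        ‖∑ k, ∑ l, (if k = l then 0 else (X k ω : ℂ) * X l ω * B k l)‖} ≤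
      ENNReal.ofReal ((n + 1) * (4 * Real.exp (1 - t))) := by
  by_cases h : quadScale s b B ≤ 0
  · have h0 := eq_zero_of_linScale_le hb h
    have h1 : ∀ k l, k ≠ l → B k l = 0 := by
      intro k l hkl
      have h2 := congrFun h0 k
      simp only [rowScale, Pi.zero_apply, Complex.ofReal_eq_zero] at h2
      have h3 := congrFun (eq_zero_of_linScale_le hb h2.le) l
      simpa [hkl] using h3
    have h2 : ∀ ω, ∑ k, ∑ l, (if k = l then 0 else (X k ω : ℂ) * X l ω * B k l) = 0 := fun ω => by
      refine Finset.sum_eq_zero fun k _ => Finset.sum_eq_zero fun l _ => ?_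
      split_ifs with hkl
      · rfl
      · rw [h1 k l hkl, mul_zero]
    have h3 : quadScale s b B = 0 := le_antisymm h (linScale_nonneg hb.le _)
    simp [h2, h3]
  push Not at h
  set Bo : Fin n → Fin n → ℂ := fun k l => if l < k then 2 * B k l else 0 with hBo
  set β : Fin n → ℝ := fun k => linScale s b fun l => if k = l then 0 else B k l with hβ
  have hβ0 : ∀ k, 0 ≤ β k := fun k => linScale_nonneg hb.le _
  have hBoβ : ∀ k, linScale s b (Bo k) ≤ 2 * β k := by
    intro k
    have hn : ∀ l, ‖Bo k l‖ ≤ 2 * ‖(if k = l then 0 else B k l : ℂ)‖ := by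
      intro l
      simp only [hBo]
      split_ifs with h1 h2 h2
      · exact absurd h2 h1.ne'
      · simp
      · simp
      · simp
    have e1 : √(∑ l, s l * ‖Bo k l‖ ^ 2) ≤
        2 * √(∑ l, s l * ‖(if k = l then 0 else B k l : ℂ)‖ ^ 2) := by
      refine Real.sqrt_le_iff.mpr ⟨by positivity, ?_⟩
      rw [mul_pow, Real.sq_sqrt (Finset.sum_nonneg fun l _ => mul_nonneg (hs l) (by positivity)),
        Finset.mul_sum]
      refine Finset.sum_le_sum fun l _ => ?_
      have := pow_le_pow_left₀ (norm_nonneg _) (hn l) 2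
      rw [mul_pow] at this
      nlinarith [hs l]
    have e2 : ‖Bo k‖ ≤ 2 * ‖(fun l => if k = l then 0 else B k l : Fin n → ℂ)‖ := by
      refine (pi_norm_le_iff_of_nonneg (by positivity)).mpr fun l => (hn l).trans ?_
      exact mul_le_mul_of_nonneg_left
        (norm_le_pi_norm (fun l => if k = l then 0 else B k l : Fin n → ℂ) l) (by norm_num)
    simp only [hβ, linScale]
    nlinarith
  set L : Fin n → (Fin n → ℝ) → ℂ := fun k x => ∑ l, (x l : ℂ) * (2 * B k l) with hL
  have hLm : ∀ k, Measurable (L k) := fun k => by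
    refine Finset.measurable_sum _ fun l _ => ?_
    exact (Complex.measurable_ofReal.comp (measurable_pi_apply l)).mul_const _
  have hLpast : ∀ k x, L k (past x k) = ∑ l, (x l : ℂ) * Bo k l := by
    intro k x
    refine Finset.sum_congr rfl fun l _ => ?_
    simp only [past, hBo, Fin.lt_def]
    split_ifs <;> simp
  -- The martingale bound needs deterministic bounds on the coefficients, so L_k is cut off at
  -- 4tβ_k. By the linear tail bound at scale at most 2β_k, the cutoff is inactive outside n
  -- unlikely events. The factor 8t² is 2t · 4t.
  set F : Fin n → (Fin n → ℝ) → ℂ := fun k x => if ‖L k x‖ ≤ 4 * t * β k then L k x else 0 with hF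
  have hFm : ∀ k, Measurable (F k) := fun k =>
    Measurable.ite (measurableSet_le (hLm k).norm measurable_const) (hLm k) measurable_const
  have hFβ : ∀ k x, ‖F k x‖ ≤ 4 * t * β k := by
    intro k x
    simp only [hF]
    split_ifs with h1
    · exact h1
    · rw [norm_zero]; have := hβ0 k; positivity
  have hmain := hX.tail_complex hFm hFβ (σ := 4 * t * quadScale s b B) (by positivity)
    (fun k => by
      have := mul_norm_le_linScale (s := s) hb.le (rowScale s b B) k
      rw [rowScale, Complex.norm_real, Real.norm_eq_abs, abs_of_nonneg (hβ0 k)] at this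
      calc b * (4 * t * β k) = 4 * t * (b * β k) := by ring
        _ ≤ _ := mul_le_mul_of_nonneg_left this (by positivity))
    (by
      have := sum_le_linScale_sq hb.le hs (rowScale s b B)
      simp only [rowScale, Complex.norm_real, Real.norm_eq_abs, sq_abs] at this
      calc ∑ k, s k * (4 * t * β k) ^ 2 = (4 * t) ^ 2 * ∑ k, s k * β k ^ 2 := by
            rw [Finset.mul_sum]; exact Finset.sum_congr rfl fun k _ => by ring
        _ ≤ (4 * t) ^ 2 * quadScale s b B ^ 2 :=
            mul_le_mul_of_nonneg_left this (by positivity)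
        _ = _ := by ring) t
  have hsub : {ω | 8 * t ^ 2 * quadScale s b B <
        ‖∑ k, ∑ l, (if k = l then 0 else (X k ω : ℂ) * X l ω * B k l)‖} ⊆
      {ω | 2 * t * (4 * t * quadScale s b B) <
        ‖∑ k, (X k ω : ℂ) * F k (past (fun j => X j ω) k)‖} ∪
      ⋃ k, {ω | 2 * t * linScale s b (Bo k) < ‖∑ l, (X l ω : ℂ) * Bo k l‖} := by
    intro ω hω
    by_cases hk : ∃ k, 2 * t * linScale s b (Bo k) < ‖∑ l, (X l ω : ℂ) * Bo k l‖
    · exact Or.inr (Set.mem_iUnion.mpr hk)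
    · left
      push Not at hk
      have hFL : ∀ k, F k (past (fun j => X j ω) k) = L k (past (fun j => X j ω) k) := by
        intro k
        simp only [hF]
        rw [if_pos]
        rw [hLpast]
        refine (hk k).trans ?_
        have := hBoβ k
        nlinarith
      simp only [Set.mem_ofPred_eq] at hω ⊢
      rw [sum_offdiag_eq B hB (fun k => X k ω)] at hω
      simp only [hFL, hL]
      calc _ = 8 * t ^ 2 * quadScale s b B := by ring
        _ < _ := hω
  refine (measure_mono hsub).trans ((measure_union_le _ _).trans ?_)
  have hU : P (⋃ k, {ω | 2 * t * linScale s b (Bo k) < ‖∑ l, (X l ω : ℂ) * Bo k l‖}) ≤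
      ENNReal.ofReal (n * (4 * Real.exp (1 - t))) := by
    refine (measure_iUnion_fintype_le _ _).trans ?_
    refine (Finset.sum_le_sum fun k _ => hX.tail_linear hb hs (Bo k) t).trans ?_
    rw [Finset.sum_const, Finset.card_univ, Fintype.card_fin, nsmul_eq_mul,
      ENNReal.ofReal_mul (p := (n : ℝ)) (by positivity), ENNReal.ofReal_natCast]
  refine (add_le_add hmain hU).trans ?_
  rw [← ENNReal.ofReal_add (by positivity) (by positivity)]
  exact ENNReal.ofReal_le_ofReal (by linarith)

/-- Large deviations of diagonal quadratic forms. -/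
lemma IsBoundedFamily.tail_square (hX : IsBoundedFamily P X b s) (hb : 0 < b)
    (hs : ∀ k, 0 ≤ s k) (c : Fin n → ℂ) (t : ℝ) :
    P {ω | 2 * t * linScale (fun k => s k * b ^ 2) (b ^ 2) c <
        ‖∑ k, ((X k ω ^ 2 - ∫ ω, X k ω ^ 2 ∂P : ℝ) : ℂ) * c k‖} ≤
      ENNReal.ofReal (4 * Real.exp (1 - t)) := by
  have hint : ∀ k, ∀ p : ℕ, Integrable (fun ω => X k ω ^ p) P := by
    intro k p
    refine Integrable.of_bound ((hX.measurable k).pow_const p).aestronglyMeasurable (b ^ p) ?_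
    filter_upwards [hX.bound k] with ω hω
    rw [norm_pow]
    exact pow_le_pow_left₀ (norm_nonneg _) hω p
  have hle : ∀ k, ∀ᵐ ω ∂P, X k ω ^ 2 ≤ b ^ 2 := by
    intro k
    filter_upwards [hX.bound k] with ω hω
    exact sq_le_sq' (abs_le.mp hω).1 (abs_le.mp hω).2
  have hE0 : ∀ k, 0 ≤ ∫ ω, X k ω ^ 2 ∂P := fun k => integral_nonneg fun ω => sq_nonneg _
  have hE1 : ∀ k, ∫ ω, X k ω ^ 2 ∂P ≤ b ^ 2 := by
    intro k
    have := integral_mono_ae (hint k 2) (integrable_const (b ^ 2)) (hle k)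
    simpa using this
  refine IsBoundedFamily.tail_linear (X := fun k ω => X k ω ^ 2 - ∫ ω, X k ω ^ 2 ∂P) ⟨?_, ?_, ?_,
    ?_, ?_⟩ (by positivity) (fun k => mul_nonneg (hs k) (by positivity)) c t
  · exact fun k => ((hX.measurable k).pow_const 2).sub_const _
  · exact hX.indep.comp (fun k x => x ^ 2 - ∫ ω, X k ω ^ 2 ∂P) fun k => by fun_prop
  · intro k
    filter_upwards [hle k] with ω hω
    exact abs_le.mpr ⟨by linarith [sq_nonneg (X k ω), hE1 k], by linarith [hE0 k]⟩
  · intro k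
    rw [integral_sub (hint k 2) (integrable_const _)]
    simp
  · intro k
    set E := ∫ ω, X k ω ^ 2 ∂P with hE
    have e : ∀ ω, (X k ω ^ 2 - E) ^ 2 = X k ω ^ 4 - 2 * E * X k ω ^ 2 + E ^ 2 := fun ω => by ring
    simp only [e]
    rw [integral_add (f := fun ω => X k ω ^ 4 - 2 * E * X k ω ^ 2)
        ((hint k 4).sub ((hint k 2).const_mul _)) (integrable_const _),
      integral_sub (hint k 4) ((hint k 2).const_mul _), integral_const_mul, ← hE]
    -- Boundedness turns the fourth moment into b² times the second, so X² has variance at most b²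
    -- s_k.
    have h4 : ∫ ω, X k ω ^ 4 ∂P ≤ b ^ 2 * E := by
      rw [hE, ← integral_const_mul]
      refine integral_mono_ae (hint k 4) ((hint k 2).const_mul _) ?_
      filter_upwards [hle k] with ω hω
      nlinarith [sq_nonneg (X k ω)]
    have := hX.var k
    simp
    nlinarith [sq_nonneg E, sq_nonneg b]

end LargeDeviation

/-! ### Weights and averages of the variance profile -/

section Profile

variable {N r : ℕ}

/-- The conditions on the vectors `γ` of a Chung–Lu ensemble. -/
structure IsProfile (q L : ℝ) (γ : Fin r → Fin N → ℝ) : Prop where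
  pos_N : 0 < N
  pos_r : 0 < r
  one_le : ∀ k i, 1 ≤ γ k i
  sum_theta_sq : (1 / (N : ℝ)) * ∑ i, theta γ i ^ 2 ≤ L
  sparse : ∀ i j, q * varianceProfile γ i j ≤ 1

variable {q L : ℝ} {γ : Fin r → Fin N → ℝ} (hγ : IsProfile q L γ)

include hγ in
lemma IsProfile.gamma_le_theta (k : Fin r) (i : Fin N) : γ k i ≤ theta γ i :=
  Finset.single_le_sum (f := fun k => γ k i)
    (fun j _ => zero_le_one.trans (hγ.one_le j i)) (Finset.mem_univ k)

include hγ in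
lemma IsProfile.one_le_theta (i : Fin N) : 1 ≤ theta γ i :=
  (hγ.one_le ⟨0, hγ.pos_r⟩ i).trans (hγ.gamma_le_theta _ i)

include hγ in
lemma IsProfile.theta_pos (i : Fin N) : 0 < theta γ i := zero_lt_one.trans_le (hγ.one_le_theta i)

include hγ in
lemma IsProfile.gamma_pos (k : Fin r) (i : Fin N) : 0 < γ k i :=
  zero_lt_one.trans_le (hγ.one_le k i)

include hγ in
lemma IsProfile.N_pos : (0 : ℝ) < N := Nat.cast_pos.mpr hγ.pos_N

include hγ in
lemma IsProfile.variance_nonneg (i j : Fin N) : 0 ≤ varianceProfile γ i j := by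
  have := hγ.N_pos
  refine mul_nonneg (by positivity) (Finset.sum_nonneg fun k _ => ?_)
  exact mul_nonneg (hγ.gamma_pos k i).le (hγ.gamma_pos k j).le

include hγ in
lemma IsProfile.variance_le (i j : Fin N) :
    varianceProfile γ i j ≤ 1 / N * (theta γ i * theta γ j) := by
  have := hγ.N_pos
  refine mul_le_mul_of_nonneg_left ?_ (by positivity)
  rw [theta, Finset.sum_mul]
  refine Finset.sum_le_sum fun k _ => ?_
  exact mul_le_mul_of_nonneg_left (hγ.gamma_le_theta k j) (hγ.gamma_pos k i).le

include hγ in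
lemma IsProfile.variance_le_inv (hq : 0 < q) (i j : Fin N) : varianceProfile γ i j ≤ 1 / q := by
  rw [le_div_iff₀ hq, mul_comm]; exact hγ.sparse i j

include hγ in
lemma IsProfile.mean_theta_le : 1 / (N : ℝ) * ∑ i, theta γ i ≤ L := by
  have := hγ.N_pos
  refine le_trans (mul_le_mul_of_nonneg_left (Finset.sum_le_sum fun i _ => ?_) (by positivity))
    hγ.sum_theta_sq
  have := hγ.one_le_theta i
  nlinarith

include hγ in
/-- Averages weighted by `γ k` of quantities bounded by `B * θ`. -/
lemma IsProfile.mean_gamma_le (k : Fin r) {f : Fin N → ℝ} {B : ℝ} (hB : 0 ≤ B)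
    (hf : ∀ i, f i ≤ B * theta γ i) : 1 / (N : ℝ) * ∑ i, γ k i * f i ≤ B * L := by
  have hN := hγ.N_pos
  calc 1 / (N : ℝ) * ∑ i, γ k i * f i ≤ 1 / (N : ℝ) * ∑ i, B * theta γ i ^ 2 := by
        refine mul_le_mul_of_nonneg_left (Finset.sum_le_sum fun i _ => ?_) (by positivity)
        have h1 := hγ.gamma_le_theta k i
        have h2 := hγ.gamma_pos k i
        have h3 := mul_le_mul_of_nonneg_left (hf i) h2.le
        have h4 := mul_nonneg hB (hγ.theta_pos i).le
        nlinarith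
    _ = B * (1 / (N : ℝ) * ∑ i, theta γ i ^ 2) := by rw [← Finset.mul_sum]; ring
    _ ≤ _ := mul_le_mul_of_nonneg_left hγ.sum_theta_sq hB

include hγ in
lemma IsProfile.mean_const (c : ℝ) : 1 / (N : ℝ) * ∑ _i : Fin N, c = c := by
  have hN := hγ.N_pos
  rw [Finset.sum_const, Finset.card_univ, Fintype.card_fin, nsmul_eq_mul]
  field_simp

include hγ in
lemma IsProfile.mean_mono {f g : Fin N → ℝ} (h : ∀ i, f i ≤ g i) :
    1 / (N : ℝ) * ∑ i, f i ≤ 1 / (N : ℝ) * ∑ i, g i := by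
  have hN := hγ.N_pos
  exact mul_le_mul_of_nonneg_left (Finset.sum_le_sum fun i _ => h i) (by positivity)

include hγ in
lemma IsProfile.sq_mean_le (f : Fin N → ℝ) :
    (1 / (N : ℝ) * ∑ i, f i) ^ 2 ≤ 1 / (N : ℝ) * ∑ i, f i ^ 2 := by
  have hN := hγ.N_pos
  set m := 1 / (N : ℝ) * ∑ i, f i with hm
  have h : 1 / (N : ℝ) * ∑ i, (2 * m * f i - m ^ 2) ≤ 1 / (N : ℝ) * ∑ i, f i ^ 2 :=
    hγ.mean_mono fun i => by nlinarith [sq_nonneg (f i - m)]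
  rw [Finset.sum_sub_distrib, mul_sub, hγ.mean_const, ← Finset.mul_sum] at h
  have e : 1 / (N : ℝ) * (2 * m * ∑ i, f i) = 2 * m * m := by rw [hm]; ring
  rw [e] at h
  nlinarith

end Profile

/-! ### The self-consistent system: bounds and stability -/

section SelfConsistent

variable {N r : ℕ} {q L : ℝ} {γ : Fin r → Fin N → ℝ} {z : ℂ} {u : Fin r → ℂ}

lemma scDenom_im (γ : Fin r → Fin N → ℝ) (z : ℂ) (u : Fin r → ℂ) (i : Fin N) :
    (scDenom γ z u i).im = z.im + ∑ j, γ j i * (u j).im := by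
  simp [scDenom]

lemma scDenom_sub (γ : Fin r → Fin N → ℝ) (z : ℂ) (u w : Fin r → ℂ) (i : Fin N) :
    scDenom γ z u i - scDenom γ z w i = ∑ j, (γ j i : ℂ) * (u j - w j) := by
  simp [scDenom, mul_sub, Finset.sum_sub_distrib]

lemma im_neg_inv (D : ℂ) : (-(1 / D)).im = ‖-(1 / D)‖ ^ 2 * D.im := by
  rw [norm_neg, norm_div, norm_one, one_div, one_div, Complex.neg_im, Complex.inv_im, inv_pow,
    Complex.sq_norm]
  ring

lemma scG_im (γ : Fin r → Fin N → ℝ) (z : ℂ) (u : Fin r → ℂ) (i : Fin N) :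
    (scG γ z u i).im = ‖scG γ z u i‖ ^ 2 * (scDenom γ z u i).im := im_neg_inv _

lemma norm_scG (γ : Fin r → Fin N → ℝ) (z : ℂ) (u : Fin r → ℂ) (i : Fin N) :
    ‖scG γ z u i‖ = 1 / ‖scDenom γ z u i‖ := by
  rw [scG, norm_neg, norm_div, norm_one]

lemma scM_eq (γ : Fin r → Fin N → ℝ) (z : ℂ) (u : Fin r → ℂ) :
    scM γ z u = (1 / (N : ℂ)) * ∑ i, scG γ z u i := by
  simp [scM, scG]

lemma scM_im (γ : Fin r → Fin N → ℝ) (z : ℂ) (u : Fin r → ℂ) :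
    (scM γ z u).im = 1 / (N : ℝ) * ∑ i, (scG γ z u i).im := by
  have : (1 / (N : ℂ)) = ((1 / (N : ℝ) : ℝ) : ℂ) := by push_cast; rfl
  rw [scM_eq, this, Complex.im_ofReal_mul, Complex.im_sum]

/-- The right-hand side of the self-consistent system. -/
def scMap (γ : Fin r → Fin N → ℝ) (z : ℂ) (u : Fin r → ℂ) (k : Fin r) : ℂ :=
  ((1 / (N : ℝ) : ℝ) : ℂ) * ∑ i, (γ k i : ℂ) * scG γ z u i

lemma IsSCSolution.eq_scMap (hu : IsSCSolution γ z u) (k : Fin r) : u k = scMap γ z u k := by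
  rw [(hu k).2, scMap]
  simp [scG, div_eq_mul_inv]

lemma scMap_im (γ : Fin r → Fin N → ℝ) (z : ℂ) (u : Fin r → ℂ) (k : Fin r) :
    (scMap γ z u k).im = 1 / (N : ℝ) * ∑ i, γ k i * (scG γ z u i).im := by
  rw [scMap, Complex.im_ofReal_mul, Complex.im_sum]
  simp

variable (hγ : IsProfile q L γ)

include hγ in
/-- If all `Im u j ≥ 1 / C`, then the denominators are at least of order `θ i`. -/
lemma theta_div_le_scDenom_im {C : ℝ} (hz : 0 < z.im)
    (hu : ∀ j, 1 / C ≤ (u j).im) (i : Fin N) : theta γ i / C ≤ (scDenom γ z u i).im := by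
  rw [scDenom_im, theta, div_eq_mul_one_div, Finset.sum_mul]
  have : ∑ j, γ j i * (1 / C) ≤ ∑ j, γ j i * (u j).im :=
    Finset.sum_le_sum fun j _ => mul_le_mul_of_nonneg_left (hu j) (hγ.gamma_pos j i).le
  linarith

include hγ in
lemma theta_mul_norm_scG_le {C : ℝ} (hC : 0 < C) (hz : 0 < z.im)
    (hu : ∀ j, 1 / C ≤ (u j).im) (i : Fin N) : theta γ i * ‖scG γ z u i‖ ≤ C := by
  have h := theta_div_le_scDenom_im hγ hz hu i
  have h2 := (le_abs_self _).trans (Complex.abs_im_le_norm (scDenom γ z u i))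
  have h3 : 0 < theta γ i / C := div_pos (hγ.theta_pos i) hC
  have h4 : 0 < ‖scDenom γ z u i‖ := by linarith
  rw [norm_scG, mul_one_div, div_le_iff₀ h4]
  rw [div_le_iff₀ hC] at h
  nlinarith

include hγ in
-- The term z is absorbed because θ i ≥ 1.
lemma norm_scDenom_le {C : ℝ} (hz : ‖z‖ ≤ C) (hu : ∀ j, ‖u j‖ ≤ C) (i : Fin N) :
    ‖scDenom γ z u i‖ ≤ 2 * C * theta γ i := by
  have h1 : ‖∑ j, (γ j i : ℂ) * u j‖ ≤ theta γ i * C := by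
    rw [theta, Finset.sum_mul]
    refine (norm_sum_le _ _).trans (Finset.sum_le_sum fun j _ => ?_)
    rw [norm_mul, Complex.norm_real, Real.norm_eq_abs, abs_of_pos (hγ.gamma_pos j i)]
    exact mul_le_mul_of_nonneg_left (hu j) (hγ.gamma_pos j i).le
  have h2 := norm_add_le z (∑ j, (γ j i : ℂ) * u j)
  have h3 := hγ.one_le_theta i
  have h4 : 0 ≤ C := (norm_nonneg _).trans hz
  rw [scDenom]
  nlinarith

lemma scDenom_im_pos (hγ : IsProfile q L γ) (hz : 0 < z.im) (hu : ∀ j, 0 < (u j).im)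
    (i : Fin N) : z.im ≤ (scDenom γ z u i).im ∧ 0 < (scDenom γ z u i).im := by
  rw [scDenom_im]
  have : 0 ≤ ∑ j, γ j i * (u j).im :=
    Finset.sum_nonneg fun j _ => mul_nonneg (hγ.gamma_pos j i).le (hu j).le
  constructor <;> linarith

lemma scDenom_ne_zero (hγ : IsProfile q L γ) (hz : 0 < z.im) (hu : ∀ j, 0 < (u j).im)
    (i : Fin N) : scDenom γ z u i ≠ 0 := fun h => by
  have := (scDenom_im_pos hγ hz hu i).2
  simp [h] at this

lemma scG_im_pos (hγ : IsProfile q L γ) (hz : 0 < z.im) (hu : ∀ j, 0 < (u j).im)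
    (i : Fin N) : 0 < (scG γ z u i).im := by
  rw [scG_im, norm_scG]
  have h := scDenom_ne_zero hγ hz hu i
  have := (scDenom_im_pos hγ hz hu i).2
  positivity

lemma scG_sub (hγ : IsProfile q L γ) (hz : 0 < z.im) (hu : ∀ j, 0 < (u j).im)
    {w : Fin r → ℂ} (hw : ∀ j, 0 < (w j).im) (i : Fin N) :
    scG γ z u i - scG γ z w i =
      scG γ z u i * scG γ z w i * ∑ j, (γ j i : ℂ) * (u j - w j) := by
  rw [← scDenom_sub γ z u w]
  have h1 := scDenom_ne_zero hγ hz hu i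
  have h2 := scDenom_ne_zero hγ hz hw i
  simp only [scG]
  field_simp
  ring

lemma norm_scG_le_one (hγ : IsProfile q L γ) (hz : 1 ≤ z.im) (hu : ∀ j, 0 < (u j).im)
    (i : Fin N) : ‖scG γ z u i‖ ≤ 1 := by
  have h := (scDenom_im_pos hγ (by linarith) hu i)
  have h2 := (le_abs_self _).trans (Complex.abs_im_le_norm (scDenom γ z u i))
  rw [norm_scG]
  exact (div_le_one (by linarith)).mpr (by linarith)

include hγ in
/-- At distance of order one from the real axis the average of `Im g i` is bounded below. -/
lemma mean_scG_im_ge {C : ℝ} (hC : 0 < C) (hL : L ≤ C) (hz1 : 1 ≤ z.im) (hz : ‖z‖ ≤ C)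
    (hu0 : ∀ j, 0 < (u j).im) (hu : ∀ j, ‖u j‖ ≤ C) :
    1 / (4 * C ^ 3) ≤ 1 / (N : ℝ) * ∑ i, (scG γ z u i).im := by
  -- The squared denominators x_i are at most 4C²θ_i², with average at most 4C²L ≤ m. The tangent
  -- bound 1/x ≥ 2/m - x/m² then gives an average of 1/x_i of at least 1/m, using only the second
  -- moment of θ.
  set m := 4 * C ^ 3 with hm
  have hm0 : 0 < m := by positivity
  have h : ∀ i, 2 / m - (4 * C ^ 2) * theta γ i ^ 2 / m ^ 2 ≤ (scG γ z u i).im := by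
    intro i
    have h1 := norm_scDenom_le hγ hz hu i
    have h0 := norm_pos_iff.mpr (scDenom_ne_zero hγ (by linarith) hu0 i)
    rw [scG_im, norm_scG]
    have h2 := (scDenom_im_pos hγ (by linarith) hu0 i).1
    set x := ‖scDenom γ z u i‖ ^ 2 with hx
    have hx0 : 0 < x := by positivity
    have h3 : x ≤ 4 * C ^ 2 * theta γ i ^ 2 := by
      have := pow_le_pow_left₀ h0.le h1 2
      calc x ≤ _ := this
        _ = _ := by ring
    have h4 : 2 / m - x / m ^ 2 ≤ 1 / x := by
      have : 1 / x - (2 / m - x / m ^ 2) = (m - x) ^ 2 / (x * m ^ 2) := by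
        field_simp; ring
      have h5 : 0 ≤ (m - x) ^ 2 / (x * m ^ 2) := by positivity
      linarith
    have h5 : x / m ^ 2 ≤ 4 * C ^ 2 * theta γ i ^ 2 / m ^ 2 :=
      div_le_div_of_nonneg_right h3 (by positivity)
    have h6 : 1 / x ≤ (1 / ‖scDenom γ z u i‖) ^ 2 * (scDenom γ z u i).im := by
      rw [div_pow, one_pow, ← hx]
      have : 0 < 1 / x := by positivity
      nlinarith
    linarith
  have h2 := hγ.mean_mono h
  rw [Finset.sum_sub_distrib, mul_sub, hγ.mean_const, ← Finset.sum_div, ← Finset.mul_sum] at h2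
  have h3 : 1 / (N : ℝ) * ((4 * C ^ 2 * ∑ i, theta γ i ^ 2) / m ^ 2) ≤ 1 / m := by
    have e : 1 / (N : ℝ) * ((4 * C ^ 2 * ∑ i, theta γ i ^ 2) / m ^ 2) =
        4 * C ^ 2 * (1 / (N : ℝ) * ∑ i, theta γ i ^ 2) / m ^ 2 := by ring
    rw [e, div_le_div_iff₀ (by positivity) hm0]
    have := mul_le_mul_of_nonneg_left (hγ.sum_theta_sq.trans hL) (by positivity : 0 ≤ 4 * C ^ 2)
    have e2 : 4 * C ^ 2 * C = m := by rw [hm]; ring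
    rw [e2] at this
    nlinarith
  have h4 : 2 / m - 1 / m = 1 / m := by ring
  linarith

include hγ in
-- As γ ≥ 1 and Im g_i > 0, a lower bound on Im m passes to each of the r components.
lemma mean_im_le_scMap_im (hz : 0 < z.im) (hu : ∀ j, 0 < (u j).im) (k : Fin r) :
    1 / (N : ℝ) * ∑ i, (scG γ z u i).im ≤ (scMap γ z u k).im := by
  rw [scMap_im]
  refine hγ.mean_mono fun i => ?_
  have h1 := hγ.one_le k i
  have h2 := scG_im_pos hγ hz hu i
  nlinarith

include hγ in
lemma norm_scMap_le {C : ℝ} (k : Fin r) (h : ∀ i, γ k i * ‖scG γ z u i‖ ≤ C) :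
    ‖scMap γ z u k‖ ≤ C := by
  have hN := hγ.N_pos
  rw [scMap, norm_mul, Complex.norm_real, Real.norm_eq_abs, abs_of_pos (by positivity),
    ← hγ.mean_const C]
  refine mul_le_mul_of_nonneg_left ?_ (by positivity)
  refine (norm_sum_le _ _).trans (Finset.sum_le_sum fun i _ => ?_)
  rw [norm_mul, Complex.norm_real, Real.norm_eq_abs, abs_of_pos (hγ.gamma_pos k i)]
  exact h i

/-- The bounds on the solution of the self-consistent system in the bulk. -/
structure SCBounds (γ : Fin r → Fin N → ℝ) (z : ℂ) (u : Fin r → ℂ) (C : ℝ) : Prop where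
  norm_z : ‖z‖ ≤ C
  im_u : ∀ k, 1 / C ≤ (u k).im
  norm_u : ∀ k, ‖u k‖ ≤ C
  im_m : 1 / C ≤ 1 / (N : ℝ) * ∑ i, (scG γ z u i).im

include hγ in
-- Im m ≥ 1/C bounds every Im u_k below; this makes the denominators at least θ_i / C, and then γ
-- |g_i| ≤ C bounds |u_k| from above.
lemma scBounds_of_im_m {C : ℝ} (hC : 0 < C) (hz : 0 < z.im) (hzC : ‖z‖ ≤ C)
    (hu : IsSCSolution γ z u) (hm : 1 / C ≤ (scM γ z u).im) : SCBounds γ z u C := by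
  rw [scM_im] at hm
  have him : ∀ k, 1 / C ≤ (u k).im := fun k => by
    rw [hu.eq_scMap k]
    exact hm.trans (mean_im_le_scMap_im hγ hz (fun j => (hu j).1) k)
  refine ⟨hzC, him, fun k => ?_, hm⟩
  rw [hu.eq_scMap k]
  refine norm_scMap_le hγ k fun i => ?_
  have := theta_mul_norm_scG_le hγ hC hz him i
  exact (mul_le_mul_of_nonneg_right (hγ.gamma_le_theta k i) (norm_nonneg _)).trans this

include hγ in
-- Covers the part of the domain above the range of the bulk assumption: there |g_i| ≤ 1, hence
-- |u_k| ≤ L, and `mean_scG_im_ge` supplies the lower bound on Im m.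
lemma scBounds_of_one_le_im {C : ℝ} (hC : 1 ≤ C) (hL : L ≤ C) (hz : 1 ≤ z.im) (hzC : ‖z‖ ≤ C)
    (hu : IsSCSolution γ z u) : SCBounds γ z u (4 * C ^ 3) := by
  have hC3 : C ≤ 4 * C ^ 3 := by nlinarith [sq_nonneg (C - 1), sq_nonneg C]
  refine scBounds_of_im_m hγ (by positivity) (by linarith) (hzC.trans hC3) hu ?_
  rw [scM_im]
  refine mean_scG_im_ge hγ (by linarith) hL hz hzC (fun j => (hu j).1) fun j => ?_
  rw [hu.eq_scMap j]
  have hN := hγ.N_pos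
  rw [scMap, norm_mul, Complex.norm_real, Real.norm_eq_abs, abs_of_pos (by positivity)]
  refine le_trans ?_ (hγ.mean_theta_le.trans hL)
  refine mul_le_mul_of_nonneg_left ?_ (by positivity)
  refine (norm_sum_le _ _).trans (Finset.sum_le_sum fun i _ => ?_)
  rw [norm_mul, Complex.norm_real, Real.norm_eq_abs, abs_of_pos (hγ.gamma_pos j i)]
  have h1 := norm_scG_le_one hγ hz (fun j => (hu j).1) i
  have h2 := hγ.gamma_le_theta j i
  have h3 := hγ.gamma_pos j i
  nlinarith

/-- In Re(gh) the term -Im g · Im h is nonpositive, and |Re g| falls short of |g| by at least (Im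
g)² / (2|g|). This deficit is the gap used in `stability`. -/
lemma re_mul_le (g h : ℂ) (hg : 0 < g.im) (hh : 0 ≤ h.im) :
    (g * h).re ≤ ‖g‖ * ‖h‖ - g.im ^ 2 * ‖h‖ / (2 * ‖g‖) := by
  have hg0 : 0 < ‖g‖ := norm_pos_iff.mpr fun h => by simp [h] at hg
  have h1 : |g.re| ≤ ‖g‖ - g.im ^ 2 / (2 * ‖g‖) := by
    have h2 := Complex.sq_norm g
    rw [Complex.normSq_apply] at h2
    have h3 := Complex.abs_re_le_norm g
    rw [le_sub_iff_add_le, ← le_sub_iff_add_le', div_le_iff₀ (by positivity)]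
    have h4 := sq_abs g.re
    nlinarith [abs_nonneg g.re]
  have h2 : g.re * h.re ≤ |g.re| * ‖h‖ := by
    refine (le_abs_self _).trans ?_
    rw [abs_mul]
    exact mul_le_mul_of_nonneg_left (Complex.abs_re_le_norm h) (abs_nonneg _)
  have h3 := mul_le_mul_of_nonneg_right h1 (norm_nonneg h)
  have h4 : (‖g‖ - g.im ^ 2 / (2 * ‖g‖)) * ‖h‖ =
    ‖g‖ * ‖h‖ - g.im ^ 2 * ‖h‖ / (2 * ‖g‖) := by ring
  rw [Complex.mul_re]
  nlinarith [mul_nonneg hg.le hh]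

include hγ in
-- Take imaginary parts, with Im g_i = |g_i|² (η + ∑_j γ_j Im u_j), and drop η: the nonnegative
-- kernel N⁻¹ ∑_i γ_k |g_i|² γ_j does not increase the vector Im u of a solution.
lemma sum_norm_scG_sq_le (hz : 0 < z.im) (k : Fin r) :
    1 / (N : ℝ) * ∑ i, γ k i * (‖scG γ z u i‖ ^ 2 * ∑ j, γ j i * (u j).im) ≤
      (scMap γ z u k).im := by
  rw [scMap_im]
  refine hγ.mean_mono fun i => mul_le_mul_of_nonneg_left ?_ (hγ.gamma_pos k i).le
  rw [scG_im, scDenom_im]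
  exact mul_le_mul_of_nonneg_left (by linarith) (by positivity)

include hγ in
/-- Stability of the self-consistent system in the bulk. -/
lemma stability {C ε : ℝ} (hC : 1 ≤ C) (hz : 0 < z.im) (hu : IsSCSolution γ z u)
    (hb : SCBounds γ z u C) {w : Fin r → ℂ} (hw : ∀ k, 1 / C ≤ (w k).im)
    (hwC : ∀ k, ‖w k‖ ≤ C) (hε : ∀ k, ‖w k - scMap γ z w k‖ ≤ ε) (hε' : 8 * C ^ 5 * ε ≤ 1)
    (k : Fin r) : ‖u k - w k‖ ≤ 8 * C ^ 6 * ε := by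
  have hC0 : 0 < C := by linarith
  have hN := hγ.N_pos
  have hu0 : ∀ j, 0 < (u j).im := fun j => (hu j).1
  have hw0 : ∀ j, 0 < (w j).im := fun j => (by positivity : (0 : ℝ) < 1 / C).trans_le (hw j)
  have hε0 : 0 ≤ ε := (norm_nonneg _).trans (hε k)
  set v : Fin r → ℝ := fun j => (u j).im
  set v' : Fin r → ℝ := fun j => (w j).im
  -- The geometric mean of the two imaginary parts is an approximate Perron vector for the mixed
  -- kernel with |g_i||g'_i|.
  set p : Fin r → ℝ := fun j => √(v j) * √(v' j) with hp
  have hp0 : ∀ j, 0 < p j := fun j => mul_pos (Real.sqrt_pos.mpr (hu0 j)) (Real.sqrt_pos.mpr (hw0 j))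
  have hpsq : ∀ j, p j ^ 2 = v j * v' j := fun j => by
    rw [hp, mul_pow, Real.sq_sqrt (hu0 j).le, Real.sq_sqrt (hw0 j).le]
  have hvC : ∀ j, v j ≤ C := fun j =>
    ((le_abs_self _).trans (Complex.abs_im_le_norm _)).trans (hb.norm_u j)
  have hvC' : ∀ j, v' j ≤ C := fun j =>
    ((le_abs_self _).trans (Complex.abs_im_le_norm _)).trans (hwC j)
  have hpC : ∀ j, p j ≤ C := fun j => by
    refine le_of_sq_le_sq ?_ hC0.le
    rw [hpsq, sq]
    exact mul_le_mul (hvC j) (hvC' j) (hw0 j).le hC0.le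
  have hpc : ∀ j, 1 / C ≤ p j := fun j => by
    refine le_of_sq_le_sq ?_ (hp0 j).le
    rw [hpsq, sq]
    exact mul_le_mul (hb.im_u j) (hw j) (by positivity) (hu0 j).le
  -- The estimate is made in the maximum norm weighted by 1/p, at a component where it is attained.
  obtain ⟨k₀, -, hk₀⟩ := Finset.exists_max_image Finset.univ (fun j => ‖u j - w j‖ / p j)
    ⟨k, Finset.mem_univ k⟩
  set d := ‖u k₀ - w k₀‖ / p k₀ with hd
  have hd0 : 0 ≤ d := div_nonneg (norm_nonneg _) (hp0 _).le
  have hxd : ∀ j, ‖u j - w j‖ ≤ d * p j := fun j =>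
    (div_le_iff₀ (hp0 j)).mp (hk₀ j (Finset.mem_univ j))
  have hxk : ‖u k₀ - w k₀‖ = d * p k₀ := by rw [hd]; field_simp [(hp0 k₀).ne']
  set X := ‖u k₀ - w k₀‖ with hX
  suffices hmain : X ≤ 8 * C ^ 4 * ε by
    have h1 : d ≤ C * (8 * C ^ 4 * ε) := by
      have h2 := hpc k₀
      rw [div_le_iff₀ hC0] at h2
      have : d ≤ C * X := by rw [hxk]; nlinarith
      exact this.trans (mul_le_mul_of_nonneg_left hmain hC0.le)
    calc ‖u k - w k‖ ≤ d * p k := hxd k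
      _ ≤ (C * (8 * C ^ 4 * ε)) * C := mul_le_mul h1 (hpC k) (hp0 k).le (by positivity)
      _ = _ := by ring
  rcases eq_or_lt_of_le (norm_nonneg (u k₀ - w k₀)) with hX0 | hX0
  · rw [hX, ← hX0]; positivity
  set g : Fin N → ℂ := scG γ z u
  set g' : Fin N → ℂ := scG γ z w
  have hg0 : ∀ i, 0 < (g i).im := scG_im_pos hγ hz hu0
  have hg0' : ∀ i, 0 < (g' i).im := scG_im_pos hγ hz hw0
  -- The deficit of Re(g_i g'_i) from `re_mul_le`. Since |g'_i| ≥ 1/(2Cθ_i) and |g_i| ≤ C/θ_i the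
  -- weights cancel, and the mean of (Im g_i)² is at least 1/C² by Jensen.
  set κ : Fin N → ℝ := fun i => (g i).im ^ 2 * ‖g' i‖ / (2 * ‖g i‖)
  have hκ : ∀ i, (g i).im ^ 2 / (4 * C ^ 2) ≤ κ i := by
    intro i
    have h1 := norm_scDenom_le hγ hb.norm_z hwC i
    have h2 := theta_mul_norm_scG_le hγ hC0 hz hb.im_u i
    have hd' := norm_pos_iff.mpr (scDenom_ne_zero hγ hz hw0 i)
    have hgn : 0 < ‖g i‖ := norm_pos_iff.mpr fun h => by have := hg0 i; simp [h] at this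
    have hθ := hγ.theta_pos i
    simp only [κ, g', norm_scG]
    rw [mul_one_div, div_div]
    refine div_le_div_of_nonneg_left (sq_nonneg _) (by positivity) ?_
    calc ‖scDenom γ z w i‖ * (2 * ‖g i‖) ≤ (2 * C * theta γ i) * (2 * ‖g i‖) :=
          mul_le_mul_of_nonneg_right h1 (by positivity)
      _ = 4 * C * (theta γ i * ‖g i‖) := by ring
      _ ≤ 4 * C * C := mul_le_mul_of_nonneg_left h2 (by positivity)
      _ = _ := by ring
  have hκsum : 1 / (4 * C ^ 4) ≤ 1 / (N : ℝ) * ∑ i, γ k₀ i * (γ k₀ i * κ i) := by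
    have h1 : (1 / C) ^ 2 ≤ 1 / (N : ℝ) * ∑ i, (g i).im ^ 2 :=
      (pow_le_pow_left₀ (by positivity) hb.im_m 2).trans (hγ.sq_mean_le _)
    have h2 : 1 / (N : ℝ) * ∑ i, (g i).im ^ 2 / (4 * C ^ 2) ≤
        1 / (N : ℝ) * ∑ i, γ k₀ i * (γ k₀ i * κ i) := hγ.mean_mono fun i => by
      have h3 := hγ.one_le k₀ i
      have h4 : 0 ≤ κ i := le_trans (by positivity) (hκ i)
      refine (hκ i).trans ?_
      have h5 : κ i ≤ γ k₀ i * κ i := le_mul_of_one_le_left h4 h3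
      exact h5.trans (le_mul_of_one_le_left (h4.trans h5) h3)
    refine le_trans ?_ h2
    rw [← Finset.sum_div, ← mul_div_assoc, le_div_iff₀ (by positivity)]
    refine le_trans (le_of_eq ?_) h1
    field_simp
  set B := 1 / (N : ℝ) * ∑ i, γ k₀ i * (‖g i‖ * ‖g' i‖ * ∑ j, γ j i * p j) with hB
  -- Arithmetic-geometric mean inequality applied to √v'_{k₀} |g_i| √v_j and √v_{k₀} |g'_i| √v'_j;
  -- the two squares are sums bounded by `sum_norm_scG_sq_le`, for u exactly and for w up to ε.
  have hpB : p k₀ * B ≤ p k₀ ^ 2 + v k₀ * ε / 2 := by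
    have e1 := sum_norm_scG_sq_le (u := u) hγ hz k₀
    rw [← hu.eq_scMap] at e1
    have e2 : 1 / (N : ℝ) * ∑ i, γ k₀ i * (‖g' i‖ ^ 2 * ∑ j, γ j i * v' j) ≤ v' k₀ + ε := by
      refine (sum_norm_scG_sq_le hγ hz k₀).trans ?_
      have := (abs_le.mp ((Complex.abs_im_le_norm _).trans (hε k₀))).1
      rw [Complex.sub_im] at this
      linarith
    have e3 : p k₀ * B ≤ 1 / (N : ℝ) * ∑ i, (v' k₀ / 2 * (γ k₀ i * (‖g i‖ ^ 2 * ∑ j, γ j i * v j)) +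
        v k₀ / 2 * (γ k₀ i * (‖g' i‖ ^ 2 * ∑ j, γ j i * v' j))) := by
      have : p k₀ * B = 1 / (N : ℝ) *
          ∑ i, p k₀ * (γ k₀ i * (‖g i‖ * ‖g' i‖ * ∑ j, γ j i * p j)) := by
        rw [hB, ← Finset.mul_sum]; ring
      rw [this]
      refine hγ.mean_mono fun i => ?_
      simp only [Finset.mul_sum]
      rw [← Finset.sum_add_distrib]
      refine Finset.sum_le_sum fun j _ => ?_
      have h1 := hγ.gamma_pos j i
      have h2 := hγ.gamma_pos k₀ i
      have h3 := two_mul_le_add_sq (√(v' k₀) * (‖g i‖ * √(v j))) (√(v k₀) * (‖g' i‖ * √(v' j)))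
      simp only [mul_pow, Real.sq_sqrt (hu0 _).le, Real.sq_sqrt (hw0 _).le, v, v'] at h3
      have h4 := mul_le_mul_of_nonneg_left h3 (mul_pos h1 h2).le
      simp only [hp, v, v']
      nlinarith [h4]
    rw [Finset.sum_add_distrib, ← Finset.mul_sum, ← Finset.mul_sum] at e3
    have e4 := mul_le_mul_of_nonneg_left e1 (hw0 k₀).le
    have e5 := mul_le_mul_of_nonneg_left e2 (hu0 k₀).le
    rw [hpsq]
    simp only [v, v', g, g'] at *
    nlinarith
  have hdB : d * B ≤ X * (1 + C * ε / 2) := by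
    have h1 : v k₀ ≤ C * p k₀ ^ 2 := by
      rw [hpsq]
      have h2 := hw k₀
      rw [div_le_iff₀ hC0] at h2
      have := mul_le_mul_of_nonneg_left h2 (hu0 k₀).le
      simp only [v, v']
      linarith
    have h2 := mul_le_mul_of_nonneg_left hpB hd0
    have h3 : p k₀ * (d * B) ≤ p k₀ * (X * (1 + C * ε / 2)) := by
      rw [hxk]
      have h4 := mul_le_mul_of_nonneg_left h1 (mul_nonneg hd0 hε0)
      nlinarith
    exact le_of_mul_le_mul_left h3 (hp0 k₀)
  -- Multiply the difference of the two equations at k₀ by the conjugate of u_{k₀} - w_{k₀} and take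
  -- real parts. Terms with j ≠ k₀ are bounded by their modulus; the term j = k₀ is X² g_i g'_i, so
  -- it gains the deficit κ_i.
  have hXX : X ^ 2 ≤ X * (d * B) - X ^ 2 * (1 / (N : ℝ) * ∑ i, γ k₀ i * (γ k₀ i * κ i)) +
      X * ε := by
    have hx : u k₀ - w k₀ = ((1 / (N : ℝ) : ℝ) : ℂ) *
        (∑ i, (γ k₀ i : ℂ) * (g i * g' i * ∑ j, (γ j i : ℂ) * (u j - w j))) -
          (w k₀ - scMap γ z w k₀) := by
      have : (∑ i, (γ k₀ i : ℂ) * (g i * g' i * ∑ j, (γ j i : ℂ) * (u j - w j))) =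
          ∑ i, (γ k₀ i : ℂ) * g i - ∑ i, (γ k₀ i : ℂ) * g' i := by
        rw [← Finset.sum_sub_distrib]
        refine Finset.sum_congr rfl fun i _ => ?_
        rw [← scG_sub hγ hz hu0 hw0]; ring
      rw [this, mul_sub]
      have h1 := hu.eq_scMap k₀
      rw [scMap] at h1
      rw [scMap, ← h1]
      ring
    set y := (starRingEnd ℂ) (u k₀ - w k₀) with hy
    have hyn : ‖y‖ = X := by rw [hy, RCLike.norm_conj]
    have hX2 : X ^ 2 = (y * (u k₀ - w k₀)).re := by
      rw [hy, Complex.conj_mul', ← Complex.ofReal_pow, Complex.ofReal_re]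
    have hyx : y * (u k₀ - w k₀) = ((1 / (N : ℝ) : ℝ) : ℂ) *
        (∑ i, (γ k₀ i : ℂ) * ∑ j, (γ j i : ℂ) * (y * (g i * g' i * (u j - w j)))) -
          y * (w k₀ - scMap γ z w k₀) := by
      conv_lhs => rw [hx]
      simp only [Finset.mul_sum, mul_sub]
      congr 1
      refine Finset.sum_congr rfl fun i _ => Finset.sum_congr rfl fun j _ => by ring
    refine le_of_eq_of_le (hX2.trans (congrArg Complex.re hyx)) ?_
    rw [Complex.sub_re, Complex.re_ofReal_mul, Complex.re_sum]
    have h1 : -(y * (w k₀ - scMap γ z w k₀)).re ≤ X * ε := by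
      refine (neg_le_abs _).trans ((Complex.abs_re_le_norm _).trans ?_)
      rw [norm_mul, hyn]
      exact mul_le_mul_of_nonneg_left (hε k₀) hX0.le
    have h2 : 1 / (N : ℝ) * ∑ i, ((γ k₀ i : ℂ) *
        ∑ j, (γ j i : ℂ) * (y * (g i * g' i * (u j - w j)))).re ≤
        1 / (N : ℝ) * ∑ i, (X * d * (γ k₀ i * (‖g i‖ * ‖g' i‖ * ∑ j, γ j i * p j)) -
          X ^ 2 * (γ k₀ i * (γ k₀ i * κ i))) := by
      refine hγ.mean_mono fun i => ?_
      rw [Complex.re_ofReal_mul, Complex.re_sum]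
      have e : X * d * (γ k₀ i * (‖g i‖ * ‖g' i‖ * ∑ j, γ j i * p j)) -
          X ^ 2 * (γ k₀ i * (γ k₀ i * κ i)) =
          γ k₀ i * ∑ j, (X * d * (‖g i‖ * ‖g' i‖) * (γ j i * p j) -
            if j = k₀ then X ^ 2 * (γ j i * κ i) else 0) := by
        rw [Finset.sum_sub_distrib, ← Finset.mul_sum]
        simp
        ring
      rw [e]
      refine mul_le_mul_of_nonneg_left (Finset.sum_le_sum fun j _ => ?_) (hγ.gamma_pos k₀ i).le
      rw [Complex.re_ofReal_mul]
      have hγj := hγ.gamma_pos j i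
      split_ifs with hj
      · subst hj
        have e2 : y * (g i * g' i * (u j - w j)) = ((X ^ 2 : ℝ) : ℂ) * (g i * g' i) := by
          have : y * (u j - w j) = ((X ^ 2 : ℝ) : ℂ) := by
            rw [hy, Complex.conj_mul', ← Complex.ofReal_pow]
          rw [← this]; ring
        rw [e2, Complex.re_ofReal_mul]
        have h3 := re_mul_le (g i) (g' i) (hg0 i) (hg0' i).le
        have h4 : X * d * (‖g i‖ * ‖g' i‖) * (γ j i * p j) = γ j i * (X ^ 2 * (‖g i‖ * ‖g' i‖)) := by
          calc _ = γ j i * (X * (d * p j) * (‖g i‖ * ‖g' i‖)) := by ring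
            _ = _ := by rw [← hxk]; ring
        rw [h4]
        have h5 := mul_le_mul_of_nonneg_left h3 (mul_pos hγj (pow_pos hX0 2)).le
        simp only [κ]
        linarith
      · rw [sub_zero]
        have h3 : (y * (g i * g' i * (u j - w j))).re ≤ X * (‖g i‖ * ‖g' i‖ * (d * p j)) := by
          refine (le_abs_self _).trans ((Complex.abs_re_le_norm _).trans ?_)
          rw [norm_mul, norm_mul, norm_mul, hyn]
          exact mul_le_mul_of_nonneg_left
            (mul_le_mul_of_nonneg_left (hxd j) (by positivity)) hX0.le
        have h4 := mul_le_mul_of_nonneg_left h3 hγj.le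
        linarith
    rw [Finset.sum_sub_distrib, ← Finset.mul_sum, ← Finset.mul_sum] at h2
    have h3 : X * (d * B) = 1 / (N : ℝ) *
        (X * d * ∑ i, γ k₀ i * (‖g i‖ * ‖g' i‖ * ∑ j, γ j i * p j)) := by rw [hB]; ring
    rw [h3]
    linarith
  have hfin : X ^ 2 * (1 / (4 * C ^ 4)) ≤ X * (X * (C * ε / 2) + ε) := by
    have h1 := mul_le_mul_of_nonneg_left hdB hX0.le
    have h2 := mul_le_mul_of_nonneg_left hκsum (sq_nonneg X)
    nlinarith
  have hfin2 : X * (1 / (4 * C ^ 4)) ≤ X * (C * ε / 2) + ε := by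
    have : X * (X * (1 / (4 * C ^ 4))) ≤ X * (X * (C * ε / 2) + ε) := by
      calc _ = X ^ 2 * (1 / (4 * C ^ 4)) := by ring
        _ ≤ _ := hfin
    exact le_of_mul_le_mul_left this hX0
  -- Smallness of ε lets half of the gap 1/(4C⁴) absorb the error that multiplies X.
  have h1 : C * ε / 2 ≤ 1 / (8 * C ^ 4) := by
    rw [le_div_iff₀ (by positivity)]
    nlinarith [pow_pos hC0 5, pow_pos hC0 4]
  have h2 : X * (1 / (8 * C ^ 4)) ≤ ε := by
    have h3 := mul_le_mul_of_nonneg_left h1 hX0.le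
    have h4 : X * (1 / (4 * C ^ 4)) = X * (1 / (8 * C ^ 4)) + X * (1 / (8 * C ^ 4)) := by
      field_simp; ring
    linarith
  rw [mul_one_div, div_le_iff₀ (by positivity)] at h2
  linarith

end SelfConsistent

/-! ### Deterministic error estimates on the good event -/

section Deterministic

variable {N r : ℕ} {q L : ℝ} {γ : Fin r → Fin N → ℝ} {z : ℂ} {u : Fin r → ℂ}
  {A : Matrix (Fin N) (Fin N) ℝ}

/-- The large deviation bounds at the spectral parameter `z`. -/
structure GoodAt (γ : Fin r → Fin N → ℝ) (b T : ℝ) (A : Matrix (Fin N) (Fin N) ℝ) (z : ℂ) :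
    Prop where
  diag : ∀ i, |A i i| ≤ b
  lin : ∀ i j, ‖∑ k, (rowVec A i k : ℂ) * minorRes A z i k j‖ ≤
    T * linScale (varianceProfile γ i) b fun k => minorRes A z i k j
  sq : ∀ i, ‖∑ k, ((rowVec A i k ^ 2 - varianceProfile γ i k : ℝ) : ℂ) * minorRes A z i k k‖ ≤
    T * linScale (fun k => varianceProfile γ i k * b ^ 2) (b ^ 2) fun k => minorRes A z i k k
  quad : ∀ i, ‖∑ k, ∑ l, (if k = l then 0 else
      (rowVec A i k : ℂ) * rowVec A i l * minorRes A z i k l)‖ ≤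
    T * quadScale (varianceProfile γ i) b (minorRes A z i)

/-- The weighted averages of the diagonal of the resolvent. -/
def empU (γ : Fin r → Fin N → ℝ) (A : Matrix (Fin N) (Fin N) ℝ) (z : ℂ) (k : Fin r) : ℂ :=
  ((1 / (N : ℝ) : ℝ) : ℂ) * ∑ i, (γ k i : ℂ) * resolvent A z i i

/-- The error in the approximate self-consistent equation. -/
def schurError (γ : Fin r → Fin N → ℝ) (A : Matrix (Fin N) (Fin N) ℝ) (z : ℂ) (i : Fin N) : ℂ :=
  (resolvent A z i i)⁻¹ + scDenom γ z (empU γ A z) i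

/-- A priori bounds on the resolvent. -/
structure APriori (γ : Fin r → Fin N → ℝ) (A : Matrix (Fin N) (Fin N) ℝ) (z : ℂ) (C : ℝ) :
    Prop where
  diag_le : ∀ i, theta γ i * ‖resolvent A z i i‖ ≤ C
  diag_ge : ∀ i, 1 ≤ C * (theta γ i * ‖resolvent A z i i‖)
  off_le : ∀ i j, i ≠ j → √(theta γ i * theta γ j) * ‖resolvent A z i j‖ ≤ C
  im_ge : ∀ k, 1 / C ≤ (empU γ A z k).im

lemma linScale_le {n : ℕ} {s : Fin n → ℝ} {b : ℝ} (hb : 0 ≤ b) {c : Fin n → ℂ} {a m : ℝ}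
    (ha : 0 ≤ a) (hm : 0 ≤ m) (h1 : ∑ k, s k * ‖c k‖ ^ 2 ≤ a ^ 2) (h2 : ∀ k, ‖c k‖ ≤ m) :
    linScale s b c ≤ a + b * m :=
  add_le_add (Real.sqrt_le_iff.mpr ⟨ha, h1⟩)
    (mul_le_mul_of_nonneg_left ((pi_norm_le_iff_of_nonneg hm).mpr h2) hb)

lemma linScale_mono {n : ℕ} {s : Fin n → ℝ} (hs : ∀ k, 0 ≤ s k) {b : ℝ} (hb : 0 ≤ b)
    {c c' : Fin n → ℂ} (h : ∀ k, ‖c k‖ ≤ ‖c' k‖) : linScale s b c ≤ linScale s b c' := by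
  refine add_le_add (Real.sqrt_le_sqrt (Finset.sum_le_sum fun k _ => ?_))
    (mul_le_mul_of_nonneg_left ((pi_norm_le_iff_of_nonneg (norm_nonneg _)).mpr fun k =>
      (h k).trans (norm_le_pi_norm c' k)) hb)
  exact mul_le_mul_of_nonneg_left (pow_le_pow_left₀ (norm_nonneg _) (h k) 2) (hs k)

variable (hγ : IsProfile q L γ)

include hγ in
lemma IsProfile.sum_variance_mul_le (i : Fin N) {f : Fin N → ℝ} (hf : ∀ k, 0 ≤ f k) :
    ∑ k, varianceProfile γ i k * f k ≤ theta γ i * (1 / (N : ℝ) * ∑ k, theta γ k * f k) := by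
  rw [Finset.mul_sum, Finset.mul_sum]
  refine Finset.sum_le_sum fun k _ => ?_
  have := mul_le_mul_of_nonneg_right (hγ.variance_le i k) (hf k)
  calc _ ≤ _ := this
    _ = _ := by ring

include hγ in
lemma empU_im_pos (hA : ∀ i j, A i j = A j i) (hz : 0 < z.im) (k : Fin r) :
    0 < (empU γ A z k).im := by
  have hN := hγ.N_pos
  have : Nonempty (Fin N) := ⟨⟨0, hγ.pos_N⟩⟩
  rw [empU, Complex.im_ofReal_mul, Complex.im_sum]
  refine mul_pos (by positivity) (Finset.sum_pos (fun i _ => ?_) Finset.univ_nonempty)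
  rw [Complex.im_ofReal_mul]
  exact mul_pos (hγ.gamma_pos k i) (resolvent_diag_im_pos hA hz i)

/-- The rank-r structure: the variance-weighted diagonal sums, one for each i, are determined by r
averages. -/
lemma sum_gamma_empU (γ : Fin r → Fin N → ℝ) (A : Matrix (Fin N) (Fin N) ℝ) (z : ℂ) (i : Fin N) :
    ∑ j, (γ j i : ℂ) * empU γ A z j =
      ∑ k, (varianceProfile γ i k : ℂ) * resolvent A z k k := by
  simp only [empU, varianceProfile, Complex.ofReal_mul, Complex.ofReal_sum, Finset.mul_sum,
    Finset.sum_mul]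
  rw [Finset.sum_comm]
  refine Finset.sum_congr rfl fun k _ => Finset.sum_congr rfl fun j _ => by ring

include hγ in
-- In Schur's formula the quadratic form splits into its off-diagonal part, its centred diagonal
-- part and ∑_k s_ik times the minor diagonal. Replacing the minor diagonal by G_kk costs G_ki G_ik
-- / G_ii, the last term.
lemma norm_schurError_le (hA : ∀ i j, A i j = A j i) (hz : 0 < z.im) {b T : ℝ}
    (hG : GoodAt γ b T A z) (i : Fin N) :
    ‖schurError γ A z i‖ ≤ b +
      T * linScale (fun k => varianceProfile γ i k * b ^ 2) (b ^ 2) (fun k => minorRes A z i k k) +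
      T * quadScale (varianceProfile γ i) b (minorRes A z i) +
      (∑ k, varianceProfile γ i k * ‖resolvent A z k i‖ ^ 2) * (1 / ‖resolvent A z i i‖) := by
  have hGi := resolvent_diag_ne_zero hA hz i
  have e1 : ∑ k, ∑ l, (rowVec A i k : ℂ) * rowVec A i l * minorRes A z i k l =
      ∑ k, ∑ l, (if k = l then 0 else (rowVec A i k : ℂ) * rowVec A i l * minorRes A z i k l) +
      ∑ k, (rowVec A i k : ℂ) * rowVec A i k * minorRes A z i k k := by
    rw [← Finset.sum_add_distrib]
    refine Finset.sum_congr rfl fun k _ => ?_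
    have : (rowVec A i k : ℂ) * rowVec A i k * minorRes A z i k k =
        ∑ l, if k = l then (rowVec A i k : ℂ) * rowVec A i l * minorRes A z i k l else 0 := by simp
    rw [this, ← Finset.sum_add_distrib]
    refine Finset.sum_congr rfl fun l _ => ?_
    split_ifs <;> simp
  -- True at k = i as well: the minor entry is 0 and the quotient is G_ii, so the removed index
  -- needs no separate error.
  have e2 : ∀ k, resolvent A z k k =
      minorRes A z i k k + resolvent A z k i * resolvent A z i k / resolvent A z i i := by
    intro k
    by_cases hk : k = i
    · subst hk; simp [hGi]
    · exact resolvent_eq_minorRes_add hA hz i hk hk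
  have e3 : schurError γ A z i = A i i -
      ∑ k, ∑ l, (if k = l then 0 else (rowVec A i k : ℂ) * rowVec A i l * minorRes A z i k l) -
      ∑ k, ((rowVec A i k ^ 2 - varianceProfile γ i k : ℝ) : ℂ) * minorRes A z i k k +
      (∑ k, (varianceProfile γ i k : ℂ) * (resolvent A z k i * resolvent A z i k)) *
        (1 / resolvent A z i i) := by
    rw [schurError, schur hA hz i, e1, scDenom, sum_gamma_empU]
    have e4 : ∑ k, (varianceProfile γ i k : ℂ) * resolvent A z k k =
        ∑ k, (rowVec A i k : ℂ) * rowVec A i k * minorRes A z i k k -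
        ∑ k, ((rowVec A i k ^ 2 - varianceProfile γ i k : ℝ) : ℂ) * minorRes A z i k k +
        (∑ k, (varianceProfile γ i k : ℂ) * (resolvent A z k i * resolvent A z i k)) *
        (1 / resolvent A z i i) := by
      rw [Finset.sum_mul, ← Finset.sum_sub_distrib, ← Finset.sum_add_distrib]
      refine Finset.sum_congr rfl fun k _ => ?_
      rw [e2 k]; push_cast; ring
    rw [e4]; ring
  rw [e3]
  refine (norm_add_le _ _).trans (add_le_add ((norm_sub_le _ _).trans ?_) ?_)
  · have h1 := hG.sq i
    have h2 := hG.quad i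
    have h3 := norm_sub_le (A i i : ℂ) (∑ k, ∑ l, (if k = l then 0 else
      (rowVec A i k : ℂ) * rowVec A i l * minorRes A z i k l))
    have h4 := hG.diag i
    rw [Complex.norm_real, Real.norm_eq_abs] at h3
    linarith
  · rw [norm_mul, norm_div, norm_one]
    refine mul_le_mul_of_nonneg_right ?_ (by positivity)
    refine (norm_sum_le _ _).trans (Finset.sum_le_sum fun k _ => ?_)
    rw [norm_mul, norm_mul, Complex.norm_real, Real.norm_eq_abs,
      abs_of_nonneg (hγ.variance_nonneg i k), resolvent_symm hA i k, sq]

include hγ in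
-- By definition the Schur error is 1/G_ii - 1/g_i, with g_i computed from `empU`.
lemma resolvent_sub_scG (hA : ∀ i j, A i j = A j i) (hz : 0 < z.im) (i : Fin N) :
    ‖resolvent A z i i - scG γ z (empU γ A z) i‖ =
      ‖schurError γ A z i‖ * ‖resolvent A z i i‖ * ‖scG γ z (empU γ A z) i‖ := by
  have h1 := resolvent_diag_ne_zero hA hz i
  have h2 := scDenom_ne_zero hγ hz (empU_im_pos hγ hA hz) i
  rw [← norm_mul, ← norm_mul, ← norm_neg]
  congr 1
  simp only [schurError, scG]
  field_simp
  ring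

lemma empU_sub_scMap (γ : Fin r → Fin N → ℝ) (A : Matrix (Fin N) (Fin N) ℝ) (z : ℂ)
    (w : Fin r → ℂ) (k : Fin r) :
    empU γ A z k - scMap γ z w k =
      ((1 / (N : ℝ) : ℝ) : ℂ) * ∑ i, (γ k i : ℂ) * (resolvent A z i i - scG γ z w i) := by
  simp only [empU, scMap, mul_sub, Finset.sum_sub_distrib]

include hγ in
lemma norm_mean_gamma_le (k : Fin r) {f : Fin N → ℂ} {B : ℝ}
    (h : ∀ i, theta γ i * ‖f i‖ ≤ B) :
    ‖((1 / (N : ℝ) : ℝ) : ℂ) * ∑ i, (γ k i : ℂ) * f i‖ ≤ B := by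
  have hN := hγ.N_pos
  rw [norm_mul, Complex.norm_real, Real.norm_eq_abs, abs_of_pos (by positivity),
    ← hγ.mean_const B]
  refine mul_le_mul_of_nonneg_left ?_ (by positivity)
  refine (norm_sum_le _ _).trans (Finset.sum_le_sum fun i _ => ?_)
  rw [norm_mul, Complex.norm_real, Real.norm_eq_abs, abs_of_pos (hγ.gamma_pos k i)]
  exact (mul_le_mul_of_nonneg_right (hγ.gamma_le_theta k i) (norm_nonneg _)).trans (h i)

include hγ in
lemma norm_mean_gamma_le' (k : Fin r) {f : Fin N → ℂ} {B : ℝ} (hB : 0 ≤ B)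
    (h : ∀ i, ‖f i‖ ≤ B * theta γ i) :
    ‖((1 / (N : ℝ) : ℝ) : ℂ) * ∑ i, (γ k i : ℂ) * f i‖ ≤ B * L := by
  have hN := hγ.N_pos
  rw [norm_mul, Complex.norm_real, Real.norm_eq_abs, abs_of_pos (by positivity)]
  refine le_trans ?_ (hγ.mean_gamma_le k hB h)
  refine mul_le_mul_of_nonneg_left ?_ (by positivity)
  refine (norm_sum_le _ _).trans (Finset.sum_le_sum fun i _ => ?_)
  rw [norm_mul, Complex.norm_real, Real.norm_eq_abs, abs_of_pos (hγ.gamma_pos k i)]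

include hγ in
/-- Comparison of the diagonal entries with the solution of the self-consistent system. -/
lemma diag_bound_of_schurError (hA : ∀ i j, A i j = A j i) (hz : 0 < z.im) {C ε : ℝ}
    (hC : 10 ≤ C) (hu : IsSCSolution γ z u) (hb : SCBounds γ z u C) (hap : APriori γ A z C)
    (hε0 : 0 ≤ ε) (hε : ∀ i, ‖schurError γ A z i‖ ≤ ε * theta γ i) (hsm : 8 * C ^ 7 * ε ≤ 1)
    (i : Fin N) :
    theta γ i * ‖resolvent A z i i - scG γ z u i‖ ≤ C ^ 11 * ε := by
  have hC0 : 0 < C := by linarith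
  have hw0 := empU_im_pos hγ hA hz
  -- The error is small only relative to θ_i; the factors G_ii and g_i, both of order at most 1/θ_i,
  -- make up for this.
  have h1 : ∀ i, theta γ i * ‖resolvent A z i i - scG γ z (empU γ A z) i‖ ≤ C ^ 2 * ε := by
    intro i
    have h2 := theta_mul_norm_scG_le hγ hC0 hz hap.im_ge i
    have h3 := hap.diag_le i
    have hθ := hγ.theta_pos i
    rw [resolvent_sub_scG hγ hA hz]
    calc theta γ i * (‖schurError γ A z i‖ * ‖resolvent A z i i‖ * ‖scG γ z (empU γ A z) i‖)
        ≤ theta γ i * ((ε * theta γ i) * ‖resolvent A z i i‖ * ‖scG γ z (empU γ A z) i‖) := by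
          gcongr; exact hε i
      _ = ε * (theta γ i * ‖resolvent A z i i‖) * (theta γ i * ‖scG γ z (empU γ A z) i‖) := by
          ring
      _ ≤ ε * C * C := by gcongr
      _ = _ := by ring
  have h2 : ∀ k, ‖empU γ A z k - scMap γ z (empU γ A z) k‖ ≤ C ^ 2 * ε := fun k => by
    rw [empU_sub_scMap]
    exact norm_mean_gamma_le hγ k h1
  have h3 : ∀ k, ‖empU γ A z k‖ ≤ C := fun k => norm_mean_gamma_le hγ k hap.diag_le
  have h4 := stability hγ (by linarith) hz hu hb hap.im_ge h3 h2
    (by calc 8 * C ^ 5 * (C ^ 2 * ε) = 8 * C ^ 7 * ε := by ring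
          _ ≤ 1 := hsm)
  have h5 : theta γ i * ‖scG γ z u i - scG γ z (empU γ A z) i‖ ≤ 8 * C ^ 10 * ε := by
    rw [scG_sub hγ hz (fun j => (hu j).1) hw0, norm_mul, norm_mul]
    have h6 : ‖∑ j, (γ j i : ℂ) * (u j - empU γ A z j)‖ ≤
        theta γ i * (8 * C ^ 6 * (C ^ 2 * ε)) := by
      rw [theta, Finset.sum_mul]
      refine (norm_sum_le _ _).trans (Finset.sum_le_sum fun j _ => ?_)
      rw [norm_mul, Complex.norm_real, Real.norm_eq_abs, abs_of_pos (hγ.gamma_pos j i)]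
      exact mul_le_mul_of_nonneg_left (h4 j) (hγ.gamma_pos j i).le
    have h7 := theta_mul_norm_scG_le hγ hC0 hz hap.im_ge i
    have h8 := theta_mul_norm_scG_le hγ hC0 hz hb.im_u i
    have hθ := hγ.theta_pos i
    calc theta γ i * (‖scG γ z u i‖ * ‖scG γ z (empU γ A z) i‖ *
          ‖∑ j, (γ j i : ℂ) * (u j - empU γ A z j)‖)
        ≤ theta γ i * (‖scG γ z u i‖ * ‖scG γ z (empU γ A z) i‖ *
          (theta γ i * (8 * C ^ 6 * (C ^ 2 * ε)))) := by gcongr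
      _ = (theta γ i * ‖scG γ z u i‖) * (theta γ i * ‖scG γ z (empU γ A z) i‖) *
          (8 * C ^ 8 * ε) := by ring
      _ ≤ C * C * (8 * C ^ 8 * ε) := by gcongr
      _ = _ := by ring
  have h6 : ‖resolvent A z i i - scG γ z u i‖ ≤
      ‖resolvent A z i i - scG γ z (empU γ A z) i‖ +
        ‖scG γ z u i - scG γ z (empU γ A z) i‖ := by
    have := norm_sub_le (resolvent A z i i - scG γ z (empU γ A z) i)
      (scG γ z u i - scG γ z (empU γ A z) i)
    simpa using this
  have hθ := hγ.theta_pos i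
  have h7 := mul_le_mul_of_nonneg_left h6 hθ.le
  have h8 := h1 i
  have h9 : C ^ 2 * ε ≤ C ^ 10 * ε :=
    mul_le_mul_of_nonneg_right (pow_le_pow_right₀ (by linarith) (by norm_num)) hε0
  have h10 : 9 * (C ^ 10 * ε) ≤ C * (C ^ 10 * ε) :=
    mul_le_mul_of_nonneg_right (by linarith) (by positivity)
  calc theta γ i * ‖resolvent A z i i - scG γ z u i‖ ≤ 9 * (C ^ 10 * ε) := by linarith
    _ ≤ C * (C ^ 10 * ε) := h10
    _ = _ := by ring

include hγ in
/-- A weighted form of the Ward identity, where large weights are treated by an a priori bound. -/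
lemma weighted_ward {C₁ lam K η : ℝ} (hK : 1 ≤ K) (hη : 0 < η) (hη10 : η ≤ 10)
    (j : Fin N) {f : Fin N → ℝ} (hf : ∀ k, 0 ≤ f k) (h1 : ∑ k, f k ^ 2 ≤ C₁ / (theta γ j * η))
    (h2 : ∀ k, k ≠ j → √(theta γ k * theta γ j) * f k ≤ lam) (h3 : theta γ j * f j ≤ C₁) :
    1 / (N : ℝ) * ∑ k, theta γ k * f k ^ 2 ≤
      1 / theta γ j * ((C₁ + 10 * C₁ ^ 2) * (K / (N * η)) + L * lam ^ 2 / K ^ 2) := by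
  have hN := hγ.N_pos
  have hθj := hγ.theta_pos j
  have hK0 : 0 < K := by linarith
  -- Three cases: θ_k ≤ K goes to the unweighted sum; for θ_k > K the factor (θ_k/K)² ≥ 1 is
  -- inserted, so that the second moment of θ pays; k = j uses the diagonal bound.
  have hpt : ∀ k, theta γ k * f k ^ 2 ≤ K * f k ^ 2 + theta γ k ^ 2 * (lam ^ 2 / theta γ j / K ^ 2) +
      if k = j then C₁ ^ 2 / theta γ j else 0 := by
    intro k
    have hθk := hγ.theta_pos k
    split_ifs with hk
    · subst hk
      have : theta γ k * f k ^ 2 ≤ C₁ ^ 2 / theta γ k := by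
        rw [le_div_iff₀ hθk]
        calc theta γ k * f k ^ 2 * theta γ k = (theta γ k * f k) ^ 2 := by ring
          _ ≤ C₁ ^ 2 := pow_le_pow_left₀ (mul_nonneg hθk.le (hf k)) h3 2
      have h5 : 0 ≤ K * f k ^ 2 := by positivity
      have h6 : 0 ≤ theta γ k ^ 2 * (lam ^ 2 / theta γ k / K ^ 2) := by positivity
      linarith
    · rw [add_zero]
      by_cases hkK : theta γ k ≤ K
      · have h5 : theta γ k * f k ^ 2 ≤ K * f k ^ 2 :=
          mul_le_mul_of_nonneg_right hkK (sq_nonneg _)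
        have h6 : 0 ≤ theta γ k ^ 2 * (lam ^ 2 / theta γ j / K ^ 2) := by positivity
        linarith
      · push Not at hkK
        have h5 := pow_le_pow_left₀ (mul_nonneg (Real.sqrt_nonneg _) (hf k)) (h2 k hk) 2
        rw [mul_pow, Real.sq_sqrt (by positivity)] at h5
        have h6 : theta γ k * f k ^ 2 ≤ lam ^ 2 / theta γ j := by
          rw [le_div_iff₀ hθj]; linarith
        have h7 : lam ^ 2 / theta γ j ≤ theta γ k ^ 2 * (lam ^ 2 / theta γ j / K ^ 2) := by
          rw [← mul_div_assoc, le_div_iff₀ (by positivity), mul_comm]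
          exact mul_le_mul_of_nonneg_right (pow_le_pow_left₀ hK0.le hkK.le 2) (by positivity)
        have h8 : 0 ≤ K * f k ^ 2 := by positivity
        linarith
  refine (hγ.mean_mono hpt).trans ?_
  rw [Finset.sum_add_distrib, Finset.sum_add_distrib, ← Finset.mul_sum, ← Finset.sum_mul]
  simp only [Finset.sum_ite_eq', Finset.mem_univ, if_true]
  have a1 : 1 / (N : ℝ) * (K * ∑ k, f k ^ 2) ≤ 1 / theta γ j * (C₁ * (K / (N * η))) := by
    calc 1 / (N : ℝ) * (K * ∑ k, f k ^ 2) ≤ 1 / (N : ℝ) * (K * (C₁ / (theta γ j * η))) := by gcongr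
      _ = _ := by field_simp
  have a2 : 1 / (N : ℝ) * ((∑ k, theta γ k ^ 2) * (lam ^ 2 / theta γ j / K ^ 2)) ≤
      1 / theta γ j * (L * lam ^ 2 / K ^ 2) := by
    calc 1 / (N : ℝ) * ((∑ k, theta γ k ^ 2) * (lam ^ 2 / theta γ j / K ^ 2)) =
        (1 / (N : ℝ) * ∑ k, theta γ k ^ 2) * (lam ^ 2 / theta γ j / K ^ 2) := by ring
      _ ≤ L * (lam ^ 2 / theta γ j / K ^ 2) :=
          mul_le_mul_of_nonneg_right hγ.sum_theta_sq (by positivity)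
      _ = _ := by ring
  have a3 : 1 / (N : ℝ) * (C₁ ^ 2 / theta γ j) ≤ 1 / theta γ j * (10 * C₁ ^ 2 * (K / (N * η))) := by
    have : 1 / (N : ℝ) ≤ 10 * (K / (N * η)) := by
      rw [← mul_div_assoc, div_le_div_iff₀ hN (by positivity)]
      nlinarith [mul_le_mul_of_nonneg_left hK hN.le, mul_le_mul_of_nonneg_left hη10 hN.le]
    calc 1 / (N : ℝ) * (C₁ ^ 2 / theta γ j) ≤ 10 * (K / (N * η)) * (C₁ ^ 2 / theta γ j) :=
          mul_le_mul_of_nonneg_right this (by positivity)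
      _ = _ := by ring
  rw [mul_add, mul_add] at *
  have e : 1 / theta γ j * ((C₁ + 10 * C₁ ^ 2) * (K / (N * η))) =
    1 / theta γ j * (C₁ * (K / (N * η))) + 1 / theta γ j * (10 * C₁ ^ 2 * (K / (N * η))) := by ring
  linarith

include hγ in
-- The two numerators together carry the weight θ_i, exactly what the bound θ_i |G_ii| ≥ 1/C
-- consumes.
lemma off_weight_le {C lam : ℝ} {i k j : Fin N}
    (h1 : √(theta γ k * theta γ i) * ‖resolvent A z k i‖ ≤ lam)
    (h2 : √(theta γ i * theta γ j) * ‖resolvent A z i j‖ ≤ lam)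
    (h3 : 1 ≤ C * (theta γ i * ‖resolvent A z i i‖)) :
    √(theta γ k * theta γ j) *
      ‖resolvent A z k i * resolvent A z i j / resolvent A z i i‖ ≤ C * lam ^ 2 := by
  have hi := hγ.theta_pos i
  have hk := hγ.theta_pos k
  have hj := hγ.theta_pos j
  have hlam : 0 ≤ lam := (by positivity : (0 : ℝ) ≤ _).trans h1
  have hG : 0 < ‖resolvent A z i i‖ := by
    by_contra hc
    have : ‖resolvent A z i i‖ = 0 := le_antisymm (not_lt.mp hc) (norm_nonneg _)
    rw [this] at h3; norm_num at h3
  have h4 := mul_le_mul h1 h2 (by positivity) hlam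
  rw [Real.sqrt_mul hk.le, Real.sqrt_mul hi.le] at h4
  rw [norm_div, norm_mul, Real.sqrt_mul hk.le]
  have hsi := Real.mul_self_sqrt hi.le
  have e : √(theta γ k) * √(theta γ i) * ‖resolvent A z k i‖ *
      (√(theta γ i) * √(theta γ j) * ‖resolvent A z i j‖) =
      theta γ i * (√(theta γ k) * √(theta γ j) *
        (‖resolvent A z k i‖ * ‖resolvent A z i j‖)) := by
    calc _ = (√(theta γ i) * √(theta γ i)) * (√(theta γ k) * √(theta γ j) *
        (‖resolvent A z k i‖ * ‖resolvent A z i j‖)) := by ring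
      _ = _ := by rw [hsi]
  rw [e] at h4
  set Y := √(theta γ k) * √(theta γ j) * (‖resolvent A z k i‖ * ‖resolvent A z i j‖) with hY
  have hY0 : 0 ≤ Y := by positivity
  rw [← mul_div_assoc, div_le_iff₀ hG]
  have h5 : Y * 1 ≤ Y * (C * (theta γ i * ‖resolvent A z i i‖)) :=
    mul_le_mul_of_nonneg_left h3 hY0
  have hC : 0 ≤ C := by
    by_contra hc
    push Not at hc
    have := mul_pos hi hG
    nlinarith
  have h6 := mul_le_mul_of_nonneg_left h4 (mul_nonneg hC hG.le)
  nlinarith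

/-- The bounds on the resolvent of a minor that follow from the a priori bounds. -/
structure MinorBounds (γ : Fin r → Fin N → ℝ) (A : Matrix (Fin N) (Fin N) ℝ) (z : ℂ)
    (C ρ : ℝ) (i : Fin N) : Prop where
  diag : ∀ k, theta γ k * ‖minorRes A z i k k‖ ≤ 2 * C ^ 3
  sup : ∀ k j, √(theta γ j) * ‖minorRes A z i k j‖ ≤ 2 * C ^ 3
  ward : ∀ j, 1 / (N : ℝ) * ∑ k, theta γ k * ‖minorRes A z i k j‖ ^ 2 ≤
    C ^ 8 * ρ ^ 2 / theta γ j

lemma sum_normSq_minorRes_le (hA : ∀ i j, A i j = A j i) (hz : 0 < z.im) (i j : Fin N) :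
    ∑ k, ‖minorRes A z i k j‖ ^ 2 ≤ ‖minorRes A z i j j‖ / z.im := by
  by_cases hj : j = i
  · subst hj; simp
  · have h1 := sum_normSq_resolvent_le (minor_symm hA i) hz j
    have e : minorRes A z i j j = resolvent (minor A i) z j j := by simp [minorRes, hj]
    rw [e]
    refine le_trans (Finset.sum_le_sum fun k _ => ?_) h1
    simp only [minorRes]
    split_ifs
    · rw [norm_zero, zero_pow two_ne_zero]; positivity
    · exact le_rfl

include hγ in
-- Rounds the constants of `weighted_ward` up to C⁸, so that one bound serves the full resolvent (c₁
-- = C, lam₁ = lam) and the minors (c₁ = 2C³, lam₁ = 2C² lam).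
lemma weighted_ward_of_bounds {C lam K η c₁ lam₁ : ℝ} (hC : 10 ≤ C) (hL : L ≤ C) (hK : 1 ≤ K)
    (hη : 0 < η) (hη10 : η ≤ 10) (hc₁ : 0 ≤ c₁) (hc₁C : c₁ ≤ 2 * C ^ 3)
    (hlam₁ : 0 ≤ lam₁) (hlam₁C : lam₁ ≤ 2 * C ^ 2 * lam)
    (j : Fin N) {f : Fin N → ℝ} (hf : ∀ k, 0 ≤ f k) (h1 : ∑ k, f k ^ 2 ≤ c₁ / (theta γ j * η))
    (h2 : ∀ k, k ≠ j → √(theta γ k * theta γ j) * f k ≤ lam₁) (h3 : theta γ j * f j ≤ c₁) :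
    1 / (N : ℝ) * ∑ k, theta γ k * f k ^ 2 ≤
      C ^ 8 * (K / (N * η) + lam ^ 2 / K ^ 2) / theta γ j := by
  have hN := hγ.N_pos
  have hC0 : 0 < C := by linarith
  refine (weighted_ward hγ hK hη hη10 j hf h1 h2 h3).trans ?_
  rw [div_eq_mul_one_div (C ^ 8 * _), mul_comm (C ^ 8 * _)]
  refine mul_le_mul_of_nonneg_left ?_ (by have := hγ.theta_pos j; positivity)
  rw [mul_add]
  have hC1 : (1 : ℝ) ≤ C := by linarith
  have hC2 : 100 ≤ C ^ 2 := by nlinarith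
  refine add_le_add (mul_le_mul_of_nonneg_right ?_ (by positivity)) ?_
  · have a1 : c₁ ^ 2 ≤ (2 * C ^ 3) ^ 2 := pow_le_pow_left₀ hc₁ hc₁C 2
    have a2 : C ^ 3 ≤ C ^ 6 := pow_le_pow_right₀ hC1 (by norm_num)
    have a3 : 100 * C ^ 6 ≤ C ^ 2 * C ^ 6 := mul_le_mul_of_nonneg_right hC2 (by positivity)
    nlinarith
  · have a1 : lam₁ ^ 2 ≤ (2 * C ^ 2 * lam) ^ 2 := pow_le_pow_left₀ hlam₁ hlam₁C 2
    rw [← mul_div_assoc]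
    refine div_le_div_of_nonneg_right ?_ (by positivity)
    have a2 : L * lam₁ ^ 2 ≤ C * (2 * C ^ 2 * lam) ^ 2 :=
      (mul_le_mul_of_nonneg_right hL (sq_nonneg _)).trans (mul_le_mul_of_nonneg_left a1 hC0.le)
    have a3 : 4 * (C ^ 5 * lam ^ 2) ≤ C ^ 3 * (C ^ 5 * lam ^ 2) := by
      refine mul_le_mul_of_nonneg_right ?_ (by positivity)
      nlinarith
    nlinarith

include hγ in
-- The minor differs from G by G_ki G_ij / G_ii, which by `off_weight_le` is at most C lam² after
-- weighting. Since lam ≤ C, this only enlarges constants.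
lemma minorBounds_of_aPriori (hA : ∀ i j, A i j = A j i) (hz : 0 < z.im) (hz10 : z.im ≤ 10)
    {C lam K : ℝ} (hC : 10 ≤ C) (hL : L ≤ C) (hK : 1 ≤ K) (hap : APriori γ A z C)
    (hlam0 : 0 ≤ lam) (hlamC : lam ≤ C)
    (hlam : ∀ i j, i ≠ j → √(theta γ i * theta γ j) * ‖resolvent A z i j‖ ≤ lam)
    (i : Fin N) : MinorBounds γ A z C (√(K / (N * z.im) + lam ^ 2 / K ^ 2)) i := by
  have hN := hγ.N_pos
  have hC0 : 0 < C := by linarith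
  have hoff : ∀ k j, k ≠ j → √(theta γ k * theta γ j) * ‖minorRes A z i k j‖ ≤
      2 * C ^ 2 * lam := by
    intro k j hkj
    by_cases hk : k = i
    · subst hk; rw [minorRes_left, norm_zero, mul_zero]; positivity
    by_cases hj : j = i
    · subst hj; rw [minorRes_right, norm_zero, mul_zero]; positivity
    have h1 := off_weight_le hγ (hlam k i hk) (hlam i j (Ne.symm hj)) (hap.diag_ge i)
    have e := resolvent_eq_minorRes_add hA hz i hk hj
    have e' : minorRes A z i k j = resolvent A z k j -
        resolvent A z k i * resolvent A z i j / resolvent A z i i := by rw [e]; ring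
    rw [e']
    have h2 := mul_le_mul_of_nonneg_left (norm_sub_le (resolvent A z k j)
      (resolvent A z k i * resolvent A z i j / resolvent A z i i))
      (Real.sqrt_nonneg (theta γ k * theta γ j))
    have h3 := hlam k j hkj
    have h4 : C * lam ^ 2 ≤ C ^ 2 * lam := by nlinarith [mul_nonneg hC0.le hlam0]
    have h5 : lam ≤ C ^ 2 * lam := le_mul_of_one_le_left hlam0 (by nlinarith)
    linarith
  have hdiag : ∀ k, theta γ k * ‖minorRes A z i k k‖ ≤ 2 * C ^ 3 := by
    intro k
    by_cases hk : k = i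
    · subst hk; rw [minorRes_left, norm_zero, mul_zero]; positivity
    have h1 := off_weight_le hγ (hlam k i hk) (hlam i k (Ne.symm hk)) (hap.diag_ge i)
    rw [Real.sqrt_mul_self (hγ.theta_pos k).le] at h1
    have e := resolvent_eq_minorRes_add hA hz i hk hk
    have e' : minorRes A z i k k = resolvent A z k k -
        resolvent A z k i * resolvent A z i k / resolvent A z i i := by rw [e]; ring
    rw [e']
    have h2 := mul_le_mul_of_nonneg_left (norm_sub_le (resolvent A z k k)
      (resolvent A z k i * resolvent A z i k / resolvent A z i i)) (hγ.theta_pos k).le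
    have h3 := hap.diag_le k
    have h4 : C * lam ^ 2 ≤ C * C ^ 2 :=
      mul_le_mul_of_nonneg_left (pow_le_pow_left₀ hlam0 hlamC 2) hC0.le
    have h5 : C ≤ C * C ^ 2 := le_mul_of_one_le_right hC0.le (by nlinarith)
    nlinarith
  refine ⟨hdiag, fun k j => ?_, fun j => ?_⟩
  · by_cases hkj : k = j
    · subst hkj
      refine le_trans ?_ (hdiag k)
      refine mul_le_mul_of_nonneg_right ?_ (norm_nonneg _)
      exact Real.sqrt_le_iff.mpr ⟨(hγ.theta_pos k).le, by have := hγ.one_le_theta k; nlinarith⟩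
    · have h1 := hoff k j hkj
      have h2 : 2 * C ^ 2 * lam ≤ 2 * C ^ 3 := by
        calc 2 * C ^ 2 * lam ≤ 2 * C ^ 2 * C := by gcongr
          _ = _ := by ring
      refine le_trans (mul_le_mul_of_nonneg_right (Real.sqrt_le_sqrt ?_) (norm_nonneg _))
        (h1.trans h2)
      exact le_mul_of_one_le_left (hγ.theta_pos j).le (hγ.one_le_theta k)
  · rw [Real.sq_sqrt (by positivity)]
    refine weighted_ward_of_bounds hγ hC hL hK hz hz10 (by positivity) le_rfl (by positivity)
      le_rfl j (fun k => norm_nonneg _) ?_ (fun k hk => hoff k j hk) (hdiag j)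
    refine (sum_normSq_minorRes_le hA hz i j).trans ?_
    have h1 := hdiag j
    have hθ := hγ.theta_pos j
    rw [div_le_div_iff₀ hz (by positivity)]
    nlinarith

include hγ in
-- The variance part is the weighted Ward bound times θ_i; the supremum part is O(1/√θ_j), and √θ_i
-- ≥ 1 brings it to the same form.
lemma linScale_minorRes_le {C ρ b : ℝ} (hC : 10 ≤ C) (hρ : 0 ≤ ρ) (hb : 0 ≤ b)
    {i : Fin N} (h : MinorBounds γ A z C ρ i) (j : Fin N) :
    linScale (varianceProfile γ i) b (fun k => minorRes A z i k j) ≤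
      C ^ 4 * (√(theta γ i) / √(theta γ j)) * (ρ + b) := by
  have hC0 : 0 < C := by linarith
  have hi := hγ.theta_pos i
  have hj := hγ.theta_pos j
  have hsj := Real.sqrt_pos.mpr hj
  have hsi : 1 ≤ √(theta γ i) := Real.one_le_sqrt.mpr (hγ.one_le_theta i)
  refine (linScale_le hb (a := C ^ 4 * (√(theta γ i) / √(theta γ j)) * ρ)
    (m := C ^ 4 * (√(theta γ i) / √(theta γ j))) (by positivity) (by positivity) ?_ ?_).trans
    (le_of_eq (by ring))
  · refine (hγ.sum_variance_mul_le i fun k => by positivity).trans ?_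
    refine (mul_le_mul_of_nonneg_left (h.ward j) hi.le).trans (le_of_eq ?_)
    rw [mul_pow, mul_pow, div_pow, Real.sq_sqrt hi.le, Real.sq_sqrt hj.le]
    ring
  · intro k
    have h1 := h.sup k j
    have h2 : 2 * C ^ 3 ≤ C ^ 4 := by nlinarith [pow_pos hC0 3]
    rw [← mul_div_assoc, le_div_iff₀ hsj, mul_comm]
    refine (h1.trans h2).trans ?_
    exact le_mul_of_one_le_right (by positivity) hsi

include hγ in
/-- The error in the approximate self-consistent equation under the a priori bounds. -/
lemma schurError_le_of_minorBounds (hA : ∀ i j, A i j = A j i) (hz : 0 < z.im)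
    {C ρ b T : ℝ} (hC : 10 ≤ C) (hρ : 0 ≤ ρ) (hρ1 : ρ ≤ 1) (hb : 0 ≤ b) (hb1 : b ≤ 1)
    (hT : 1 ≤ T) (hG : GoodAt γ b T A z) {i : Fin N} (h : MinorBounds γ A z C ρ i)
    (hd : 1 ≤ C * (theta γ i * ‖resolvent A z i i‖))
    (hward : 1 / (N : ℝ) * ∑ k, theta γ k * ‖resolvent A z k i‖ ^ 2 ≤ C ^ 8 * ρ ^ 2 / theta γ i) :
    ‖schurError γ A z i‖ ≤ T * C ^ 10 * (ρ + b) * theta γ i := by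
  have hN := hγ.N_pos
  have hC0 : 0 < C := by linarith
  have hi := hγ.theta_pos i
  have hi1 := hγ.one_le_theta i
  have hsi1 : 1 ≤ √(theta γ i) := Real.one_le_sqrt.mpr hi1
  have hsi : √(theta γ i) ≤ theta γ i :=
    Real.sqrt_le_iff.mpr ⟨hi.le, by nlinarith⟩
  have h1 : linScale (fun k => varianceProfile γ i k * b ^ 2) (b ^ 2)
      (fun k => minorRes A z i k k) ≤ 4 * C ^ 3 * b * theta γ i := by
    refine (linScale_le (by positivity) (a := 2 * C ^ 3 * b * theta γ i) (m := 2 * C ^ 3)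
      (by positivity) (by positivity) ?_ ?_).trans ?_
    · have e : ∀ k, varianceProfile γ i k * b ^ 2 * ‖minorRes A z i k k‖ ^ 2 =
          varianceProfile γ i k * (b ^ 2 * ‖minorRes A z i k k‖ ^ 2) := fun k => by ring
      simp only [e]
      refine (hγ.sum_variance_mul_le i fun k => by positivity).trans ?_
      have h2 : 1 / (N : ℝ) * ∑ k, theta γ k * (b ^ 2 * ‖minorRes A z i k k‖ ^ 2) ≤
          b ^ 2 * (2 * C ^ 3) ^ 2 := by
        rw [← hγ.mean_const (b ^ 2 * (2 * C ^ 3) ^ 2)]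
        refine hγ.mean_mono fun k => ?_
        have h3 := pow_le_pow_left₀ (mul_nonneg (hγ.theta_pos k).le (norm_nonneg _)) (h.diag k) 2
        have h4 := hγ.one_le_theta k
        have h5 : theta γ k * ‖minorRes A z i k k‖ ^ 2 ≤ (2 * C ^ 3) ^ 2 := by
          refine le_trans ?_ h3
          rw [mul_pow]
          exact mul_le_mul_of_nonneg_right (by nlinarith) (sq_nonneg _)
        nlinarith [sq_nonneg b]
      refine (mul_le_mul_of_nonneg_left h2 hi.le).trans ?_
      have h3 : theta γ i ≤ theta γ i ^ 2 := by nlinarith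
      have h4 := mul_le_mul_of_nonneg_right h3 (by positivity : 0 ≤ b ^ 2 * (2 * C ^ 3) ^ 2)
      linarith
    · intro k
      have h2 := h.diag k
      have h3 := hγ.one_le_theta k
      nlinarith [norm_nonneg (minorRes A z i k k)]
    · have h2 : b ^ 2 ≤ b * theta γ i := by nlinarith
      nlinarith [pow_pos hC0 3]
  have h2 : quadScale (varianceProfile γ i) b (minorRes A z i) ≤
      2 * C ^ 4 * (ρ + b) * theta γ i := by
    -- The factor 1/√θ_k cancels the weight θ_k coming from s_ik in the outer sum, so no higher
    -- moment of θ is needed.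
    have hrow : ∀ k, ‖rowScale (varianceProfile γ i) b (minorRes A z i) k‖ ≤
        C ^ 4 * (√(theta γ i) / √(theta γ k)) * (ρ + b) := by
      intro k
      rw [rowScale, Complex.norm_real, Real.norm_eq_abs, abs_of_nonneg (linScale_nonneg hb _)]
      refine (linScale_mono (hγ.variance_nonneg i) hb fun l => ?_).trans
        (linScale_minorRes_le hγ hC hρ hb h k)
      split_ifs
      · rw [norm_zero]; exact norm_nonneg _
      · rw [minorRes_symm hA]
    refine (linScale_le hb (a := C ^ 4 * (ρ + b) * theta γ i) (m := C ^ 4 * (ρ + b) * theta γ i)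
      (by positivity) (by positivity) ?_ fun k => (hrow k).trans ?_).trans ?_
    · refine (hγ.sum_variance_mul_le i fun k => by positivity).trans ?_
      have h3 : 1 / (N : ℝ) * ∑ k, theta γ k *
          ‖rowScale (varianceProfile γ i) b (minorRes A z i) k‖ ^ 2 ≤
          (C ^ 4 * (ρ + b)) ^ 2 * theta γ i := by
        rw [← hγ.mean_const ((C ^ 4 * (ρ + b)) ^ 2 * theta γ i)]
        refine hγ.mean_mono fun k => ?_
        have hk := hγ.theta_pos k
        have h4 := mul_le_mul_of_nonneg_left
          (pow_le_pow_left₀ (norm_nonneg _) (hrow k) 2) hk.le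
        refine h4.trans (le_of_eq ?_)
        rw [mul_pow, mul_pow, div_pow, Real.sq_sqrt hi.le, Real.sq_sqrt hk.le]
        field_simp
      calc _ ≤ theta γ i * ((C ^ 4 * (ρ + b)) ^ 2 * theta γ i) :=
            mul_le_mul_of_nonneg_left h3 hi.le
        _ = _ := by ring
    · have hk : 1 ≤ √(theta γ k) := Real.one_le_sqrt.mpr (hγ.one_le_theta k)
      have h3 : √(theta γ i) / √(theta γ k) ≤ theta γ i :=
        (div_le_self (Real.sqrt_nonneg _) hk).trans hsi
      calc _ ≤ C ^ 4 * theta γ i * (ρ + b) := by gcongr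
        _ = _ := by ring
    · have h3 : 0 ≤ C ^ 4 * (ρ + b) * theta γ i := by positivity
      nlinarith
  have h3 : (∑ k, varianceProfile γ i k * ‖resolvent A z k i‖ ^ 2) * (1 / ‖resolvent A z i i‖) ≤
      C ^ 9 * ρ * theta γ i := by
    have h4 : ∑ k, varianceProfile γ i k * ‖resolvent A z k i‖ ^ 2 ≤ C ^ 8 * ρ ^ 2 := by
      refine (hγ.sum_variance_mul_le i fun k => by positivity).trans ?_
      refine (mul_le_mul_of_nonneg_left hward hi.le).trans (le_of_eq ?_)
      field_simp
    have hG0 : 0 < ‖resolvent A z i i‖ := norm_pos_iff.mpr (resolvent_diag_ne_zero hA hz i)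
    have h5 : 1 / ‖resolvent A z i i‖ ≤ C * theta γ i := by
      rw [div_le_iff₀ hG0]; linarith
    calc _ ≤ (C ^ 8 * ρ ^ 2) * (C * theta γ i) :=
          mul_le_mul h4 h5 (by positivity) (by positivity)
      _ = C ^ 9 * theta γ i * ρ ^ 2 := by ring
      _ ≤ C ^ 9 * theta γ i * ρ := by
          refine mul_le_mul_of_nonneg_left ?_ (by positivity)
          nlinarith
      _ = _ := by ring
  refine (norm_schurError_le hγ hA hz hG i).trans ?_
  have hT0 : 0 ≤ T := by linarith
  have h1' := mul_le_mul_of_nonneg_left h1 hT0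
  have h2' := mul_le_mul_of_nonneg_left h2 hT0
  set x := T * (ρ + b) * theta γ i with hx
  have hx0 : 0 ≤ x := by positivity
  have c1 : b * 1 ≤ x := by
    have : b * 1 ≤ (ρ + b) * theta γ i := mul_le_mul (by linarith) hi1 (by norm_num) (by positivity)
    have h6 : (ρ + b) * theta γ i ≤ T * ((ρ + b) * theta γ i) :=
      le_mul_of_one_le_left (by positivity) hT
    rw [hx, mul_assoc]; linarith
  have c2 : T * (4 * C ^ 3 * b * theta γ i) ≤ 4 * C ^ 3 * x := by
    have : T * b * theta γ i ≤ x := by rw [hx]; gcongr; linarith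
    nlinarith [pow_pos hC0 3]
  have c3 : T * (2 * C ^ 4 * (ρ + b) * theta γ i) = 2 * C ^ 4 * x := by rw [hx]; ring
  have c4 : C ^ 9 * ρ * theta γ i ≤ C ^ 9 * x := by
    have : 1 * ρ * theta γ i ≤ x := by rw [hx]; gcongr; linarith
    nlinarith [pow_pos hC0 9]
  have hC1 : (1 : ℝ) ≤ C := by linarith
  have p0 : 1 ≤ C ^ 9 := one_le_pow₀ hC1
  have p1 : C ^ 3 ≤ C ^ 9 := pow_le_pow_right₀ hC1 (by norm_num)
  have p2 : C ^ 4 ≤ C ^ 9 := pow_le_pow_right₀ hC1 (by norm_num)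
  have p3 : 10 * C ^ 9 ≤ C ^ 10 := by
    calc 10 * C ^ 9 ≤ C * C ^ 9 := mul_le_mul_of_nonneg_right hC (by positivity)
      _ = _ := by ring
  have hfin : (1 + 4 * C ^ 3 + 2 * C ^ 4 + C ^ 9) * x ≤ C ^ 10 * x :=
    mul_le_mul_of_nonneg_right (by linarith) hx0
  have e : T * C ^ 10 * (ρ + b) * theta γ i = C ^ 10 * x := by rw [hx]; ring
  rw [e]
  linarith

end Deterministic

/-! ### Self-improving bounds and the initial estimate -/

section Bootstrap

variable {N r : ℕ} {q L : ℝ} {γ : Fin r → Fin N → ℝ} {z : ℂ} {u : Fin r → ℂ}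
  {A : Matrix (Fin N) (Fin N) ℝ} (hγ : IsProfile q L γ)

lemma norm_offdiag_le (hA : ∀ i j, A i j = A j i) (hz : 0 < z.im) {b T : ℝ}
    (hG : GoodAt γ b T A z) {i k : Fin N} (hk : k ≠ i) :
    ‖resolvent A z k i‖ ≤
      T * linScale (varianceProfile γ i) b (fun l => minorRes A z i l k) *
        ‖resolvent A z i i‖ := by
  rw [resolvent_offdiag hA hz i hk, norm_mul, norm_neg]
  refine mul_le_mul_of_nonneg_right (le_of_eq_of_le ?_ (hG.lin i k)) (norm_nonneg _)
  congr 1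
  refine Finset.sum_congr rfl fun l _ => ?_
  rw [minorRes_symm hA i k l, mul_comm]

lemma le_lambdaO (i j : Fin N) (hij : i ≠ j) :
    √(theta γ i * theta γ j) * ‖resolvent A z i j‖ ≤ LambdaO γ z A :=
  le_ciSup (f := fun p : {p : Fin N × Fin N // p.1 ≠ p.2} =>
    √(theta γ p.1.1 * theta γ p.1.2) * ‖resolvent A z p.1.1 p.1.2‖)
    (Set.finite_range _).bddAbove ⟨(i, j), hij⟩

lemma lambdaO_nonneg : 0 ≤ LambdaO γ z A :=
  Real.iSup_nonneg fun _ => by positivity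

lemma lambdaO_le {B : ℝ} (hB : 0 ≤ B)
    (h : ∀ i j, i ≠ j → √(theta γ i * theta γ j) * ‖resolvent A z i j‖ ≤ B) :
    LambdaO γ z A ≤ B :=
  Real.iSup_le (fun p => h _ _ p.2) hB

include hγ in
set_option maxHeartbeats 400000 in
/-- Under a priori bounds, the large deviation bounds imply the optimal bounds. -/
lemma bootstrap_step (hA : ∀ i j, A i j = A j i) (hz : 0 < z.im) (hz10 : z.im ≤ 10)
    {C T b Φ : ℝ} (hC : 10 ≤ C) (hL : L ≤ C) (hT : 1 ≤ T) (hb : 0 ≤ b) (hb1 : b ≤ 1)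
    (hΦ : Φ = b + 1 / √(N * z.im))
    (hu : IsSCSolution γ z u) (hsc : SCBounds γ z u C) (hap : APriori γ A z C)
    (hG : GoodAt γ b T A z) (hsm : T ^ 2 * C ^ 24 * Φ ≤ 1) :
    (∀ i, theta γ i * ‖resolvent A z i i - scG γ z u i‖ ≤ T ^ 2 * C ^ 30 * Φ) ∧
    (∀ i j, i ≠ j → √(theta γ i * theta γ j) * ‖resolvent A z i j‖ ≤ T ^ 2 * C ^ 30 * Φ) := by
  have hN := hγ.N_pos
  have hC0 : 0 < C := by linarith
  have hC1 : 1 ≤ C := by linarith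
  have hT0 : 0 < T := by linarith
  set lam := LambdaO γ z A with hlam
  have hlam0 : 0 ≤ lam := lambdaO_nonneg
  have hlamC : lam ≤ C := lambdaO_le hC0.le hap.off_le
  -- Chosen so that T C⁵ · (lam / K) = lam / 2: the contribution of the large weights to `hoff` is
  -- absorbed in lam.
  set K := 2 * T * C ^ 5 with hK
  have hC5 : 1 ≤ C ^ 5 := one_le_pow₀ hC1
  have hTC : 1 ≤ T * C ^ 5 := one_le_mul_of_one_le_of_one_le hT hC5
  have hK1 : 1 ≤ K := by rw [hK, mul_assoc]; linarith
  have hK0 : 0 < K := by linarith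
  set p := 1 / √(N * z.im) with hp
  have hp0 : 0 ≤ p := by positivity
  have hΦ0 : 0 ≤ Φ := by rw [hΦ]; positivity
  set ρ := √(K / (N * z.im) + lam ^ 2 / K ^ 2) with hρ
  have hρ0 : 0 ≤ ρ := Real.sqrt_nonneg _
  have hρle : ρ ≤ K * p + lam / K := by
    refine Real.sqrt_le_iff.mpr ⟨by positivity, ?_⟩
    have h1 : K / (N * z.im) ≤ (K * p) ^ 2 := by
      rw [hp, mul_pow, div_pow, Real.sq_sqrt (by positivity), one_pow, mul_one_div]
      refine div_le_div_of_nonneg_right ?_ (by positivity)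
      nlinarith
    have h2 : lam ^ 2 / K ^ 2 = (lam / K) ^ 2 := by rw [div_pow]
    have h3 : 0 ≤ (K * p) * (lam / K) := by positivity
    nlinarith
  have hmin := minorBounds_of_aPriori hγ hA hz hz10 hC hL hK1 hap hlam0 hlamC le_lambdaO
  have hoff : lam ≤ T * C ^ 5 * (ρ + b) := by
    refine lambdaO_le (by positivity) fun k i hki => ?_
    have h1 := norm_offdiag_le hA hz hG hki
    have h2 := linScale_minorRes_le hγ hC hρ0 hb (hmin i) k
    have hi := hγ.theta_pos i
    have hk := hγ.theta_pos k
    have hsk := Real.sqrt_pos.mpr hk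
    calc √(theta γ k * theta γ i) * ‖resolvent A z k i‖
        ≤ √(theta γ k * theta γ i) *
          (T * (C ^ 4 * (√(theta γ i) / √(theta γ k)) * (ρ + b)) * ‖resolvent A z i i‖) := by
          refine mul_le_mul_of_nonneg_left (h1.trans ?_) (Real.sqrt_nonneg _)
          gcongr
      _ = T * C ^ 4 * (ρ + b) * ((√(theta γ i) * √(theta γ i)) * ‖resolvent A z i i‖) := by
          rw [Real.sqrt_mul hk.le]
          field_simp
      _ ≤ T * C ^ 4 * (ρ + b) * C := by
          rw [Real.mul_self_sqrt hi.le]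
          exact mul_le_mul_of_nonneg_left (hap.diag_le i) (by positivity)
      _ = _ := by ring
  have hlamK : lam ≤ K ^ 2 * Φ := by
    have h1 : lam ≤ K / 2 * (K * p + lam / K + b) := by
      have e : K / 2 = T * C ^ 5 := by rw [hK]; ring
      rw [e]
      refine hoff.trans (mul_le_mul_of_nonneg_left (by linarith) (by positivity))
    have h2 : K / 2 * (K * p + lam / K + b) = K ^ 2 * p / 2 + lam / 2 + K * b / 2 := by
      field_simp
    have h3 : K * b ≤ K ^ 2 * b := mul_le_mul_of_nonneg_right (by nlinarith) hb
    rw [hΦ]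
    nlinarith
  have hρΦ : ρ ≤ 2 * K * Φ := by
    have h1 : lam / K ≤ K * Φ := by rw [div_le_iff₀ hK0]; nlinarith
    have h2 : K * p ≤ K * Φ := mul_le_mul_of_nonneg_left (by rw [hΦ]; linarith) hK0.le
    linarith
  have hbΦ : b ≤ K * Φ := by
    have h1 : b ≤ Φ := by rw [hΦ]; linarith
    nlinarith
  have hpow : ∀ {m n : ℕ} {a : ℝ}, m ≤ n → 0 ≤ a → C ^ m * a ≤ C ^ n * a := fun h ha =>
    mul_le_mul_of_nonneg_right (pow_le_pow_right₀ hC1 h) ha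
  have hTT : T ≤ T ^ 2 := by nlinarith
  have hC2 : 100 ≤ C ^ 2 := by nlinarith
  have hρ1 : ρ ≤ 1 := by
    refine hρΦ.trans (le_trans ?_ hsm)
    rw [hK]
    have h1 : 4 * (T * C ^ 5 * Φ) ≤ C ^ 2 * (T * C ^ 5 * Φ) :=
      mul_le_mul_of_nonneg_right (by linarith) (by positivity)
    have h2 : T * C ^ 7 * Φ ≤ T ^ 2 * C ^ 24 * Φ := by
      gcongr
      norm_num
    linarith [h1, h2, (by ring : C ^ 2 * (T * C ^ 5 * Φ) = T * C ^ 7 * Φ)]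
  -- This is T C¹⁰ · 3K, since ρ + b ≤ 3KΦ.
  set ε := 6 * T ^ 2 * C ^ 15 * Φ with hε
  have hεi : ∀ i, ‖schurError γ A z i‖ ≤ ε * theta γ i := by
    intro i
    have hi := hγ.theta_pos i
    refine (schurError_le_of_minorBounds hγ hA hz hC hρ0 hρ1 hb hb1 hT hG (hmin i)
      (hap.diag_ge i) ?_).trans ?_
    · rw [Real.sq_sqrt (by positivity)]
      refine weighted_ward_of_bounds hγ hC hL hK1 hz hz10 hC0.le ?_ hlam0 ?_ i
        (fun k => norm_nonneg _) ?_ (fun k hk => le_lambdaO k i hk) (hap.diag_le i)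
      · have : C ≤ C ^ 3 := le_self_pow₀ hC1 (by norm_num)
        linarith
      · exact le_mul_of_one_le_left hlam0 (by linarith)
      · refine (sum_normSq_resolvent_le hA hz i).trans ?_
        rw [div_le_div_iff₀ hz (by positivity)]
        have := mul_le_mul_of_nonneg_right (hap.diag_le i) hz.le
        linarith
    · have h1 : ρ + b ≤ 3 * K * Φ := by linarith
      calc T * C ^ 10 * (ρ + b) * theta γ i ≤ T * C ^ 10 * (3 * K * Φ) * theta γ i := by gcongr
        _ = _ := by rw [hε, hK]; ring
  have hd := diag_bound_of_schurError hγ hA hz hC hu hsc hap (by positivity) hεi (by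
    refine le_trans ?_ hsm
    have h1 : 48 * (T ^ 2 * C ^ 22 * Φ) ≤ C ^ 2 * (T ^ 2 * C ^ 22 * Φ) :=
      mul_le_mul_of_nonneg_right (by linarith) (by positivity)
    rw [hε]
    linarith [h1, (by ring : C ^ 2 * (T ^ 2 * C ^ 22 * Φ) = T ^ 2 * C ^ 24 * Φ)])
  refine ⟨fun i => (hd i).trans ?_, fun i j hij => (le_lambdaO i j hij).trans
    (hlamK.trans ?_)⟩
  · have h1 : 6 * (T ^ 2 * C ^ 26 * Φ) ≤ C ^ 2 * (T ^ 2 * C ^ 26 * Φ) :=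
      mul_le_mul_of_nonneg_right (by linarith) (by positivity)
    have h2 := hpow (m := 28) (n := 30) (a := T ^ 2 * Φ) (by norm_num) (by positivity)
    rw [hε]
    linarith
  · have h1 : 4 * (T ^ 2 * C ^ 10 * Φ) ≤ C ^ 2 * (T ^ 2 * C ^ 10 * Φ) :=
      mul_le_mul_of_nonneg_right (by linarith) (by positivity)
    have h2 := hpow (m := 12) (n := 30) (a := T ^ 2 * Φ) (by norm_num) (by positivity)
    rw [hK]
    linarith

include hγ in
/-- The a priori bounds persist under small changes of the spectral parameter. -/
lemma aPriori_of_close {C ε : ℝ} (hC : 1 ≤ C) (hz : 0 < z.im)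
    (hu : IsSCSolution γ z u) (hsc : SCBounds γ z u C) (hε : 8 * C * ε ≤ 1) {w : ℂ}
    (h1 : ∀ i, theta γ i * ‖resolvent A w i i - scG γ z u i‖ ≤ ε)
    (h2 : ∀ i j, i ≠ j → √(theta γ i * theta γ j) * ‖resolvent A w i j‖ ≤ ε) :
    APriori γ A w (4 * C) := by
  have hC0 : 0 < C := by linarith
  have hε1 : ε ≤ 1 / (8 * C) := by rw [le_div_iff₀ (by positivity)]; linarith
  have hε2 : ε ≤ C := hε1.trans (by rw [div_le_iff₀ (by positivity)]; nlinarith)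
  -- The resolvent at w is compared with g at z, so continuity of the solution u in z is never
  -- needed.
  refine ⟨fun i => ?_, fun i => ?_, fun i j hij => (h2 i j hij).trans (by linarith), fun k => ?_⟩
  · have h3 := theta_mul_norm_scG_le hγ hC0 hz hsc.im_u i
    have h4 : ‖resolvent A w i i‖ ≤ ‖resolvent A w i i - scG γ z u i‖ + ‖scG γ z u i‖ := by
      have := norm_add_le (resolvent A w i i - scG γ z u i) (scG γ z u i)
      simpa using this
    have h5 := mul_le_mul_of_nonneg_left h4 (hγ.theta_pos i).le
    have h6 := h1 i
    linarith
  · have h3 := norm_scDenom_le hγ hsc.norm_z hsc.norm_u i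
    have h0 := norm_pos_iff.mpr (scDenom_ne_zero hγ hz (fun j => (hu j).1) i)
    have hθ := hγ.theta_pos i
    have h4 : 1 / (2 * C) ≤ theta γ i * ‖scG γ z u i‖ := by
      rw [norm_scG, mul_one_div, div_le_div_iff₀ (by positivity) h0]
      linarith
    have h5 : ‖scG γ z u i‖ ≤ ‖resolvent A w i i - scG γ z u i‖ + ‖resolvent A w i i‖ := by
      have := norm_sub_le (resolvent A w i i) (resolvent A w i i - scG γ z u i)
      rw [sub_sub_cancel] at this
      linarith
    have h6 := mul_le_mul_of_nonneg_left h5 hθ.le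
    have h7 := h1 i
    have h8 : 1 / (2 * C) - 1 / (8 * C) ≤ theta γ i * ‖resolvent A w i i‖ := by linarith
    have h9 : 1 / (2 * C) - 1 / (8 * C) = 3 / (8 * C) := by field_simp; norm_num
    rw [h9, div_le_iff₀ (by positivity)] at h8
    linarith
  · have h3 : ‖empU γ A w k - u k‖ ≤ ε := by
      rw [hu.eq_scMap k]
      have : empU γ A w k - scMap γ z u k =
          ((1 / (N : ℝ) : ℝ) : ℂ) * ∑ i, (γ k i : ℂ) * (resolvent A w i i - scG γ z u i) := by
        simp only [empU, scMap, mul_sub, Finset.sum_sub_distrib]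
      rw [this]
      exact norm_mean_gamma_le hγ k h1
    have h4 := (abs_le.mp ((Complex.abs_im_le_norm _).trans h3)).1
    rw [Complex.sub_im] at h4
    have h5 := hsc.im_u k
    have h6 : 1 / (4 * C) = 1 / C - 3 / (4 * C) := by field_simp; norm_num
    have h7 : 1 / (8 * C) ≤ 3 / (4 * C) := by
      rw [div_le_div_iff₀ (by positivity) (by positivity)]; nlinarith
    linarith

include hγ in
/-- The a priori bounds hold at distance of order one from the real axis. -/
lemma aPriori_of_one_le_im (hA : ∀ i j, A i j = A j i) (hz1 : 1 ≤ z.im)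
    {C T b : ℝ} (hC : 10 ≤ C) (hL : L ≤ C) (hzC : ‖z‖ ≤ C) (hT : 1 ≤ T) (hb : 0 ≤ b)
    (hb1 : b ≤ 1) (hsb : ∀ i j, varianceProfile γ i j ≤ b ^ 2)
    (hG : GoodAt γ b T A z) (hsm : T * C ^ 8 * b ≤ 1) :
    APriori γ A z (16 * C ^ 3) := by
  have hz : 0 < z.im := by linarith
  have hN := hγ.N_pos
  have hC0 : 0 < C := by linarith
  have hC1 : 1 ≤ C := by linarith
  have hT0 : 0 < T := by linarith
  have hzi : 1 / z.im ≤ 1 := (div_le_one hz).mpr hz1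
  have hRle : ∀ i k l, ‖minorRes A z i k l‖ ≤ 1 := by
    intro i k l
    simp only [minorRes]
    split_ifs
    · simp
    · exact (norm_resolvent_le (minor_symm hA i) hz k l).trans hzi
  have hRsum : ∀ i l, ∑ k, ‖minorRes A z i k l‖ ^ 2 ≤ 1 := by
    intro i l
    refine (sum_normSq_minorRes_le hA hz i l).trans ?_
    rw [div_le_one hz]
    exact (hRle i l l).trans hz1
  -- No weights are available yet: entries bounded by 1, Ward sums bounded by 1 and variances
  -- bounded by b² give the scale 2b.
  have hlin : ∀ i j, linScale (varianceProfile γ i) b (fun k => minorRes A z i k j) ≤ 2 * b := by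
    intro i j
    refine (linScale_le hb (a := b) (m := 1) hb zero_le_one ?_ fun k => hRle i k j).trans
      (le_of_eq (by ring))
    calc ∑ k, varianceProfile γ i k * ‖minorRes A z i k j‖ ^ 2
        ≤ ∑ k, b ^ 2 * ‖minorRes A z i k j‖ ^ 2 :=
          Finset.sum_le_sum fun k _ => mul_le_mul_of_nonneg_right (hsb i k) (by positivity)
      _ = b ^ 2 * ∑ k, ‖minorRes A z i k j‖ ^ 2 := by rw [Finset.mul_sum]
      _ ≤ b ^ 2 * 1 := mul_le_mul_of_nonneg_left (hRsum i j) (by positivity)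
      _ = _ := mul_one _
  have hssum : ∀ i, ∑ k, varianceProfile γ i k ≤ C * theta γ i := by
    intro i
    have h1 := hγ.sum_variance_mul_le i (f := fun _ => 1) fun _ => zero_le_one
    simp only [mul_one] at h1
    have h2 := mul_le_mul_of_nonneg_left (hγ.mean_theta_le.trans hL) (hγ.theta_pos i).le
    linarith
  have hθC : ∀ i, C * theta γ i ≤ (C * theta γ i) ^ 2 := fun i => by
    have : 1 ≤ C * theta γ i := one_le_mul_of_one_le_of_one_le hC1 (hγ.one_le_theta i)
    nlinarith
  set ε := 8 * C * T * b with hε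
  have hε0 : 0 ≤ ε := by positivity
  have hεi : ∀ i, ‖schurError γ A z i‖ ≤ ε * theta γ i := by
    intro i
    have hi1 := hγ.one_le_theta i
    have hi := hγ.theta_pos i
    have hx : 1 ≤ C * theta γ i := one_le_mul_of_one_le_of_one_le hC1 hi1
    have h1 : linScale (fun k => varianceProfile γ i k * b ^ 2) (b ^ 2)
        (fun k => minorRes A z i k k) ≤ 2 * C * theta γ i * b := by
      refine (linScale_le (by positivity) (a := C * theta γ i * b) (m := 1) (by positivity)
        zero_le_one ?_ fun k => hRle i k k).trans ?_
      · calc ∑ k, varianceProfile γ i k * b ^ 2 * ‖minorRes A z i k k‖ ^ 2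
            ≤ ∑ k, varianceProfile γ i k * b ^ 2 := by
              refine Finset.sum_le_sum fun k _ => mul_le_of_le_one_right ?_ ?_
              · exact mul_nonneg (hγ.variance_nonneg i k) (sq_nonneg _)
              · exact pow_le_one₀ (norm_nonneg _) (hRle i k k)
          _ = (∑ k, varianceProfile γ i k) * b ^ 2 := by rw [Finset.sum_mul]
          _ ≤ (C * theta γ i) ^ 2 * b ^ 2 :=
              mul_le_mul_of_nonneg_right ((hssum i).trans (hθC i)) (sq_nonneg _)
          _ = _ := by ring
      · nlinarith
    have h2 : quadScale (varianceProfile γ i) b (minorRes A z i) ≤ 4 * C * theta γ i * b := by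
      have hrow : ∀ k, ‖rowScale (varianceProfile γ i) b (minorRes A z i) k‖ ≤ 2 * b := by
        intro k
        rw [rowScale, Complex.norm_real, Real.norm_eq_abs, abs_of_nonneg (linScale_nonneg hb _)]
        refine (linScale_mono (hγ.variance_nonneg i) hb fun l => ?_).trans (hlin i k)
        split_ifs
        · rw [norm_zero]; exact norm_nonneg _
        · rw [minorRes_symm hA]
      refine (linScale_le hb (a := C * theta γ i * (2 * b)) (m := 2 * b) (by positivity)
        (by positivity) ?_ hrow).trans ?_
      · calc ∑ k, varianceProfile γ i k * ‖rowScale (varianceProfile γ i) b (minorRes A z i) k‖ ^ 2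
            ≤ ∑ k, varianceProfile γ i k * (2 * b) ^ 2 := by
              refine Finset.sum_le_sum fun k _ => ?_
              exact mul_le_mul_of_nonneg_left (pow_le_pow_left₀ (norm_nonneg _) (hrow k) 2)
                (hγ.variance_nonneg i k)
          _ = (∑ k, varianceProfile γ i k) * (2 * b) ^ 2 := by rw [Finset.sum_mul]
          _ ≤ (C * theta γ i) ^ 2 * (2 * b) ^ 2 :=
              mul_le_mul_of_nonneg_right ((hssum i).trans (hθC i)) (sq_nonneg _)
          _ = _ := by ring
      · nlinarith
    have h3 : (∑ k, varianceProfile γ i k * ‖resolvent A z k i‖ ^ 2) *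
        (1 / ‖resolvent A z i i‖) ≤ b := by
      have hG0 : 0 < ‖resolvent A z i i‖ := norm_pos_iff.mpr (resolvent_diag_ne_zero hA hz i)
      have h4 : ∑ k, varianceProfile γ i k * ‖resolvent A z k i‖ ^ 2 ≤
          b ^ 2 * ‖resolvent A z i i‖ := by
        calc ∑ k, varianceProfile γ i k * ‖resolvent A z k i‖ ^ 2
            ≤ ∑ k, b ^ 2 * ‖resolvent A z k i‖ ^ 2 :=
              Finset.sum_le_sum fun k _ => mul_le_mul_of_nonneg_right (hsb i k) (by positivity)
          _ = b ^ 2 * ∑ k, ‖resolvent A z k i‖ ^ 2 := by rw [Finset.mul_sum]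
          _ ≤ b ^ 2 * (‖resolvent A z i i‖ / z.im) :=
              mul_le_mul_of_nonneg_left (sum_normSq_resolvent_le hA hz i) (by positivity)
          _ ≤ _ := mul_le_mul_of_nonneg_left (div_le_self (norm_nonneg _) hz1) (by positivity)
      rw [mul_one_div, div_le_iff₀ hG0]
      refine h4.trans (mul_le_mul_of_nonneg_right ?_ hG0.le)
      nlinarith
    refine (norm_schurError_le hγ hA hz hG i).trans ?_
    have h1' := mul_le_mul_of_nonneg_left h1 hT0.le
    have h2' := mul_le_mul_of_nonneg_left h2 hT0.le
    have h5 : b ≤ T * (C * theta γ i) * b :=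
      le_mul_of_one_le_left hb (one_le_mul_of_one_le_of_one_le hT hx)
    rw [hε]
    nlinarith
  have hw0 := empU_im_pos hγ hA hz
  have hC3 : C ≤ C ^ 3 := le_self_pow₀ hC1 (by norm_num)
  have hsm' : 128 * C ^ 4 * T * b ≤ 1 := by
    refine le_trans ?_ hsm
    have h1 : 128 ≤ C ^ 4 := by
      have : (10 : ℝ) ^ 4 ≤ C ^ 4 := pow_le_pow_left₀ (by norm_num) hC 4
      linarith
    calc 128 * C ^ 4 * T * b ≤ C ^ 4 * C ^ 4 * T * b := by gcongr
      _ = _ := by ring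
  have hsm'' : 64 * C ^ 5 * T * b ≤ 1 := by
    refine le_trans ?_ hsm
    have h1 : 64 ≤ C ^ 3 := by
      have : (10 : ℝ) ^ 3 ≤ C ^ 3 := pow_le_pow_left₀ (by norm_num) hC 3
      linarith
    calc 64 * C ^ 5 * T * b ≤ C ^ 3 * C ^ 5 * T * b := by gcongr
      _ = _ := by ring
  have hg1 := norm_scG_le_one (z := z) hγ hz1 hw0
  have hGn : ∀ i, ‖resolvent A z i i‖ ≤ 1 := fun i => (norm_resolvent_diag_le hA hz i).trans hzi
  -- With only |G_ii|, |g_i| ≤ 1 the error keeps its factor θ_i; after averaging against γ it is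
  -- paid for by the second moment of θ.
  have hGg : ∀ i, ‖resolvent A z i i - scG γ z (empU γ A z) i‖ ≤ ε * theta γ i := by
    intro i
    rw [resolvent_sub_scG hγ hA hz]
    have hi := hγ.theta_pos i
    calc ‖schurError γ A z i‖ * ‖resolvent A z i i‖ * ‖scG γ z (empU γ A z) i‖
        ≤ (ε * theta γ i) * 1 * 1 :=
          mul_le_mul (mul_le_mul (hεi i) (hGn i) (norm_nonneg _) (by positivity)) (hg1 i)
            (norm_nonneg _) (by positivity)
      _ = _ := by ring
  have hUC : ∀ k, ‖empU γ A z k‖ ≤ C := fun k => by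
    have := norm_mean_gamma_le' hγ k (f := fun i => resolvent A z i i) zero_le_one
      fun i => (hGn i).trans (by rw [one_mul]; exact hγ.one_le_theta i)
    exact this.trans (by linarith)
  -- `empU` nearly solves the system, and `mean_scG_im_ge` bounds Im of the right-hand side below
  -- for any bounded argument in the upper half-plane; the error costs half of that bound.
  have him : ∀ k, 1 / (8 * C ^ 3) ≤ (empU γ A z k).im := by
    intro k
    have h1 : ‖empU γ A z k - scMap γ z (empU γ A z) k‖ ≤ ε * C := by
      rw [empU_sub_scMap]
      exact (norm_mean_gamma_le' hγ k hε0 hGg).trans (mul_le_mul_of_nonneg_left hL hε0)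
    have h2 := (abs_le.mp ((Complex.abs_im_le_norm _).trans h1)).1
    rw [Complex.sub_im] at h2
    have h3 := mean_scG_im_ge hγ hC0 hL hz1 hzC hw0 hUC
    have h4 := mean_im_le_scMap_im hγ hz hw0 k
    have h5 : ε * C ≤ 1 / (8 * C ^ 3) := by
      rw [le_div_iff₀ (by positivity), hε]
      linarith
    have h6 : 1 / (4 * C ^ 3) = 1 / (8 * C ^ 3) + 1 / (8 * C ^ 3) := by field_simp; norm_num
    linarith
  have hε16 : ε ≤ 1 / (16 * C ^ 3) := by
    rw [le_div_iff₀ (by positivity), hε]; linarith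
  have hGinv : ∀ i, (resolvent A z i i)⁻¹ = schurError γ A z i - scDenom γ z (empU γ A z) i :=
    fun i => by rw [schurError]; ring
  have hdiag : ∀ i, theta γ i * ‖resolvent A z i i‖ ≤ 16 * C ^ 3 := by
    intro i
    have hi := hγ.theta_pos i
    have hG0 : 0 < ‖resolvent A z i i‖ := norm_pos_iff.mpr (resolvent_diag_ne_zero hA hz i)
    have h1 : theta γ i / (16 * C ^ 3) ≤ ‖(resolvent A z i i)⁻¹‖ := by
      have h2 := theta_div_le_scDenom_im hγ hz him i
      have h3 := (le_abs_self _).trans (Complex.abs_im_le_norm (scDenom γ z (empU γ A z) i))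
      have h4 := hεi i
      have h5 := mul_le_mul_of_nonneg_right hε16 hi.le
      have h6 := norm_sub_norm_le (scDenom γ z (empU γ A z) i) (schurError γ A z i)
      rw [hGinv, norm_sub_rev]
      have h7 : theta γ i / (8 * C ^ 3) = 1 / (16 * C ^ 3) * theta γ i + theta γ i / (16 * C ^ 3) := by
        field_simp; norm_num
      linarith
    rw [norm_inv, ← one_div, div_le_div_iff₀ (by positivity) hG0] at h1
    linarith
  refine ⟨hdiag, fun i => ?_, ?_, fun k => ?_⟩
  · have hi := hγ.theta_pos i
    have hG0 : 0 < ‖resolvent A z i i‖ := norm_pos_iff.mpr (resolvent_diag_ne_zero hA hz i)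
    have h1 : ‖(resolvent A z i i)⁻¹‖ ≤ 16 * C ^ 3 * theta γ i := by
      rw [hGinv]
      refine (norm_sub_le _ _).trans ?_
      have h2 := norm_scDenom_le hγ hzC hUC i
      have h3 := hεi i
      have h4 : ε ≤ 1 := hε16.trans (by
        rw [div_le_one (by positivity)]; linarith)
      have h5 := mul_le_mul_of_nonneg_right h4 hi.le
      have h6 := mul_le_mul_of_nonneg_right hC3 hi.le
      have h7 := mul_le_mul_of_nonneg_right hC1 hi.le
      linarith
    rw [norm_inv, inv_le_iff_one_le_mul₀ hG0] at h1
    linarith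
  · have hmain : ∀ i j, j ≠ i → theta γ j ≤ theta γ i →
        √(theta γ j * theta γ i) * ‖resolvent A z j i‖ ≤ 16 * C ^ 3 := by
      intro i j hji hθ
      have hi := hγ.theta_pos i
      have hj := hγ.theta_pos j
      have h1 := norm_offdiag_le hA hz hG hji
      have h2 : √(theta γ j * theta γ i) ≤ theta γ i :=
        Real.sqrt_le_iff.mpr ⟨hi.le, by nlinarith⟩
      have h3 : T * (2 * b) ≤ 1 := by
        refine le_trans ?_ hsm'
        have : (1 : ℝ) ≤ C ^ 4 := one_le_pow₀ hC1
        have h4 : 0 ≤ T * b := by positivity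
        nlinarith
      have h5 : ‖resolvent A z j i‖ ≤ ‖resolvent A z i i‖ := by
        refine h1.trans (mul_le_of_le_one_left (norm_nonneg _) (le_trans ?_ h3))
        exact mul_le_mul_of_nonneg_left (hlin i j) hT0.le
      calc _ ≤ theta γ i * ‖resolvent A z i i‖ := mul_le_mul h2 h5 (norm_nonneg _) hi.le
        _ ≤ _ := hdiag i
    intro i j hij
    rcases le_total (theta γ i) (theta γ j) with h | h
    · exact hmain j i hij h
    · rw [resolvent_symm hA, mul_comm (theta γ i)]
      exact hmain i j hij.symm h
  · refine le_trans ?_ (him k)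
    apply one_div_le_one_div_of_le (by positivity)
    have := pow_pos hC0 3
    linarith

end Bootstrap

/-! ### Conditioning on independent entries; measurability -/

section Conditioning

variable {Ω : Type*} [MeasurableSpace Ω] {P : Measure Ω}

/-- If `X` and `Y` are independent, then an event that is unlikely for every fixed value of `Y` is
unlikely. -/
lemma measure_le_of_indepFun [IsProbabilityMeasure P] {α β : Type*} [MeasurableSpace α]
    [MeasurableSpace β] {X : Ω → α} {Y : Ω → β} (hX : Measurable X) (hY : Measurable Y)
    (h : IndepFun X Y P) {S : Set (α × β)} (hS : MeasurableSet S) {δ : ENNReal}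
    (hδ : ∀ y, P {ω | (X ω, y) ∈ S} ≤ δ) : P {ω | (X ω, Y ω) ∈ S} ≤ δ := by
  have h1 := (indepFun_iff_map_prod_eq_prod_map_map hX.aemeasurable hY.aemeasurable).mp h
  have h2 : P {ω | (X ω, Y ω) ∈ S} = (Measure.map (fun ω => (X ω, Y ω)) P) S :=
    (Measure.map_apply (hX.prodMk hY) hS).symm
  have : IsProbabilityMeasure (Measure.map Y P) := Measure.isProbabilityMeasure_map hY.aemeasurable
  have : IsProbabilityMeasure (Measure.map X P) := Measure.isProbabilityMeasure_map hX.aemeasurable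
  rw [h2, h1, Measure.prod_apply_symm hS]
  calc ∫⁻ y, (Measure.map X P) ((fun x => (x, y)) ⁻¹' S) ∂(Measure.map Y P)
      ≤ ∫⁻ _, δ ∂(Measure.map Y P) := by
        refine lintegral_mono fun y => ?_
        rw [Measure.map_apply hX (measurable_prodMk_right hS)]
        exact hδ y
    _ = δ := by simp

lemma measurable_det {n : ℕ} {β : Type*} [MeasurableSpace β] {F : β → Matrix (Fin n) (Fin n) ℂ}
    (hF : ∀ k l, Measurable fun y => F y k l) : Measurable fun y => (F y).det := by
  simp only [Matrix.det_apply]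
  refine Finset.measurable_sum _ fun σ _ => Measurable.const_smul ?_ _
  exact Finset.measurable_prod _ fun i _ => hF _ _

/-- Cramer's rule: the entries are quotients of determinants. -/
lemma measurable_matrix_inv {n : ℕ} {β : Type*} [MeasurableSpace β]
    {F : β → Matrix (Fin n) (Fin n) ℂ} (hF : ∀ k l, Measurable fun y => F y k l) (k l : Fin n) :
    Measurable fun y => (F y)⁻¹ k l := by
  simp only [Matrix.inv_def, Ring.inverse_eq_inv', Matrix.smul_apply, smul_eq_mul,
    Matrix.adjugate_apply]
  refine (measurable_det hF).inv.mul (measurable_det fun a b => ?_)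
  simp only [Matrix.updateRow_apply]
  split_ifs
  · exact measurable_const
  · exact hF a b

lemma measurable_resolvent {n : ℕ} {β : Type*} [MeasurableSpace β]
    {F : β → Matrix (Fin n) (Fin n) ℝ} (hF : ∀ k l, Measurable fun y => F y k l) (z : ℂ)
    (k l : Fin n) : Measurable fun y => resolvent (F y) z k l := by
  simp only [resolvent_eq]
  refine measurable_matrix_inv (fun a b => ?_) k l
  simp only [shifted_apply]
  exact (Complex.measurable_ofReal.comp (hF a b)).sub_const _

lemma measurable_linScale {n : ℕ} {β : Type*} [MeasurableSpace β] (s : Fin n → ℝ) (b : ℝ)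
    {c : β → Fin n → ℂ} (hc : ∀ k, Measurable fun y => c y k) :
    Measurable fun y => linScale s b (c y) := by
  have h : Measurable c := measurable_pi_lambda _ hc
  have h1 : Measurable fun y => ∑ k, s k * ‖c y k‖ ^ 2 :=
    Finset.measurable_sum _ fun k _ => ((hc k).norm.pow_const 2).const_mul _
  exact (Real.continuous_sqrt.measurable.comp h1).add (h.norm.const_mul b)

lemma measurable_quadScale {n : ℕ} {β : Type*} [MeasurableSpace β] (s : Fin n → ℝ) (b : ℝ)
    {B : β → Fin n → Fin n → ℂ} (hB : ∀ k l, Measurable fun y => B y k l) :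
    Measurable fun y => quadScale s b (B y) := by
  refine measurable_linScale s b fun k => Complex.measurable_ofReal.comp
    (measurable_linScale s b fun l => ?_)
  split_ifs
  · exact measurable_const
  · exact hB k l

end Conditioning

/-! ### Probability of the good event -/

section GoodEvent

variable {Ω : Type*} [MeasurableSpace Ω] {P : Measure Ω} {N r : ℕ} {q M : ℝ}
  {γ : Fin r → Fin N → ℝ} {H : Ω → Matrix (Fin N) (Fin N) ℝ}

lemma IsChungLuMatrix.isProfile (h : IsChungLuMatrix P q M γ H) (hN : 0 < N) (hr : 0 < r) :
    IsProfile q (r * M) γ := by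
  refine ⟨hN, hr, h.one_le, ?_, h.sparse⟩
  have h1 : ∀ i, theta γ i ^ 2 ≤ r * ∑ k, γ k i ^ 2 := by
    intro i
    have := sq_sum_le_card_mul_sum_sq (s := Finset.univ) (f := fun k => γ k i)
    simpa [theta] using this
  calc (1 / (N : ℝ)) * ∑ i, theta γ i ^ 2 ≤ (1 / (N : ℝ)) * ∑ i, r * ∑ k, γ k i ^ 2 :=
        mul_le_mul_of_nonneg_left (Finset.sum_le_sum fun i _ => h1 i) (by positivity)
    _ = r * ((1 / (N : ℝ)) * ∑ k, ∑ i, γ k i ^ 2) := by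
        rw [← Finset.mul_sum, Finset.sum_comm]; ring
    _ ≤ r * M := mul_le_mul_of_nonneg_left h.sum_sq_le (by positivity)

/-- The moment assumption implies that the entries are bounded. -/
lemma IsChungLuMatrix.ae_abs_le [IsProbabilityMeasure P] (h : IsChungLuMatrix P q M γ H)
    (hq : 1 ≤ q) (i j : Fin N) : ∀ᵐ ω ∂P, |H ω i j| ≤ 1 / √q := by
  have hq0 : 0 < q := by linarith
  have hsq : 0 < √q := Real.sqrt_pos.mpr hq0
  have key : ∀ n : ℕ, ∀ᵐ ω ∂P, |H ω i j| < 1 / √q + 1 / ((n : ℝ) + 1) := by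
    intro n
    set a := 1 / √q + 1 / ((n : ℝ) + 1) with ha
    have ha0 : 0 < a := by positivity
    have hba : 1 / √q < a := by
      have : 0 < 1 / ((n : ℝ) + 1) := by positivity
      linarith
    set c := varianceProfile γ i j * q with hc
    set ρ := (1 / √q) / a with hρ
    have hρ0 : 0 ≤ ρ := by positivity
    have hρ1 : ρ < 1 := (div_lt_one ha0).mpr hba
    -- Markov's inequality at order k. Since a > 1/√q the ratio ρ is below 1, and k → ∞ shows that
    -- the event is null.
    have hbound : ∀ k : ℕ, 3 ≤ k → P.real {ω | a ≤ |H ω i j|} ≤ c * ρ ^ k := by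
      intro k hk
      have h1 := mul_meas_ge_le_integral_of_nonneg (μ := P) (f := fun ω => |H ω i j| ^ k)
        (ae_of_all _ fun ω => by positivity) (h.integrable i j k) (a ^ k)
      have h2 : {ω | a ≤ |H ω i j|} ⊆ {ω | a ^ k ≤ |H ω i j| ^ k} := fun ω hω =>
        pow_le_pow_left₀ ha0.le hω k
      have h3 := measureReal_mono (μ := P) h2
      have h4 := h.moment i j k hk
      have h5 : varianceProfile γ i j / q ^ ((k : ℝ) / 2 - 1) = c * (1 / √q) ^ k := by
        have : q ^ ((k : ℝ) / 2 - 1) = √q ^ k / q := by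
          rw [Real.rpow_sub hq0, Real.rpow_one, Real.sqrt_eq_rpow, ← Real.rpow_natCast,
            ← Real.rpow_mul hq0.le]
          congr 2; ring
        rw [this, hc, one_div, inv_pow]
        field_simp
      rw [h5] at h4
      have h6 : a ^ k * P.real {ω | a ≤ |H ω i j|} ≤ c * (1 / √q) ^ k :=
        (mul_le_mul_of_nonneg_left h3 (by positivity)).trans (h1.trans h4)
      rw [hρ, div_pow, ← mul_div_assoc, le_div_iff₀ (by positivity)]
      linarith
    have hlim : Tendsto (fun k : ℕ => c * ρ ^ k) atTop (𝓝 (c * 0)) :=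
      (tendsto_pow_atTop_nhds_zero_of_lt_one hρ0 hρ1).const_mul c
    rw [mul_zero] at hlim
    have h0 : P.real {ω | a ≤ |H ω i j|} ≤ 0 :=
      ge_of_tendsto hlim (eventually_atTop.mpr ⟨3, hbound⟩)
    have h1 : P {ω | a ≤ |H ω i j|} = 0 := by
      rw [← measureReal_eq_zero_iff]
      exact le_antisymm h0 measureReal_nonneg
    rw [ae_iff]
    simpa using h1
  filter_upwards [ae_all_iff.mpr key] with ω hω
  have hl : Tendsto (fun n : ℕ => 1 / √q + 1 / ((n : ℝ) + 1)) atTop (𝓝 (1 / √q + 0)) :=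
    tendsto_const_nhds.add tendsto_one_div_add_atTop_nhds_zero_nat
  rw [add_zero] at hl
  exact ge_of_tendsto' hl fun n => (hω n).le

/-- The pairs of indices on and above the diagonal. -/
abbrev UpperPair (N : ℕ) := {p : Fin N × Fin N // p.1 ≤ p.2}

/-- The ordered pair of two indices. -/
def upperPair (k l : Fin N) : UpperPair N := ⟨(min k l, max k l), min_le_max⟩

lemma upperPair_injective (i : Fin N) : Function.Injective (upperPair i) := by
  intro k l h
  simp only [upperPair, Subtype.mk.injEq, Prod.mk.injEq] at h
  obtain ⟨h1, h2⟩ := h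
  rcases le_total i k with hk | hk <;> rcases le_total i l with hl | hl <;>
    simp only [min_eq_left, min_eq_right, max_eq_left, max_eq_right, hk, hl] at h1 h2 <;>
    simp_all

lemma IsChungLuMatrix.apply_upperPair (h : IsChungLuMatrix P q M γ H) (ω : Ω) (k l : Fin N) :
    H ω (upperPair k l).1.1 (upperPair k l).1.2 = H ω k l := by
  simp only [upperPair]
  rcases le_total k l with hkl | hkl
  · rw [min_eq_left hkl, max_eq_right hkl]
  · rw [min_eq_right hkl, max_eq_left hkl, h.symm]

lemma IsChungLuMatrix.integral_sq (h : IsChungLuMatrix P q M γ H) (i j : Fin N) :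
    ∫ ω, H ω i j ^ 2 ∂P = varianceProfile γ i j := by
  rw [← h.variance i j]
  simp only [sq_abs]

/-- Distinct k give distinct pairs {i, k}, so the row is a subfamily of the independent entries. The
variances are only bounded by the profile because the entry k = i is replaced by zero. -/
lemma IsChungLuMatrix.isBoundedFamily_row [IsProbabilityMeasure P]
    (h : IsChungLuMatrix P q M γ H) (hq : 1 ≤ q) (hN : 0 < N) (hr : 0 < r) (i : Fin N) :
    IsBoundedFamily P (fun k ω => rowVec (H ω) i k) (1 / √q) (varianceProfile γ i) := by
  have hγ := h.isProfile hN hr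
  refine ⟨fun k => ?_, ?_, fun k => ?_, fun k => ?_, fun k => ?_⟩
  · simp only [rowVec]
    split_ifs
    · exact measurable_const
    · exact h.measurable i k
  · have h1 := (h.indep.precomp (upperPair_injective i)).comp
      (fun k x => if k = i then (0 : ℝ) else x) fun k => by
        split_ifs
        · exact measurable_const
        · exact measurable_id
    convert h1 using 1
    funext k ω
    simp only [Function.comp, rowVec, h.apply_upperPair]
  · filter_upwards [h.ae_abs_le hq i k] with ω hω
    simp only [rowVec]
    split_ifs
    · rw [abs_zero]; positivity
    · exact hω
  · simp only [rowVec]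
    split_ifs
    · simp
    · exact h.mean i k
  · simp only [rowVec]
    split_ifs
    · simpa using hγ.variance_nonneg i k
    · exact (h.integral_sq i k).le

/-- The pairs of indices which contain `i`. -/
def pairsWith (i : Fin N) : Finset (UpperPair N) :=
  Finset.univ.filter fun p => p.1.1 = i ∨ p.1.2 = i

/-- The pairs of indices which do not contain `i`. -/
def pairsWithout (i : Fin N) : Finset (UpperPair N) :=
  Finset.univ.filter fun p => ¬(p.1.1 = i ∨ p.1.2 = i)

lemma upperPair_mem_pairsWith (i k : Fin N) : upperPair i k ∈ pairsWith i := by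
  simp only [pairsWith, Finset.mem_filter, Finset.mem_univ, true_and, upperPair]
  rcases le_total i k with h | h
  · left; exact min_eq_left h
  · right; exact max_eq_left h

lemma upperPair_mem_pairsWithout {i k l : Fin N} (h : ¬(k = i ∨ l = i)) :
    upperPair k l ∈ pairsWithout i := by
  simp only [pairsWithout, Finset.mem_filter, Finset.mem_univ, true_and, upperPair]
  rcases le_total k l with hkl | hkl
  · rwa [min_eq_left hkl, max_eq_right hkl]
  · rwa [min_eq_right hkl, max_eq_left hkl, or_comm]

/-- The symmetric matrix with vanishing row and column `i` built from its other entries. -/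
def matrixOfPairs (i : Fin N) (y : pairsWithout i → ℝ) : Matrix (Fin N) (Fin N) ℝ :=
  fun k l => if h : k = i ∨ l = i then 0 else y ⟨upperPair k l, upperPair_mem_pairsWithout h⟩

lemma matrixOfPairs_symm (i : Fin N) (y : pairsWithout i → ℝ) (k l : Fin N) :
    matrixOfPairs i y k l = matrixOfPairs i y l k := by
  have : upperPair k l = upperPair l k := by simp [upperPair, min_comm, max_comm]
  simp only [matrixOfPairs, or_comm (a := l = i), this]

lemma measurable_matrixOfPairs (i k l : Fin N) :
    Measurable fun y : pairsWithout i → ℝ => matrixOfPairs i y k l := by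
  simp only [matrixOfPairs]
  split_ifs
  · exact measurable_const
  · exact measurable_pi_apply _

/-- The resolvent of `matrixOfPairs`, with row and column `i` set to zero. -/
def pairsRes (i : Fin N) (z : ℂ) (y : pairsWithout i → ℝ) (k l : Fin N) : ℂ :=
  if k = i ∨ l = i then 0 else resolvent (matrixOfPairs i y) z k l

lemma pairsRes_symm (i : Fin N) (z : ℂ) (y : pairsWithout i → ℝ) (k l : Fin N) :
    pairsRes i z y k l = pairsRes i z y l k := by
  simp only [pairsRes, or_comm (a := l = i), resolvent_symm (matrixOfPairs_symm i y) k l]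

lemma measurable_pairsRes (i : Fin N) (z : ℂ) (k l : Fin N) :
    Measurable fun y => pairsRes i z y k l := by
  simp only [pairsRes]
  split_ifs
  · exact measurable_const
  · exact measurable_resolvent (measurable_matrixOfPairs i) z k l

/-- The entries of `H` outside of row and column `i`. -/
def entriesWithout (H : Ω → Matrix (Fin N) (Fin N) ℝ) (i : Fin N) (ω : Ω) :
    pairsWithout i → ℝ := fun p => H ω p.1.1.1 p.1.1.2

lemma IsChungLuMatrix.pairsRes_eq (h : IsChungLuMatrix P q M γ H) (i : Fin N) (z : ℂ) (ω : Ω)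
    (k l : Fin N) : pairsRes i z (entriesWithout H i ω) k l = minorRes (H ω) z i k l := by
  have : matrixOfPairs i (entriesWithout H i ω) = minor (H ω) i := by
    funext k l
    simp only [matrixOfPairs, minor, entriesWithout, h.apply_upperPair]
    split_ifs <;> rfl
  rw [pairsRes, minorRes, this]

/-- Row i and the remaining entries are functions of disjoint sets of independent entries. -/
lemma IsChungLuMatrix.indepFun_row (h : IsChungLuMatrix P q M γ H) (i : Fin N) :
    IndepFun (fun ω k => rowVec (H ω) i k) (entriesWithout H i) P := by
  have hd : Disjoint (pairsWith i) (pairsWithout i) := Finset.disjoint_filter_filter_not _ _ _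
  have h1 := h.indep.indepFun_finset _ _ hd fun p => h.measurable _ _
  have hφ : Measurable fun (x : pairsWith i → ℝ) (k : Fin N) =>
      if k = i then (0 : ℝ) else x ⟨upperPair i k, upperPair_mem_pairsWith i k⟩ := by
    refine measurable_pi_lambda _ fun k => ?_
    split_ifs
    · exact measurable_const
    · exact measurable_pi_apply _
  have h2 := h1.comp hφ measurable_id
  convert h2 using 1
  · funext ω k
    simp only [Function.comp, rowVec, h.apply_upperPair]
  · rfl

/-- Conditioning on the entries outside of row and column `i`. -/
lemma IsChungLuMatrix.measure_row_le [IsProbabilityMeasure P] (h : IsChungLuMatrix P q M γ H)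
    (i : Fin N) (z : ℂ) {f : (Fin N → Fin N → ℂ) → ℝ} {g : (Fin N → ℝ) → (Fin N → Fin N → ℂ) → ℝ}
    (hf : Measurable fun y => f (pairsRes i z y))
    (hg : Measurable fun p : (Fin N → ℝ) × (pairsWithout i → ℝ) => g p.1 (pairsRes i z p.2))
    {δ : ENNReal}
    (hδ : ∀ B : Fin N → Fin N → ℂ, (∀ k l, B k l = B l k) → (∀ k l, k = i ∨ l = i → B k l = 0) →
      P {ω | f B < g (rowVec (H ω) i) B} ≤ δ) :
    P {ω | f (minorRes (H ω) z i) < g (rowVec (H ω) i) (minorRes (H ω) z i)} ≤ δ := by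
  have hS : MeasurableSet {p : (Fin N → ℝ) × (pairsWithout i → ℝ) |
      f (pairsRes i z p.2) < g p.1 (pairsRes i z p.2)} :=
    measurableSet_lt (hf.comp measurable_snd) hg
  have hX : Measurable fun ω k => rowVec (H ω) i k := by
    refine measurable_pi_lambda _ fun k => ?_
    simp only [rowVec]
    split_ifs
    · exact measurable_const
    · exact h.measurable i k
  have hY : Measurable (entriesWithout H i) := measurable_pi_lambda _ fun p => h.measurable _ _
  have h1 := measure_le_of_indepFun hX hY (h.indepFun_row i) hS (δ := δ) fun y =>
    hδ (pairsRes i z y) (pairsRes_symm i z y) fun k l hkl => by simp [pairsRes, hkl]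
  have e : ∀ ω, pairsRes i z (entriesWithout H i ω) = minorRes (H ω) z i := fun ω => by
    funext k l; exact h.pairsRes_eq i z ω k l
  simp only [Set.mem_ofPred_eq, e] at h1
  exact h1

/-- The large deviation bounds hold with high probability. -/
lemma IsChungLuMatrix.measure_not_goodAt_le [IsProbabilityMeasure P]
    (h : IsChungLuMatrix P q M γ H) (hq : 1 ≤ q) (hN : 0 < N) (hr : 0 < r) (z : ℂ) {t : ℝ}
    (ht : 1 ≤ t) :
    P {ω | ¬ GoodAt γ (1 / √q) (8 * t ^ 2) (H ω) z} ≤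
      ENNReal.ofReal (16 * (N : ℝ) ^ 2 * Real.exp (1 - t)) := by
  have hγ := h.isProfile hN hr
  have hb : 0 < 1 / √q := by
    have : 0 < q := by linarith
    positivity
  set b := 1 / √q with hbdef
  have htt : 2 * t ≤ 8 * t ^ 2 := by nlinarith
  have hrow := h.isBoundedFamily_row hq hN hr
  set E := Real.exp (1 - t) with hE
  have hE0 : 0 < E := Real.exp_pos _
  have hres : ∀ (i k l : Fin N), Measurable fun p : (Fin N → ℝ) × (pairsWithout i → ℝ) =>
      pairsRes i z p.2 k l := fun i k l => (measurable_pairsRes i z k l).comp measurable_snd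
  have hcoord : ∀ (i k : Fin N), Measurable fun p : (Fin N → ℝ) × (pairsWithout i → ℝ) => p.1 k :=
    fun i k => (measurable_pi_apply k).comp measurable_fst
  have hlin : ∀ i j, P {ω | 8 * t ^ 2 * linScale (varianceProfile γ i) b
      (fun k => minorRes (H ω) z i k j) <
      ‖∑ k, (rowVec (H ω) i k : ℂ) * minorRes (H ω) z i k j‖} ≤ ENNReal.ofReal (4 * E) := by
    intro i j
    refine h.measure_row_le i z
      (f := fun B => 8 * t ^ 2 * linScale (varianceProfile γ i) b fun k => B k j)
      (g := fun x B => ‖∑ k, (x k : ℂ) * B k j‖) ?_ ?_ fun B _ _ => ?_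
    · exact (measurable_linScale _ _ fun k => measurable_pairsRes i z k j).const_mul _
    · refine Measurable.norm (Finset.measurable_sum _ fun k _ => ?_)
      exact (Complex.measurable_ofReal.comp (hcoord i k)).mul (hres i k j)
    · refine le_trans (measure_mono fun ω hω => ?_)
        ((hrow i).tail_linear hb (hγ.variance_nonneg i) (fun k => B k j) t)
      exact lt_of_le_of_lt (mul_le_mul_of_nonneg_right htt (linScale_nonneg hb.le _)) hω
  have hsq : ∀ i, P {ω | 8 * t ^ 2 * linScale (fun k => varianceProfile γ i k * b ^ 2) (b ^ 2)
      (fun k => minorRes (H ω) z i k k) <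
      ‖∑ k, ((rowVec (H ω) i k ^ 2 - varianceProfile γ i k : ℝ) : ℂ) * minorRes (H ω) z i k k‖} ≤
      ENNReal.ofReal (4 * E) := by
    intro i
    refine h.measure_row_le i z
      (f := fun B => 8 * t ^ 2 * linScale (fun k => varianceProfile γ i k * b ^ 2) (b ^ 2)
        fun k => B k k)
      (g := fun x B => ‖∑ k, ((x k ^ 2 - varianceProfile γ i k : ℝ) : ℂ) * B k k‖) ?_ ?_
      fun B _ hB0 => ?_
    · exact (measurable_linScale _ _ fun k => measurable_pairsRes i z k k).const_mul _
    · refine Measurable.norm (Finset.measurable_sum _ fun k _ => ?_)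
      exact (Complex.measurable_ofReal.comp (((hcoord i k).pow_const 2).sub_const _)).mul
        (hres i k k)
    · refine le_trans (measure_mono fun ω hω => ?_)
        ((hrow i).tail_square hb (hγ.variance_nonneg i) (fun k => B k k) t)
      -- At k = i the actual variance is 0 instead of s_ii, which is harmless because B vanishes
      -- there.
      have e : ∑ k, ((rowVec (H ω) i k ^ 2 - ∫ ω, rowVec (H ω) i k ^ 2 ∂P : ℝ) : ℂ) * B k k =
          ∑ k, ((rowVec (H ω) i k ^ 2 - varianceProfile γ i k : ℝ) : ℂ) * B k k := by
        refine Finset.sum_congr rfl fun k _ => ?_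
        by_cases hk : k = i
        · rw [hB0 k k (Or.inl hk), mul_zero, mul_zero]
        · simp only [rowVec, if_neg hk, h.integral_sq]
      simp only [Set.mem_ofPred_eq] at hω ⊢
      rw [e]
      exact lt_of_le_of_lt (mul_le_mul_of_nonneg_right htt
        (linScale_nonneg (by positivity) _)) hω
  have hquad : ∀ i, P {ω | 8 * t ^ 2 * quadScale (varianceProfile γ i) b (minorRes (H ω) z i) <
      ‖∑ k, ∑ l, (if k = l then 0 else
        (rowVec (H ω) i k : ℂ) * rowVec (H ω) i l * minorRes (H ω) z i k l)‖} ≤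
      ENNReal.ofReal ((N + 1) * (4 * E)) := by
    intro i
    refine h.measure_row_le i z
      (f := fun B => 8 * t ^ 2 * quadScale (varianceProfile γ i) b B)
      (g := fun x B => ‖∑ k, ∑ l, (if k = l then 0 else (x k : ℂ) * x l * B k l)‖) ?_ ?_
      fun B hBs _ => ?_
    · exact (measurable_quadScale _ _ fun k l => measurable_pairsRes i z k l).const_mul _
    · refine Measurable.norm (Finset.measurable_sum _ fun k _ => Finset.measurable_sum _
        fun l _ => ?_)
      split_ifs
      · exact measurable_const
      · exact ((Complex.measurable_ofReal.comp (hcoord i k)).mul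
          (Complex.measurable_ofReal.comp (hcoord i l))).mul (hres i k l)
    · exact (hrow i).tail_quadratic hb (hγ.variance_nonneg i) B hBs (by linarith)
  have hdiag : P {ω | ¬ ∀ i, |H ω i i| ≤ b} = 0 :=
    ae_iff.mp (ae_all_iff.mpr fun i => h.ae_abs_le hq i i)
  have hsub : {ω | ¬ GoodAt γ b (8 * t ^ 2) (H ω) z} ⊆ {ω | ¬ ∀ i, |H ω i i| ≤ b} ∪
      ⋃ i, ((⋃ j, {ω | 8 * t ^ 2 * linScale (varianceProfile γ i) b
          (fun k => minorRes (H ω) z i k j) <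
          ‖∑ k, (rowVec (H ω) i k : ℂ) * minorRes (H ω) z i k j‖}) ∪
        ({ω | 8 * t ^ 2 * linScale (fun k => varianceProfile γ i k * b ^ 2) (b ^ 2)
          (fun k => minorRes (H ω) z i k k) <
          ‖∑ k, ((rowVec (H ω) i k ^ 2 - varianceProfile γ i k : ℝ) : ℂ) *
            minorRes (H ω) z i k k‖} ∪
        {ω | 8 * t ^ 2 * quadScale (varianceProfile γ i) b (minorRes (H ω) z i) <
          ‖∑ k, ∑ l, (if k = l then 0 else
            (rowVec (H ω) i k : ℂ) * rowVec (H ω) i l * minorRes (H ω) z i k l)‖})) := by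
    intro ω hω
    by_contra hc
    simp only [Set.mem_union, Set.mem_iUnion, Set.mem_ofPred_eq, not_or, not_exists,
      not_lt, not_not] at hc
    exact hω ⟨hc.1, fun i j => (hc.2 i).1 j, fun i => (hc.2 i).2.1, fun i => (hc.2 i).2.2⟩
  refine (measure_mono hsub).trans ((measure_union_le _ _).trans ?_)
  rw [hdiag, zero_add]
  refine (measure_iUnion_fintype_le _ _).trans ?_
  have hper : ∀ i : Fin N, P ((⋃ j, {ω | 8 * t ^ 2 * linScale (varianceProfile γ i) b
          (fun k => minorRes (H ω) z i k j) <
          ‖∑ k, (rowVec (H ω) i k : ℂ) * minorRes (H ω) z i k j‖}) ∪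
        ({ω | 8 * t ^ 2 * linScale (fun k => varianceProfile γ i k * b ^ 2) (b ^ 2)
          (fun k => minorRes (H ω) z i k k) <
          ‖∑ k, ((rowVec (H ω) i k ^ 2 - varianceProfile γ i k : ℝ) : ℂ) *
            minorRes (H ω) z i k k‖} ∪
        {ω | 8 * t ^ 2 * quadScale (varianceProfile γ i) b (minorRes (H ω) z i) <
          ‖∑ k, ∑ l, (if k = l then 0 else
            (rowVec (H ω) i k : ℂ) * rowVec (H ω) i l * minorRes (H ω) z i k l)‖})) ≤
      ENNReal.ofReal ((2 * N + 2) * (4 * E)) := by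
    intro i
    have h1 : P (⋃ j, {ω | 8 * t ^ 2 * linScale (varianceProfile γ i) b
          (fun k => minorRes (H ω) z i k j) <
          ‖∑ k, (rowVec (H ω) i k : ℂ) * minorRes (H ω) z i k j‖}) ≤
        ENNReal.ofReal (N * (4 * E)) := by
      refine (measure_iUnion_fintype_le _ _).trans ?_
      refine (Finset.sum_le_sum fun j _ => hlin i j).trans ?_
      rw [Finset.sum_const, Finset.card_univ, Fintype.card_fin, nsmul_eq_mul,
        ENNReal.ofReal_mul (p := (N : ℝ)) (by positivity), ENNReal.ofReal_natCast]
    refine (measure_union_le _ _).trans ((add_le_add h1 ((measure_union_le _ _).trans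
      (add_le_add (hsq i) (hquad i)))).trans ?_)
    rw [← ENNReal.ofReal_add (by positivity) (by positivity),
      ← ENNReal.ofReal_add (by positivity) (by positivity)]
    exact ENNReal.ofReal_le_ofReal (by linarith)
  refine (Finset.sum_le_sum fun i _ => hper i).trans ?_
  rw [Finset.sum_const, Finset.card_univ, Fintype.card_fin, nsmul_eq_mul,
    ← ENNReal.ofReal_natCast, ← ENNReal.ofReal_mul (by positivity)]
  refine ENNReal.ofReal_le_ofReal ?_
  have hN1 : (1 : ℝ) ≤ N := Nat.one_le_cast.mpr hN
  have h2 : (N : ℝ) * ((2 * N + 2) * (4 * E)) = (8 * N ^ 2 + 8 * N) * E := by ring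
  have h3 : (8 * (N : ℝ) ^ 2 + 8 * N) ≤ 16 * N ^ 2 := by nlinarith
  rw [h2]
  exact mul_le_mul_of_nonneg_right h3 hE0.le

end GoodEvent

/-! ### Descent along a vertical grid -/

section Descent

variable {N r : ℕ} {q L : ℝ} {γ : Fin r → Fin N → ℝ} {z : ℂ}
  {A : Matrix (Fin N) (Fin N) ℝ}

lemma SCBounds.mono {u : Fin r → ℂ} {C C' : ℝ} (h : SCBounds γ z u C) (hC : 0 < C)
    (hCC : C ≤ C') : SCBounds γ z u C' := by
  have h1 : 1 / C' ≤ 1 / C := one_div_le_one_div_of_le hC hCC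
  exact ⟨h.norm_z.trans hCC, fun k => h1.trans (h.im_u k), fun k => (h.norm_u k).trans hCC,
    h1.trans h.im_m⟩

lemma APriori.mono (hγ : IsProfile q L γ) {C C' : ℝ} (h : APriori γ A z C) (hC : 0 < C)
    (hCC : C ≤ C') : APriori γ A z C' := by
  have h1 : 1 / C' ≤ 1 / C := one_div_le_one_div_of_le hC hCC
  refine ⟨fun i => (h.diag_le i).trans hCC, fun i => (h.diag_ge i).trans ?_,
    fun i j hij => (h.off_le i j hij).trans hCC, fun k => h1.trans (h.im_ge k)⟩
  exact mul_le_mul_of_nonneg_right hCC (mul_nonneg (hγ.theta_pos i).le (norm_nonneg _))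

lemma IsProfile.theta_le (hγ : IsProfile q L γ) (i : Fin N) : theta γ i ≤ N * L := by
  have hN := hγ.N_pos
  have h1 := Finset.single_le_sum (f := fun i => theta γ i) (fun i _ => (hγ.theta_pos i).le)
    (Finset.mem_univ i)
  have h2 := hγ.mean_theta_le
  rw [one_div, inv_mul_le_iff₀ hN] at h2
  exact h1.trans h2

/-- The points at which the bounds are propagated from `E + 10 i` down to `E + i η`. -/
def gridPoint (E η : ℝ) (K n : ℕ) : ℂ := ⟨E, 10 - (10 - η) * (n / K)⟩

lemma gridPoint_im {E η : ℝ} (hη10 : η ≤ 10) {K n : ℕ} (hK : 0 < K) (hn : n ≤ K) :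
    η ≤ (gridPoint E η K n).im ∧ (gridPoint E η K n).im ≤ 10 := by
  have hK0 : (0 : ℝ) < K := Nat.cast_pos.mpr hK
  have h1 : (n : ℝ) / K ≤ 1 := (div_le_one hK0).mpr (Nat.cast_le.mpr hn)
  have h2 : 0 ≤ (n : ℝ) / K := by positivity
  simp only [gridPoint]
  constructor <;> nlinarith

/-- Propagation of the a priori bounds along the grid. -/
lemma aPriori_gridPoint (hγ : IsProfile q L γ) (hA : ∀ i j, A i j = A j i) {E η C₀ C T b Φ : ℝ}
    {K : ℕ} (hK : 0 < K) (hη : 0 < η) (hη10 : η ≤ 10) (hηN : 1 ≤ N * η) {u : ℂ → Fin r → ℂ}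
    (hC₀ : 10 ≤ C₀) (hL : L ≤ C₀) (hC : C = 16 * C₀ ^ 3) (hT : 1 ≤ T) (hb : 0 ≤ b) (hb1 : b ≤ 1)
    (hΦ : Φ = b + 1 / √(N * η)) (hsb : ∀ i j, varianceProfile γ i j ≤ b ^ 2)
    (hu : ∀ n ≤ K, IsSCSolution γ (gridPoint E η K n) (u (gridPoint E η K n)))
    (hsc : ∀ n ≤ K, SCBounds γ (gridPoint E η K n) (u (gridPoint E η K n)) C₀)
    (hG : ∀ n ≤ K, GoodAt γ b T A (gridPoint E η K n))
    (hsm : 8 * C₀ * (T ^ 2 * C ^ 30 * Φ + 10 * L * N ^ 3 / K) ≤ 1) {n : ℕ} (hn : n ≤ K) :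
    APriori γ A (gridPoint E η K n) C := by
  have hN := hγ.N_pos
  have hK0 : (0 : ℝ) < K := Nat.cast_pos.mpr hK
  have hC₀1 : 1 ≤ C₀ := by linarith
  have hL0 : 0 ≤ L := le_trans (by
    have : ∀ i, 0 ≤ theta γ i ^ 2 := fun i => sq_nonneg _
    exact mul_nonneg (by positivity) (Finset.sum_nonneg fun i _ => this i)) hγ.sum_theta_sq
  have hC₀C : 4 * C₀ ≤ C := by
    have : C₀ ≤ C₀ ^ 3 := le_self_pow₀ hC₀1 (by norm_num)
    rw [hC]; linarith
  have hC10 : 10 ≤ C := by linarith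
  have hC1 : 1 ≤ C := by linarith
  have hΦ0 : 0 ≤ Φ := by rw [hΦ]; positivity
  have hbΦ : b ≤ Φ := by
    rw [hΦ]
    have : 0 ≤ 1 / √(N * η) := by positivity
    linarith
  have hx0 : 0 ≤ T ^ 2 * C ^ 30 * Φ := by positivity
  have hy0 : 0 ≤ 10 * L * N ^ 3 / (K : ℝ) := by positivity
  have hsm1 : T ^ 2 * C ^ 30 * Φ ≤ 1 := by nlinarith
  induction n with
  | zero =>
    have him : (gridPoint E η K 0).im = 10 := by simp [gridPoint]
    rw [hC]
    refine aPriori_of_one_le_im hγ hA (by rw [him]; norm_num) hC₀ hL (hsc 0 (Nat.zero_le _)).norm_z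
      hT hb hb1 hsb (hG 0 (Nat.zero_le _)) (le_trans ?_ hsm1)
    have h1 : T ≤ T ^ 2 := by nlinarith
    have h2 : C₀ ^ 8 ≤ C ^ 30 :=
      (pow_le_pow_left₀ (by linarith) (by linarith : C₀ ≤ C) 8).trans
        (pow_le_pow_right₀ hC1 (by norm_num))
    gcongr
  | succ n ih =>
    have hn' : n ≤ K := by omega
    have ih := ih hn'
    obtain ⟨hi1, hi2⟩ := gridPoint_im (E := E) hη10 hK hn'
    obtain ⟨hj1, hj2⟩ := gridPoint_im (E := E) hη10 hK hn
    set w := gridPoint E η K n with hw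
    set w' := gridPoint E η K (n + 1) with hw'
    have hwp : 0 < w.im := by linarith
    have hwp' : 0 < w'.im := by linarith
    have hΦw : b + 1 / √(N * w.im) ≤ Φ := by
      rw [hΦ]
      have : 1 / √(N * w.im) ≤ 1 / √(N * η) :=
        one_div_le_one_div_of_le (Real.sqrt_pos.mpr (by positivity))
          (Real.sqrt_le_sqrt (mul_le_mul_of_nonneg_left hi1 hN.le))
      linarith
    have hmono : ∀ m ≤ 30, T ^ 2 * C ^ m * (b + 1 / √(N * w.im)) ≤ T ^ 2 * C ^ 30 * Φ := by
      intro m hm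
      have := pow_le_pow_right₀ hC1 hm
      gcongr
    have hstep := bootstrap_step hγ hA hwp hi2 hC10 (by linarith) hT hb hb1 rfl
      (hu n hn') ((hsc n hn').mono (by linarith) (by linarith)) ih (hG n hn')
      ((hmono 24 (by norm_num)).trans hsm1)
    -- Neighbouring points are at most 10/K apart and N Im ≥ 1 at both. Together with weights of at
    -- most N L this is the source of 10 L N³ / K.
    have hdist : ∀ i j, ‖resolvent A w' i j - resolvent A w i j‖ ≤ 10 * N ^ 2 / K := by
      intro i j
      refine (norm_resolvent_sub_le hA hwp' hwp i j).trans ?_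
      have h1 : ‖w' - w‖ ≤ 10 / K := by
        have e : w' - w = ((-((10 - η) / K) : ℝ) : ℂ) * Complex.I := by
          apply Complex.ext
          · simp [hw, hw', gridPoint]
          · rw [Complex.im_ofReal_mul]
            simp only [hw, hw', gridPoint, Complex.sub_im, Complex.I_im]
            push_cast
            field_simp
            ring
        rw [e, norm_mul, Complex.norm_I, mul_one, Complex.norm_real, norm_neg, Real.norm_eq_abs,
          abs_of_nonneg (div_nonneg (by linarith) hK0.le)]
        exact div_le_div_of_nonneg_right (by linarith) hK0.le
      have h2 : 1 ≤ N ^ 2 * (w'.im * w.im) := by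
        have h3 : 1 ≤ N * w'.im := hηN.trans (mul_le_mul_of_nonneg_left hj1 hN.le)
        have h4 : 1 ≤ N * w.im := hηN.trans (mul_le_mul_of_nonneg_left hi1 hN.le)
        calc (1 : ℝ) ≤ (N * w'.im) * (N * w.im) := one_le_mul_of_one_le_of_one_le h3 h4
          _ = _ := by ring
      rw [div_le_iff₀ (mul_pos hwp' hwp)]
      calc ‖w' - w‖ ≤ 10 / K * 1 := by rw [mul_one]; exact h1
        _ ≤ 10 / K * (N ^ 2 * (w'.im * w.im)) := mul_le_mul_of_nonneg_left h2 (by positivity)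
        _ = _ := by ring
    have hθdist : ∀ (θ : ℝ) (i j : Fin N), 0 ≤ θ → θ ≤ N * L →
        θ * ‖resolvent A w' i j - resolvent A w i j‖ ≤ 10 * L * N ^ 3 / K := by
      intro θ i j h0 hθ
      calc θ * ‖resolvent A w' i j - resolvent A w i j‖ ≤ (N * L) * (10 * N ^ 2 / K) :=
            mul_le_mul hθ (hdist i j) (norm_nonneg _) (by positivity)
        _ = _ := by ring
    -- The new constant is 4C₀, where C₀ comes from the self-consistent solution alone. It is at
    -- most C, so nothing deteriorates with the number of steps.
    refine (aPriori_of_close hγ hC₀1 hwp (hu n hn') (hsc n hn') hsm (fun i => ?_)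
      fun i j hij => ?_).mono hγ (by linarith) hC₀C
    · have h1 := hθdist (theta γ i) i i (hγ.theta_pos i).le (hγ.theta_le i)
      have h2 := hstep.1 i
      have h3 := norm_sub_le_norm_sub_add_norm_sub (resolvent A w' i i) (resolvent A w i i)
        (scG γ w (u w) i)
      have h4 := mul_le_mul_of_nonneg_left h3 (hγ.theta_pos i).le
      have h5 := hmono 30 le_rfl
      linarith
    · have hi := hγ.theta_pos i
      have hj := hγ.theta_pos j
      have hs : √(theta γ i * theta γ j) ≤ N * L := by
        refine Real.sqrt_le_iff.mpr ⟨by positivity, ?_⟩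
        rw [sq]
        exact mul_le_mul (hγ.theta_le i) (hγ.theta_le j) hj.le (by positivity)
      have h1 := hθdist _ i j (Real.sqrt_nonneg (theta γ i * theta γ j)) hs
      have h2 := hstep.2 i j hij
      have h3 : ‖resolvent A w' i j‖ ≤
          ‖resolvent A w' i j - resolvent A w i j‖ + ‖resolvent A w i j‖ := by
        have := norm_add_le (resolvent A w' i j - resolvent A w i j) (resolvent A w i j)
        simpa using this
      have h4 := mul_le_mul_of_nonneg_left h3 (Real.sqrt_nonneg (theta γ i * theta γ j))
      have h5 := hmono 30 le_rfl
      linarith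

/-- The local law on the event that the large deviation bounds hold on the grid. -/
lemma lambda_le_of_goodAt (hγ : IsProfile q L γ) (hA : ∀ i j, A i j = A j i)
    {E η C₀ C T b Φ : ℝ}
    {K : ℕ} (hK : 0 < K) (hη : 0 < η) (hη10 : η ≤ 10) (hηN : 1 ≤ N * η) {u : ℂ → Fin r → ℂ}
    (hC₀ : 10 ≤ C₀) (hL : L ≤ C₀) (hC : C = 16 * C₀ ^ 3) (hT : 1 ≤ T) (hb : 0 ≤ b) (hb1 : b ≤ 1)
    (hΦ : Φ = b + 1 / √(N * η)) (hsb : ∀ i j, varianceProfile γ i j ≤ b ^ 2)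
    (hu : ∀ n ≤ K, IsSCSolution γ (gridPoint E η K n) (u (gridPoint E η K n)))
    (hsc : ∀ n ≤ K, SCBounds γ (gridPoint E η K n) (u (gridPoint E η K n)) C₀)
    (hG : ∀ n ≤ K, GoodAt γ b T A (gridPoint E η K n))
    (hsm : 8 * C₀ * (T ^ 2 * C ^ 30 * Φ + 10 * L * N ^ 3 / K) ≤ 1) :
    Lambda γ ⟨E, η⟩ (u ⟨E, η⟩) A ≤ T ^ 2 * C ^ 30 * Φ := by
  have hN := hγ.N_pos
  have hK0 : (0 : ℝ) < K := Nat.cast_pos.mpr hK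
  have hC₀1 : 1 ≤ C₀ := by linarith
  have hL0 : 0 ≤ L := le_trans (by
    have : ∀ i, 0 ≤ theta γ i ^ 2 := fun i => sq_nonneg _
    exact mul_nonneg (by positivity) (Finset.sum_nonneg fun i _ => this i)) hγ.sum_theta_sq
  have hC₀C : C₀ ≤ C := by
    have : C₀ ≤ C₀ ^ 3 := le_self_pow₀ hC₀1 (by norm_num)
    rw [hC]; linarith
  have hC1 : 1 ≤ C := by linarith
  have hΦ0 : 0 ≤ Φ := by rw [hΦ]; positivity
  have hx0 : 0 ≤ T ^ 2 * C ^ 30 * Φ := by positivity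
  have hy0 : 0 ≤ 10 * L * N ^ 3 / (K : ℝ) := by positivity
  have hsm1 : T ^ 2 * C ^ 30 * Φ ≤ 1 := by nlinarith
  have hap := aPriori_gridPoint hγ hA hK hη hη10 hηN hC₀ hL hC hT hb hb1 hΦ hsb hu hsc hG hsm
    le_rfl
  have he : gridPoint E η K K = ⟨E, η⟩ := by
    simp only [gridPoint]
    rw [div_self hK0.ne']
    congr 1; ring
  have hu' := hu K le_rfl
  have hsc' := hsc K le_rfl
  have hG' := hG K le_rfl
  rw [he] at hap hu' hsc' hG'
  have hstep := bootstrap_step hγ hA (z := ⟨E, η⟩) hη hη10 (by linarith) (by linarith) hT hb hb1 hΦ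
    hu' (hsc'.mono (by linarith) hC₀C) hap hG' (by
      refine le_trans ?_ hsm1
      have := pow_le_pow_right₀ hC1 (by norm_num : 24 ≤ 30)
      gcongr)
  exact max_le (Real.iSup_le hstep.1 hx0) (lambdaO_le hx0 hstep.2)

end Descent

/-! ### Elementary asymptotics in N -/

section Asymptotics

lemma tendsto_rpow_natCast_neg {a : ℝ} (ha : a < 0) :
    Tendsto (fun N : ℕ => (N : ℝ) ^ a) atTop (𝓝 0) := by
  have := (tendsto_rpow_neg_atTop (neg_pos.mpr ha)).comp (tendsto_natCast_atTop_atTop (R := ℝ))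
  simpa [Function.comp_def] using this

lemma eventually_rpow_mul_exp_le {a : ℝ} (ha : 0 < a) (B c : ℝ) (hc : 0 < c) :
    ∀ᶠ N : ℕ in atTop, c * (N : ℝ) ^ B * Real.exp (-(N : ℝ) ^ a) ≤ 1 := by
  have h1 := isLittleO_exp_neg_mul_rpow_atTop (a := 1) one_pos (-(B / a))
  have h2 := h1.def (c := c⁻¹) (by positivity)
  have h3 : Tendsto (fun N : ℕ => (N : ℝ) ^ a) atTop atTop :=
    (tendsto_rpow_atTop ha).comp tendsto_natCast_atTop_atTop
  filter_upwards [h3.eventually h2, eventually_gt_atTop 0] with N hN hN0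
  have hN0 : (0 : ℝ) < N := Nat.cast_pos.mpr hN0
  rw [Real.norm_eq_abs, Real.norm_eq_abs, abs_of_pos (Real.exp_pos _), abs_of_nonneg
    (by positivity), ← Real.rpow_mul hN0.le, neg_one_mul] at hN
  have e : a * -(B / a) = -B := by field_simp
  rw [e, Real.rpow_neg hN0.le] at hN
  have hB : 0 < (N : ℝ) ^ B := by positivity
  calc c * (N : ℝ) ^ B * Real.exp (-(N : ℝ) ^ a) ≤ c * (N : ℝ) ^ B * (c⁻¹ * ((N : ℝ) ^ B)⁻¹) :=
        mul_le_mul_of_nonneg_left hN (by positivity)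
    _ = 1 := by field_simp

end Asymptotics

end

end ChungLu

/-! ### The local law: choice of parameters and union bound -/

open ChungLu in
theorem theorem2p4 {Ω : ℕ → Type*} [∀ N, MeasurableSpace (Ω N)]
    (P : ∀ N, Measure (Ω N)) [∀ N, IsProbabilityMeasure (P N)]
    {r : ℕ} (κ M : ℝ) (γ : ∀ N, Fin r → Fin N → ℝ)
    (H : ∀ N, Ω N → Matrix (Fin N) (Fin N) ℝ)
    (hH : ChungLu.IsGeneralizedChungLu P κ M γ H)
    (u : ℕ → ℂ → Fin r → ℂ)
    (hu : ∀ᶠ N in atTop, ∀ z : ℂ, 0 < z.im → ChungLu.IsSCSolution (γ N) z (u N z))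
    (I : Set ℝ) (hI : ChungLu.IsBulkInterval γ u I)
    (δ : ℝ) (hδ : 0 < δ) :
    ChungLu.StochDominated P (ChungLu.spectralDomain I δ)
      (fun N z ω => ChungLu.Lambda (γ N) z (u N z) (H N ω))
      (fun N z _ => ChungLu.Phi κ N z) := by
  intro ε hε D hD
  obtain ⟨c, hc, hbulk⟩ := hI.im_lower
  obtain ⟨R, hR⟩ := hI.bounded.exists_norm_le
  have hκ := hH.kappa_pos
  set L := (r : ℝ) * M with hL
  -- C₁ bounds |z| on the grid; in C₀ the entry 4C₁³ serves Im z > 1 and 1/c serves the bulk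
  -- assumption for Im z ≤ 1.
  set C₁ := max (R + 10) (max 10 L) with hC₁
  have hC₁10 : 10 ≤ C₁ := (le_max_left _ _).trans (le_max_right _ _)
  have hC₁L : L ≤ C₁ := (le_max_right _ _).trans (le_max_right _ _)
  set C₀ := max (4 * C₁ ^ 3) (1 / c) with hC₀
  have hC₁C₀' : C₁ ≤ 4 * C₁ ^ 3 := by
    have : C₁ ≤ C₁ ^ 3 := le_self_pow₀ (by linarith) (by norm_num)
    linarith
  have hC₁C₀ : C₁ ≤ C₀ := hC₁C₀'.trans (le_max_left _ _)
  have hC₀10 : 10 ≤ C₀ := by linarith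
  set C := 16 * C₀ ^ 3 with hC
  have hC0 : 0 < C := by positivity
  -- T² = 64 N^{4a} must be beaten by N^{κ/2}, N^{δ/2} and N^ε.
  set a := min ε (min κ δ) / 16 with ha
  have hm0 : 0 < min ε (min κ δ) := lt_min hε (lt_min hκ hδ)
  have ha0 : 0 < a := by positivity
  have haε : 16 * a ≤ ε := by rw [ha]; linarith [min_le_left ε (min κ δ)]
  have haκ : 16 * a ≤ κ := by
    rw [ha]; linarith [(min_le_right ε (min κ δ)).trans (min_le_left κ δ)]
  have haδ : 16 * a ≤ δ := by
    rw [ha]; linarith [(min_le_right ε (min κ δ)).trans (min_le_right κ δ)]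
  have hsmall : ∀ᶠ N : ℕ in atTop, 8 * C₀ * (64 * C ^ 30 * ((N : ℝ) ^ (4 * a - κ / 2) +
      (N : ℝ) ^ (4 * a - δ / 2)) + 10 * L * (N : ℝ) ^ (-1 : ℝ)) ≤ 1 := by
    have h1 := tendsto_rpow_natCast_neg (a := 4 * a - κ / 2) (by linarith)
    have h2 := tendsto_rpow_natCast_neg (a := 4 * a - δ / 2) (by linarith)
    have h3 := tendsto_rpow_natCast_neg (a := -1) (by norm_num)
    have h4 := ((((h1.add h2).const_mul (64 * C ^ 30)).add (h3.const_mul (10 * L))).const_mul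
      (8 * C₀))
    simp only [add_zero, mul_zero] at h4
    exact h4.eventually (eventually_le_nhds zero_lt_one)
  have hlarge : ∀ᶠ N : ℕ in atTop, 64 * C ^ 30 * (N : ℝ) ^ (4 * a - ε) ≤ 1 := by
    have h1 := (tendsto_rpow_natCast_neg (a := 4 * a - ε) (by linarith)).const_mul (64 * C ^ 30)
    rw [mul_zero] at h1
    exact h1.eventually (eventually_le_nhds zero_lt_one)
  -- The exponent 6 is 4 for the grid points plus 2 for the events at each point; 32e is 2 · 16 · e.
  have hexp := eventually_rpow_mul_exp_le ha0 (6 + D) (32 * Real.exp 1) (by positivity)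
  filter_upwards [hH.eventually, hu, hbulk, hsmall, hlarge, hexp, eventually_gt_atTop 0] with
    N hM hu hbulk hsmall hlarge hexp hN
  have hN0 : (0 : ℝ) < N := Nat.cast_pos.mpr hN
  have hN1 : (1 : ℝ) ≤ N := Nat.one_le_cast.mpr hN
  have hγ : IsProfile (sparsity κ N) L (γ N) := hM.isProfile hN hH.rank_pos
  set q := sparsity κ N with hq
  have hq1 : 1 ≤ q := Real.one_le_rpow hN1 hκ.le
  have hq0 : 0 < q := by linarith
  set b := 1 / √q with hb
  have hb0 : 0 < b := by positivity
  have hb1 : b ≤ 1 := by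
    rw [hb, div_le_one (Real.sqrt_pos.mpr hq0)]; exact Real.one_le_sqrt.mpr hq1
  have hbN : b = (N : ℝ) ^ (-(κ / 2)) := by
    rw [hb, hq, sparsity, Real.sqrt_eq_rpow, ← Real.rpow_mul hN0.le, Real.rpow_neg hN0.le,
      one_div]
    congr 2; ring
  set t := (N : ℝ) ^ a with ht
  have ht1 : 1 ≤ t := Real.one_le_rpow hN1 ha0.le
  have hT1 : 1 ≤ 8 * t ^ 2 := by nlinarith
  have hT4 : (8 * t ^ 2) ^ 2 = 64 * (N : ℝ) ^ (4 * a) := by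
    have : (N : ℝ) ^ (4 * a) = t ^ 4 := by
      rw [ht, ← Real.rpow_natCast, ← Real.rpow_mul hN0.le]; congr 1; push_cast; ring
    rw [this]; ring
  refine iSup₂_le fun z hz => ?_
  obtain ⟨hzI, hzη, hz10⟩ := hz
  have hη : 0 < z.im := (by positivity : (0 : ℝ) < (N : ℝ) ^ (δ - 1)).trans_le hzη
  have hNη : (N : ℝ) ^ δ ≤ N * z.im := by
    calc (N : ℝ) ^ δ = N * (N : ℝ) ^ (δ - 1) := by
          rw [Real.rpow_sub hN0, Real.rpow_one]; field_simp
      _ ≤ _ := mul_le_mul_of_nonneg_left hzη hN0.le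
  have hNη1 : 1 ≤ N * z.im := (Real.one_le_rpow hN1 hδ.le).trans hNη
  have hΦδ : 1 / √(N * z.im) ≤ (N : ℝ) ^ (-(δ / 2)) := by
    have : (N : ℝ) ^ (-(δ / 2)) = 1 / √((N : ℝ) ^ δ) := by
      rw [Real.sqrt_eq_rpow, ← Real.rpow_mul hN0.le, Real.rpow_neg hN0.le, one_div]
      congr 2; ring
    rw [this]
    exact one_div_le_one_div_of_le (Real.sqrt_pos.mpr (by positivity)) (Real.sqrt_le_sqrt hNη)
  have hΦ : Phi κ N z = b + 1 / √(N * z.im) := rfl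
  have hΦ0 : 0 ≤ Phi κ N z := by rw [hΦ]; positivity
  -- Makes the grid error 10 L N³ / K equal to 10 L / N, with still polynomially many points.
  set K := N ^ 4 with hK
  have hK0 : 0 < K := by positivity
  have hsc : ∀ n ≤ K, SCBounds (γ N) (gridPoint z.re z.im K n)
      (u N (gridPoint z.re z.im K n)) C₀ := by
    intro n hn
    obtain ⟨h1, h2⟩ := gridPoint_im (E := z.re) hz10 hK0 hn
    have hp : 0 < (gridPoint z.re z.im K n).im := by linarith
    have hnorm : ‖gridPoint z.re z.im K n‖ ≤ C₁ := by
      refine (Complex.norm_le_abs_re_add_abs_im _).trans (le_trans ?_ (le_max_left _ _))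
      rw [abs_of_pos hp]
      have h3 : |(gridPoint z.re z.im K n).re| ≤ R := hR z.re hzI
      linarith
    by_cases h4 : (gridPoint z.re z.im K n).im ≤ 1
    · refine scBounds_of_im_m hγ (by linarith) hp (hnorm.trans hC₁C₀) (hu _ hp) ?_
      refine le_trans ?_ (hbulk z.re hzI _ hp h4).le
      rw [one_div_le (by linarith) hc]
      exact le_max_right _ _
    · exact (scBounds_of_one_le_im hγ (by linarith) hC₁L (not_le.mp h4).le hnorm (hu _ hp)).mono
        (by positivity) (le_max_left _ _)
  -- The grid ends at z itself and so depends on z. This is allowed because the supremum over z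
  -- stands outside the probability.
  have hsub : {ω | |Lambda (γ N) z (u N z) (H N ω)| > (N : ℝ) ^ ε * Phi κ N z} ⊆
      ⋃ n : Fin (K + 1), {ω | ¬ GoodAt (γ N) b (8 * t ^ 2) (H N ω)
        (gridPoint z.re z.im K n)} := by
    intro ω hω
    by_contra hcon
    simp only [Set.mem_iUnion, Set.mem_ofPred_eq, not_exists, not_not] at hcon
    have hG : ∀ n ≤ K, GoodAt (γ N) b (8 * t ^ 2) (H N ω) (gridPoint z.re z.im K n) :=
      fun n hn => hcon ⟨n, Nat.lt_succ_of_le hn⟩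
    have hLam := lambda_le_of_goodAt (u := u N) hγ (hM.symm ω) hK0 hη hz10 hNη1 hC₀10
      (hC₁L.trans hC₁C₀) hC hT1 hb0.le hb1 hΦ (fun i j => by
        rw [hb, div_pow, one_pow, Real.sq_sqrt hq0.le]
        exact hγ.variance_le_inv hq0 i j)
      (fun n hn => hu _ (hη.trans_le (gridPoint_im hz10 hK0 hn).1)) hsc hG (by
        refine le_trans (mul_le_mul_of_nonneg_left (add_le_add ?_ ?_) (by positivity)) hsmall
        · rw [hT4, hΦ, sub_eq_add_neg, sub_eq_add_neg, Real.rpow_add hN0, Real.rpow_add hN0,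
            ← hbN, ← mul_add]
          calc 64 * (N : ℝ) ^ (4 * a) * C ^ 30 * (b + 1 / √(N * z.im))
              ≤ 64 * (N : ℝ) ^ (4 * a) * C ^ 30 * (b + (N : ℝ) ^ (-(δ / 2))) := by gcongr
            _ = _ := by ring
        · rw [Real.rpow_neg_one, hK]
          push_cast
          refine le_of_eq ?_
          field_simp)
    have hLam0 : 0 ≤ Lambda (γ N) z (u N z) (H N ω) :=
      le_max_of_le_right lambdaO_nonneg
    simp only [Set.mem_ofPred_eq, abs_of_nonneg hLam0] at hω
    refine absurd (hLam.trans ?_) (not_le.mpr hω)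
    refine mul_le_mul_of_nonneg_right ?_ hΦ0
    rw [Real.rpow_sub hN0, ← mul_div_assoc, div_le_one (by positivity)] at hlarge
    rw [hT4]
    linarith
  refine (measure_mono hsub).trans ((measure_iUnion_fintype_le _ _).trans ?_)
  refine (Finset.sum_le_sum fun n _ => hM.measure_not_goodAt_le hq1 hN hH.rank_pos _ ht1).trans ?_
  rw [Finset.sum_const, Finset.card_univ, Fintype.card_fin, nsmul_eq_mul,
    ← ENNReal.ofReal_natCast, ← ENNReal.ofReal_mul (by positivity)]
  refine ENNReal.ofReal_le_ofReal ?_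
  have hK1 : ((K + 1 : ℕ) : ℝ) ≤ 2 * (N : ℝ) ^ 4 := by
    rw [hK]; push_cast
    have : (1 : ℝ) ≤ (N : ℝ) ^ 4 := one_le_pow₀ hN1
    linarith
  have hexp' : 32 * (N : ℝ) ^ 6 * Real.exp (1 - t) ≤ (N : ℝ) ^ (-D) := by
    rw [Real.rpow_add hN0] at hexp
    have e6 : (N : ℝ) ^ (6 : ℝ) = (N : ℝ) ^ 6 := by
      rw [← Real.rpow_natCast]; norm_num
    rw [e6] at hexp
    rw [Real.rpow_neg hN0.le, ← one_div, le_div_iff₀ (by positivity), sub_eq_add_neg, Real.exp_add]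
    linarith
  calc ((K + 1 : ℕ) : ℝ) * (16 * (N : ℝ) ^ 2 * Real.exp (1 - t))
      ≤ 2 * (N : ℝ) ^ 4 * (16 * (N : ℝ) ^ 2 * Real.exp (1 - t)) :=
        mul_le_mul_of_nonneg_right hK1 (by positivity)
    _ = 32 * (N : ℝ) ^ 6 * Real.exp (1 - t) := by ring
    _ ≤ _ := hexp'
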